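/- For a directed graph $G=(V,A)$ without self-loops or parallel arcs (both $(u,v)$ and $(v,u)$ may be present), an ordering of $V$ is a bijection $\pi\colon V\to\{1,\dots,|V|\}$, and an arc $(u,v)\in A$ is backward with respect to $\pi$ if $\pi(u)<\pi(v)$ does not hold. The (unweighted) Feedback Arc Set problem asks, given $G$, for an ordering $\pi$ of $V$ with the minimum number $\mathrm{opt}(G)$ of backward arcs. Theorem. For every constant $\varepsilon>0$ there is a constant $\delta_\varepsilon>0$ such that Feedback Arc Set can be $(1+\varepsilon)$-approximated in $O((2-\delta_\varepsilon)^n)$ time. That is, there is a deterministic algorithm which, given any such directed graph $G$ on $n$ vertices (as its adjacency matrix), outputs an ordering of its vertices with at most $(1+\varepsilon)\,\mathrm{opt}(G)$ backward arcs, and whose worst-case running time over all such graphs with $n$ vertices is $O((2-\delta_\varepsilon)^n)$. Here an algorithm is a program of a random access machine (with addition, truncated subtraction, multiplication, integer division, indirect addressing and conditional jumps), and running time is measured by the logarithmic cost criterion: each instruction costs one plus the total binary length of the numbers (operands and addresses) that it handles. -/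

import Mathlib

open Asymptotics Filter

/-! ### The problem: Feedback Arc Set as a vertex-ordering problem -/

/-- The number of backward arcs of the digraph `G` on `{0, …, n-1}` with respect to the ordering
`π`: arcs `(u, v)` for which `π u < π v` does not hold. -/
noncomputable def numBackwardArcs {n : ℕ} (G : Digraph (Fin n)) (π : Fin n ≃ Fin n) : ℕ :=
  Set.ncard {a : Fin n × Fin n | G.Adj a.1 a.2 ∧ ¬ π a.1 < π a.2}

/-- `π` is a `ρ`-approximate solution of Feedback Arc Set on `G`: it has at most `ρ` times as many
backward arcs as any ordering, in particular as an optimal one. -/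
def IsApproxOrdering {n : ℕ} (ρ : ℝ) (G : Digraph (Fin n)) (π : Fin n ≃ Fin n) : Prop :=
  ∀ σ : Fin n ≃ Fin n, (numBackwardArcs G π : ℝ) ≤ ρ * (numBackwardArcs G σ : ℝ)

/-! ### The machine model: random access machines with logarithmic cost -/

namespace RAM

/-- Instructions of a random access machine. Registers are named by constants of the program;
memory cells are addressed through the contents of registers. -/
inductive Instr : Type
  /-- `r_d := c` -/
  | const (d c : ℕ)
  /-- `r_d := r_a + r_b` -/
  | add (d a b : ℕ)
  /-- `r_d := max (r_a - r_b) 0` -/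
  | sub (d a b : ℕ)
  /-- `r_d := r_a * r_b` -/
  | mul (d a b : ℕ)
  /-- `r_d := ⌊r_a / r_b⌋`, and `0` if `r_b = 0` -/
  | div (d a b : ℕ)
  /-- `r_d := mem[r_a]` -/
  | load (d a : ℕ)
  /-- `mem[r_a] := r_b` -/
  | store (a b : ℕ)
  /-- continue at instruction `l` -/
  | jump (l : ℕ)
  /-- continue at instruction `l` if `r_a = 0` -/
  | jumpZero (a l : ℕ)

/-- A program is a finite list of instructions; it halts when the program counter leaves it. -/
abbrev Program : Type := List Instr

/-- A configuration: program counter, registers and memory, all holding natural numbers. -/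
structure Config : Type where
  pc : ℕ
  reg : ℕ → ℕ
  mem : ℕ → ℕ

/-- Go on to the next instruction after setting register `d` to `x`. -/
def Config.setReg (c : Config) (d x : ℕ) : Config :=
  ⟨c.pc + 1, Function.update c.reg d x, c.mem⟩

/-- The effect of one instruction. -/
def Instr.exec : Instr → Config → Config
  | .const d x, c => c.setReg d x
  | .add d a b, c => c.setReg d (c.reg a + c.reg b)
  | .sub d a b, c => c.setReg d (c.reg a - c.reg b)
  | .mul d a b, c => c.setReg d (c.reg a * c.reg b)
  | .div d a b, c => c.setReg d (c.reg a / c.reg b)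
  | .load d a, c => c.setReg d (c.mem (c.reg a))
  | .store a b, c => ⟨c.pc + 1, c.reg, Function.update c.mem (c.reg a) (c.reg b)⟩
  | .jump l, c => ⟨l, c.reg, c.mem⟩
  | .jumpZero a l, c => ⟨if c.reg a = 0 then l else c.pc + 1, c.reg, c.mem⟩

/-- The logarithmic cost of one instruction: one plus the binary lengths of all the numbers
(operands and addresses) that it handles. -/
def Instr.cost : Instr → Config → ℕ
  | .const _ x, _ => 1 + Nat.size x
  | .add _ a b, c => 1 + Nat.size (c.reg a) + Nat.size (c.reg b)
  | .sub _ a b, c => 1 + Nat.size (c.reg a) + Nat.size (c.reg b)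
  | .mul _ a b, c => 1 + Nat.size (c.reg a) + Nat.size (c.reg b)
  | .div _ a b, c => 1 + Nat.size (c.reg a) + Nat.size (c.reg b)
  | .load _ a, c => 1 + Nat.size (c.reg a) + Nat.size (c.mem (c.reg a))
  | .store a b, c => 1 + Nat.size (c.reg a) + Nat.size (c.reg b)
  | .jump _, _ => 1
  | .jumpZero a _, c => 1 + Nat.size (c.reg a)

/-- `HaltsIn P c t c'`: started in configuration `c`, the program `P` halts in configuration `c'`
after a computation of total cost `t`. -/
inductive HaltsIn (P : Program) : Config → ℕ → Config → Prop
  | halt (c : Config) (h : P[c.pc]? = none) : HaltsIn P c 0 c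
  | step (c : Config) (i : Instr) (t : ℕ) (c' : Config) (h : P[c.pc]? = some i)
      (hrun : HaltsIn P (i.exec c) t c') : HaltsIn P c (i.cost c + t) c'

/-- A memory holding the adjacency matrix of `G`, row by row: cell `n * u + v` holds `1` if
`(u, v)` is an arc of `G`, and all the other cells hold `0`. -/
noncomputable def adjMemory {n : ℕ} (G : Digraph (Fin n)) : ℕ → ℕ :=
  open Classical in
  fun x => if ∃ u v : Fin n, x = n * (u : ℕ) + (v : ℕ) ∧ G.Adj u v then 1 else 0

/-- The initial configuration on input `G`: register `0` holds the number `n` of vertices, all the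
other registers hold `0`, and the memory holds the adjacency matrix. -/
noncomputable def inputConfig {n : ℕ} (G : Digraph (Fin n)) : Config :=
  ⟨0, fun r => if r = 0 then n else 0, adjMemory G⟩

/-- The final memory presents the ordering `π`: for each vertex `v`, cell `v` holds its position
`π v` (positions being counted from `0`). -/
def Config.Outputs {n : ℕ} (c : Config) (π : Fin n ≃ Fin n) : Prop :=
  ∀ v : Fin n, c.mem (v : ℕ) = (π v : ℕ)

/-- The program `P` is a `ρ`-approximation algorithm for Feedback Arc Set whose running time on
simple digraphs (no self-loops) with `n` vertices is at most `T n`. -/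
def ApproximatesFAS (P : Program) (ρ : ℝ) (T : ℕ → ℕ) : Prop :=
  ∀ (n : ℕ) (G : Digraph (Fin n)), (∀ v, ¬ G.Adj v v) →
    ∃ (t : ℕ) (c : Config) (π : Fin n ≃ Fin n),
      HaltsIn P (inputConfig G) t c ∧ t ≤ T n ∧ c.Outputs π ∧ IsApproxOrdering ρ G π

end RAM

/-! The exact dynamic program builds an ordering by adding vertices one at a time and has a state
for each of the `2 ^ n` sets of vertices. It is made faster on a window `W` of `q = n / k` vertices,
with `k` at least about `20 / ε`. Let `opt` be the number of backward arcs of an optimal ordering.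
Averaging over the `n` cyclic windows gives one with at most `β ≤ 2 * opt / k` backward arcs
incident to it (`exists_rotation`). An extra cost of `10 * β` is therefore affordable. All windows
are tried, so the right one need not be known.

Let `Z` be a subset of `W` with at least `q / 2` vertices and as few inner arcs as possible, say `m`
of them.

If `m ≤ 8 * β`, the vertices of `Z` are left out of the dynamic program, which saves a factor of at
least `2 ^ (q / 2)`. Each vertex of `Z` is inserted at the first moment when it has more arcs to the
vertices already placed than it has from the remaining vertices outside `Z`. At the threshold the
two counts nearly balance, so the insertion costs at most twice what the vertex costs in any given
ordering (`outTo_add_inFrom_le`). Arcs inside `Z` are all paid for. The total is at most `opt + 2 *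
β + 8 * β`.

If `m > 8 * β`, every initial segment of an optimal ordering is entered within `W` by at most `β < m
/ 8` arcs, so only traces on `W` with this property need be considered. They are few
(`card_family_le`): while at least half of `W` remains, it contains `m` arcs, so some arc is
violated by at most an eighth of the family (`exists_arc_rarely_violated`). The other three patterns
on its endpoints carry the remaining seven eighths, so deleting the endpoints gains the factor `8 /
7 * 3 / 4 = 6 / 7`. After `q / 4` rounds, at most `(6 / 7) ^ (q / 4) * 2 ^ q` traces remain.

`β` is unknown, so both modes are run and the best result is kept. `numGood_le` bounds the states of
both modes, `exists_candidate` shows that one of them is good enough, and `Path.sum_le` shows that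
no result is worse than its computed cost.

The ordering is not recovered by backtracking. Each vertex receives a sort key, the keys are digits
in base `2 * n + 2` below the cost, and the combined number is additive along paths
(`stepWeight_eq`). The optimal table entry thus contains the whole ordering (`decode`). Entries are
stored as a large constant minus the weight, so minima become maxima and an untouched cell, holding
`0`, means that no path is known.

For the machine, `Comp` and `CompC` give a small language of expressions and loops whose translation
costs a polynomial factor, because all stored numbers have polynomially many bits. The gap between
`2 * (1 - δ)` and `2 - δ` absorbs this factor. -/

namespace RAM

/-! ### Relocatable code fragments -/

/-- `Reach P c t c'`: the program `P` gets from `c` to `c'` by a computation of cost `t`. -/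
inductive Reach (P : Program) : Config → ℕ → Config → Prop
  | refl (c : Config) : Reach P c 0 c
  | step (c : Config) (i : Instr) (t : ℕ) (c' : Config) (h : P[c.pc]? = some i)
      (hr : Reach P (i.exec c) t c') : Reach P c (i.cost c + t) c'

theorem Reach.trans {P : Program} {c c' c'' : Config} {s t : ℕ} (h : Reach P c s c')
    (h' : Reach P c' t c'') : Reach P c (s + t) c'' := by
  induction h with
  | refl c => simpa using h'
  | step c i t c' hi _ ih => rw [add_assoc]; exact .step _ _ _ _ hi (ih h')

theorem Reach.single {P : Program} {c : Config} {i : Instr} (h : P[c.pc]? = some i) :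
    Reach P c (i.cost c) (i.exec c) := by
  simpa using Reach.step c i 0 _ h (.refl _)

theorem Reach.haltsIn {P : Program} {c c' : Config} {t : ℕ} (h : Reach P c t c')
    (hc : P[c'.pc]? = none) : HaltsIn P c t c' := by
  induction h with
  | refl c => exact .halt c hc
  | step c i t c' hi _ ih => exact .step _ _ _ _ hi (ih hc)

/-- The list `l` of instructions occurs in `P` at position `off`. -/
def Placed (P : Program) (off : ℕ) (l : List Instr) : Prop :=
  ∀ i < l.length, P[off + i]? = l[i]?

theorem Placed.left {P : Program} {off : ℕ} {l₁ l₂ : List Instr} (h : Placed P off (l₁ ++ l₂)) :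
    Placed P off l₁ := fun i hi => by
  rw [h i (by simp; omega), List.getElem?_append_left hi]

theorem Placed.right {P : Program} {off : ℕ} {l₁ l₂ : List Instr} (h : Placed P off (l₁ ++ l₂)) :
    Placed P (off + l₁.length) l₂ := fun i hi => by
  rw [add_assoc, h (l₁.length + i) (by simp; omega), List.getElem?_append_right (by omega)]
  simp

theorem Placed.head {P : Program} {off : ℕ} {i : Instr} {l : List Instr}
    (h : Placed P off (i :: l)) : P[off]? = some i := by
  simpa using h 0 (by simp)

/-- A relocatable piece of code. -/
structure Frag where
  len : ℕ
  -- Jump targets are absolute, so the instructions depend on the position of the code.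
  code : ℕ → List Instr
  length_code : ∀ off, (code off).length = len

/-- The fragment `F`, started at its beginning with registers `r` and memory `m`, leaves at its end
with registers `r'` and memory `m'`, at cost `t`. -/
def Frag.Runs (F : Frag) (r m : ℕ → ℕ) (t : ℕ) (r' m' : ℕ → ℕ) : Prop :=
  ∀ (P : Program) (off : ℕ), Placed P off (F.code off) →
    Reach P ⟨off, r, m⟩ t ⟨off + F.len, r', m'⟩

/-- Concatenation of fragments. -/
def Frag.seq (F G : Frag) : Frag where
  len := F.len + G.len
  code off := F.code off ++ G.code (off + F.len)
  length_code off := by simp [F.length_code, G.length_code]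

theorem Frag.Runs.seq {F G : Frag} {r m r' m' r'' m'' : ℕ → ℕ} {s t : ℕ}
    (hF : F.Runs r m s r' m') (hG : G.Runs r' m' t r'' m'') :
    (F.seq G).Runs r m (s + t) r'' m'' := fun P off hP => by
  have h1 := hF P off hP.left
  have h2 := hG P (off + F.len) (by simpa [F.length_code] using hP.right)
  simpa [Frag.seq, add_assoc] using h1.trans h2

/-- The fragment of a single instruction. -/
def Frag.one (i : Instr) : Frag := ⟨1, fun _ => [i], fun _ => rfl⟩

theorem Frag.runs_one {i : Instr} {r m r' m' : ℕ → ℕ} {t : ℕ}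
    (hexec : ∀ pc, i.exec ⟨pc, r, m⟩ = ⟨pc + 1, r', m'⟩) (hcost : ∀ pc, i.cost ⟨pc, r, m⟩ = t) :
    (Frag.one i).Runs r m t r' m' := fun P off hP => by
  have := Reach.single (P := P) (c := ⟨off, r, m⟩) (i := i) hP.head
  rwa [hexec, hcost] at this

theorem Frag.runs_const (d x : ℕ) (r m : ℕ → ℕ) :
    (Frag.one (.const d x)).Runs r m (1 + Nat.size x) (Function.update r d x) m :=
  runs_one (fun _ => rfl) fun _ => rfl

theorem Frag.runs_add (d a b : ℕ) (r m : ℕ → ℕ) :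
    (Frag.one (.add d a b)).Runs r m (1 + Nat.size (r a) + Nat.size (r b))
      (Function.update r d (r a + r b)) m :=
  runs_one (fun _ => rfl) fun _ => rfl

theorem Frag.runs_sub (d a b : ℕ) (r m : ℕ → ℕ) :
    (Frag.one (.sub d a b)).Runs r m (1 + Nat.size (r a) + Nat.size (r b))
      (Function.update r d (r a - r b)) m :=
  runs_one (fun _ => rfl) fun _ => rfl

theorem Frag.runs_mul (d a b : ℕ) (r m : ℕ → ℕ) :
    (Frag.one (.mul d a b)).Runs r m (1 + Nat.size (r a) + Nat.size (r b))
      (Function.update r d (r a * r b)) m :=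
  runs_one (fun _ => rfl) fun _ => rfl

theorem Frag.runs_div (d a b : ℕ) (r m : ℕ → ℕ) :
    (Frag.one (.div d a b)).Runs r m (1 + Nat.size (r a) + Nat.size (r b))
      (Function.update r d (r a / r b)) m :=
  runs_one (fun _ => rfl) fun _ => rfl

theorem Frag.runs_load (d a : ℕ) (r m : ℕ → ℕ) :
    (Frag.one (.load d a)).Runs r m (1 + Nat.size (r a) + Nat.size (m (r a)))
      (Function.update r d (m (r a))) m :=
  runs_one (fun _ => rfl) fun _ => rfl

theorem Frag.runs_store (a b : ℕ) (r m : ℕ → ℕ) :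
    (Frag.one (.store a b)).Runs r m (1 + Nat.size (r a) + Nat.size (r b))
      r (Function.update m (r a) (r b)) :=
  runs_one (fun _ => rfl) fun _ => rfl

/-- Repeat `F` until register `c` holds zero. -/
def Frag.while (c : ℕ) (F : Frag) : Frag where
  len := F.len + 2
  code off := .jumpZero c (off + (F.len + 2)) :: (F.code (off + 1) ++ [.jump off])
  length_code off := by simp [F.length_code]

theorem Frag.runs_while_zero {c : ℕ} {F : Frag} {r m : ℕ → ℕ} (h : r c = 0) :
    (Frag.while c F).Runs r m 1 r m := fun P off hP => by
  have := Reach.single (P := P) (c := ⟨off, r, m⟩) hP.head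
  simpa [Instr.exec, Instr.cost, h, Frag.while] using this

theorem Frag.runs_while_succ {c : ℕ} {F : Frag} {r m r' m' r'' m'' : ℕ → ℕ} {s t : ℕ}
    (h : r c ≠ 0) (hF : F.Runs r m s r' m') (hw : (Frag.while c F).Runs r' m' t r'' m'') :
    (Frag.while c F).Runs r m (1 + Nat.size (r c) + s + 1 + t) r'' m'' := fun P off hP => by
  have h1 := Reach.single (P := P) (c := ⟨off, r, m⟩) hP.head
  have hP' : Placed P (off + 1) (F.code (off + 1) ++ [.jump off]) := by
    have : Placed P off ([.jumpZero c (off + (F.len + 2))] ++ (F.code (off + 1) ++ [.jump off])) :=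
      hP
    simpa using this.right
  have h2 := hF P (off + 1) hP'.left
  have h3 : P[off + 1 + F.len]? = some (.jump off) := by
    have := hP'.right
    rw [F.length_code] at this
    exact this.head
  have h3 := Reach.single (P := P) (c := ⟨off + 1 + F.len, r', m'⟩) h3
  have h4 := hw P off hP
  simp only [Instr.exec, Instr.cost, h, if_false] at h1 h3
  simpa [add_assoc] using ((h1.trans h2).trans h3).trans h4

/-- Run `body` for each value of register `idx` below the value of register `ctr`;
register `one` is scratch. -/
def Frag.for (ctr idx one : ℕ) (body : Frag) : Frag :=
  (Frag.one (.const idx 0)).seq <| Frag.while ctr <|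
    body.seq <| (Frag.one (.const one 1)).seq <| (Frag.one (.sub ctr ctr one)).seq <|
      Frag.one (.add idx idx one)

/-- The counter runs down while the index runs up. The bookkeeping between two iterations writes
only to `ctr`, `idx` and `one`; `hstab` says that the invariant does not see these registers. The
term `10 * (Nat.size N + 1)` covers the test, the jump and the three bookkeeping instructions. -/
theorem Frag.runs_for {ctr idx one : ℕ} (hci : ctr ≠ idx) (hco : ctr ≠ one) (hio : idx ≠ one)
    {body : Frag} (Inv : ℕ → (ℕ → ℕ) → (ℕ → ℕ) → Prop) (N : ℕ) (b : ℕ → ℕ)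
    (hbody : ∀ j < N, ∀ r m, Inv j r m → r idx = j → ∃ r' m' k, body.Runs r m k r' m' ∧ k ≤ b j ∧
      Inv (j + 1) r' m' ∧ r' ctr = r ctr ∧ r' idx = j)
    (hstab : ∀ j r r' m, (∀ i, i ≠ ctr → i ≠ idx → i ≠ one → r' i = r i) → Inv j r m →
      Inv j r' m)
    (r m : ℕ → ℕ) (h0 : Inv 0 r m) (hN : r ctr = N) :
    ∃ r' m' k, (Frag.for ctr idx one body).Runs r m k r' m' ∧ Inv N r' m' ∧
      k ≤ ∑ j ∈ Finset.range N, (b j + 10 * (Nat.size N + 1)) + 2 := by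
  have key : ∀ d j, j + d = N → ∀ r m, Inv j r m → r ctr = d → r idx = j →
      ∃ r' m' k, (Frag.while ctr (body.seq <| (Frag.one (.const one 1)).seq <|
        (Frag.one (.sub ctr ctr one)).seq <| Frag.one (.add idx idx one))).Runs r m k r' m' ∧
        Inv N r' m' ∧ k ≤ ∑ j ∈ Finset.Ico j N, (b j + 10 * (Nat.size N + 1)) + 1 := by
    intro d
    induction d with
    | zero =>
      intro j hj r m hI hc _
      obtain rfl : j = N := by omega
      exact ⟨r, m, 1, runs_while_zero hc, hI, by simp⟩
    | succ d ih =>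
      intro j hj r m hI hc hi
      obtain ⟨r₁, m₁, k₁, hr₁, hk₁, hI₁, hc₁, hi₁⟩ := hbody j (by omega) r m hI hi
      have e1 := runs_const one 1 r₁ m₁
      set r₂ := Function.update r₁ one 1 with hr₂
      have e2 := runs_sub ctr ctr one r₂ m₁
      set r₃ := Function.update r₂ ctr (r₂ ctr - r₂ one) with hr₃
      have e3 := runs_add idx idx one r₃ m₁
      set r₄ := Function.update r₃ idx (r₃ idx + r₃ one) with hr₄
      have c2 : r₂ ctr = d + 1 := by simp [hr₂, hco, hc₁, hc]
      have o2 : r₂ one = 1 := by simp [hr₂]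
      have i3 : r₃ idx = j := by simp [hr₃, hr₂, hci.symm, hio, hi₁]
      have o3 : r₃ one = 1 := by simp [hr₃, hco.symm, o2]
      have c4 : r₄ ctr = d := by simp [hr₄, hr₃, hci, c2, o2]
      have i4 : r₄ idx = j + 1 := by simp [hr₄, i3, o3]
      have hI₄ : Inv (j + 1) r₄ m₁ := hstab _ _ _ _ (fun i h1 h2 h3 => by
        simp [hr₄, hr₃, hr₂, h1, h2, h3]) hI₁
      obtain ⟨r', m', k, hr', hI', hk⟩ := ih (j + 1) (by omega) r₄ m₁ hI₄ c4 i4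
      refine ⟨r', m', _, runs_while_succ (by omega) (hr₁.seq (e1.seq (e2.seq e3))) hr', hI', ?_⟩
      rw [Finset.sum_eq_sum_Ico_succ_bot (by omega)]
      have s1 : Nat.size (d + 1) ≤ Nat.size N := Nat.size_le_size (by omega)
      have s2 : Nat.size j ≤ Nat.size N := Nat.size_le_size (by omega)
      have s3 : Nat.size 1 = 1 := Nat.size_one
      rw [c2, o2, i3, o3, hc, s3]
      omega
  have e0 := runs_const idx 0 r m
  obtain ⟨r', m', k, hr', hI', hk⟩ := key N 0 (by omega) (Function.update r idx 0) m
    (hstab _ _ _ _ (fun i _ h2 _ => by simp [h2]) h0) (by simp [hci, hN]) (by simp)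
  refine ⟨r', m', _, e0.seq hr', hI', ?_⟩
  rw [← Finset.range_eq_Ico] at hk
  simp only [Nat.size_zero]
  omega

/-! ### Polynomially bounded functions -/

/-- `b` is bounded by a polynomial. -/
def PolyBdd (b : ℕ → ℕ) : Prop := ∃ c : ℕ, ∀ n, b n ≤ (n + 2) ^ c

theorem PolyBdd.mono {a b : ℕ → ℕ} (hb : PolyBdd b) (h : ∀ n, a n ≤ b n) : PolyBdd a :=
  hb.imp fun _ hc n => (h n).trans (hc n)

theorem PolyBdd.const (a : ℕ) : PolyBdd fun _ => a :=
  ⟨a, fun n => Nat.lt_two_pow_self.le.trans (Nat.pow_le_pow_left (by omega) a)⟩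

theorem PolyBdd.id : PolyBdd fun n => n := ⟨1, fun n => by simp⟩

theorem PolyBdd.mul {a b : ℕ → ℕ} (ha : PolyBdd a) (hb : PolyBdd b) :
    PolyBdd fun n => a n * b n := by
  obtain ⟨c, hc⟩ := ha
  obtain ⟨d, hd⟩ := hb
  exact ⟨c + d, fun n => by rw [pow_add]; exact Nat.mul_le_mul (hc n) (hd n)⟩

theorem PolyBdd.add {a b : ℕ → ℕ} (ha : PolyBdd a) (hb : PolyBdd b) :
    PolyBdd fun n => a n + b n := by
  obtain ⟨c, hc⟩ := ha
  obtain ⟨d, hd⟩ := hb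
  refine ⟨c + d + 1, fun n => ?_⟩
  have h1 : (n + 2) ^ c ≤ (n + 2) ^ (c + d) := Nat.pow_le_pow_right (by omega) (by omega)
  have h2 : (n + 2) ^ d ≤ (n + 2) ^ (c + d) := Nat.pow_le_pow_right (by omega) (by omega)
  have h3 : (n + 2) ^ (c + d) * 2 ≤ (n + 2) ^ (c + d + 1) := by
    rw [pow_succ]; exact Nat.mul_le_mul_left _ (by omega)
  have := hc n
  have := hd n
  beta_reduce
  omega

theorem size_add_le (a b : ℕ) : (a + b).size ≤ a.size + b.size + 1 := by
  rw [Nat.size_le]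
  have h1 := Nat.lt_size_self a
  have h2 := Nat.lt_size_self b
  have h3 : 2 ^ a.size ≤ 2 ^ (a.size + b.size) := Nat.pow_le_pow_right (by omega) (by omega)
  have h4 : 2 ^ b.size ≤ 2 ^ (a.size + b.size) := Nat.pow_le_pow_right (by omega) (by omega)
  rw [pow_succ]
  omega

theorem size_mul_le (a b : ℕ) : (a * b).size ≤ a.size + b.size := by
  rw [Nat.size_le, pow_add]
  exact Nat.mul_lt_mul'' (Nat.lt_size_self a) (Nat.lt_size_self b)

theorem size_le_self (a : ℕ) : a.size ≤ a := Nat.size_le.2 Nat.lt_two_pow_self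

theorem size_pow_le (a k : ℕ) : (a ^ k).size ≤ k * a.size + 1 := by
  induction k with
  | zero => simp
  | succ k ih =>
    rw [pow_succ, add_mul]
    have := size_mul_le (a ^ k) a
    omega

/-- A bound for all the numbers that are kept in memory or used as loop indices. -/
def cap (n : ℕ) : ℕ := (2 * n + 2) ^ n * (11 * n ^ 2 + 11)

/-- `cap n` is exponential, but its binary length is polynomial; hence logarithmic costs stay
polynomial per operation. In `cap`, the power leaves room for `n` sort keys below `2 * n + 2`, and
the other factor exceeds `11 * n ^ 2`, the largest cost that matters. -/
theorem polyBdd_size_cap : PolyBdd fun n => (cap n).size := by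
  refine PolyBdd.mono (b := fun n => n * (2 * n + 2) + 1 + (11 * (n * n) + 11)) ?_ fun n => ?_
  · exact ((PolyBdd.id.mul (((PolyBdd.const 2).mul .id).add (.const 2))).add (.const 1)).add
      (((PolyBdd.const 11).mul (PolyBdd.id.mul .id)).add (.const 11))
  · refine (size_mul_le _ _).trans (add_le_add ((size_pow_le _ _).trans ?_) ?_)
    · exact Nat.add_le_add_right (Nat.mul_le_mul_left _ (size_le_self _)) _
    · rw [pow_two]; exact size_le_self _

theorem le_cap_of_le {n a : ℕ} (h : a ≤ (2 * n + 2) ^ n) : a ≤ cap n :=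
  h.trans (Nat.le_mul_of_pos_right _ (by positivity))

theorem le_cap {n a : ℕ} (h : a ≤ 11 * n ^ 2 + 11) : a ≤ cap n :=
  h.trans (Nat.le_mul_of_pos_left _ (by positivity))

/-! ### Contexts of program variables -/

/-- Values of `d` program variables, the first of which is the size of the instance. -/
class Ctx (V : Type) where
  d : ℕ
  d_pos : 0 < d
  var : ℕ → V → ℕ

/-- The size of the instance. -/
def num {V : Type} [Ctx V] (x : V) : ℕ := Ctx.var 0 x

instance : Ctx ℕ := ⟨1, one_pos, fun _ n => n⟩

/-- Entering a loop appends its index as the last variable; earlier variables keep their numbers. -/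
instance {V : Type} [Ctx V] : Ctx (V × ℕ) :=
  ⟨Ctx.d V + 1, by omega, fun i x => if i < Ctx.d V then Ctx.var i x.1 else x.2⟩

@[simp] theorem num_pair {V : Type} [Ctx V] (x : V × ℕ) : num x = num x.1 :=
  if_pos (Ctx.d_pos (V := V))

@[simp] theorem num_nat (n : ℕ) : num n = n := rfl

/-- All the numbers in the context and in memory are within the bound. -/
structure Ok {V : Type} [Ctx V] (x : V) (m : ℕ → ℕ) : Prop where
  var : ∀ i < Ctx.d V, Ctx.var i x ≤ cap (num x)
  mem : ∀ a, m a ≤ cap (num x)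

theorem Ok.fst {V : Type} [Ctx V] {x : V × ℕ} {m : ℕ → ℕ} (h : Ok x m) : Ok x.1 m where
  var i hi := by
    have := h.var i (Nat.lt_succ_of_lt hi)
    rw [num_pair] at this
    exact (if_pos hi).symm.le.trans this
  mem a := by simpa using h.mem a

theorem Ok.pair {V : Type} [Ctx V] {x : V} {m : ℕ → ℕ} {j : ℕ} (h : Ok x m)
    (hj : j ≤ cap (num x)) : Ok (x, j) m where
  var i hi := by
    rw [num_pair]
    change (if i < Ctx.d V then _ else _) ≤ _
    split_ifs with hi'
    · exact h.var i hi'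
    · exact hj
  mem a := by simpa using h.mem a

theorem Ok.num_le {V : Type} [Ctx V] {x : V} {m : ℕ → ℕ} (h : Ok x m) : num x ≤ cap (num x) :=
  h.var 0 Ctx.d_pos

/-- The registers `r` hold the variables of `x` at the places given by `ρ`. -/
def Rep {V : Type} [Ctx V] (ρ : ℕ → ℕ) (x : V) (r : ℕ → ℕ) : Prop :=
  ∀ i < Ctx.d V, r (ρ i) = Ctx.var i x

theorem Rep.congr {V : Type} [Ctx V] {ρ : ℕ → ℕ} {x : V} {r r' : ℕ → ℕ} {t : ℕ}
    (hρ : ∀ i < Ctx.d V, ρ i < t) (h : Rep ρ x r) (hr : ∀ i < t, r' i = r i) : Rep ρ x r' :=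
  fun i hi => (hr _ (hρ i hi)).trans (h i hi)

theorem Rep.pair {V : Type} [Ctx V] {ρ : ℕ → ℕ} {x : V} {r r' : ℕ → ℕ} {t k j : ℕ}
    (hρ : ∀ i < Ctx.d V, ρ i < t) (h : Rep ρ x r) (hr : ∀ i < t, r' i = r i) (hj : r' k = j) :
    Rep (Function.update ρ (Ctx.d V) k) (x, j) r' := fun i hi => by
  change _ = (if i < Ctx.d V then _ else _)
  split_ifs with hi'
  · rw [Function.update_of_ne (by omega)]
    exact h.congr hρ hr i hi'
  · obtain rfl : i = Ctx.d V := Nat.le_antisymm (Nat.le_of_lt_succ hi) (not_lt.1 hi')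
    rw [Function.update_self, hj]

/-! ### Functions of variables and memory that are computed in polynomial time -/

/-- `f` is computed by a fragment of code in polynomial time (in the size of the instance), the
memory and the registers below a given one being left unchanged. -/
def Comp {V : Type} [Ctx V] (f : V → (ℕ → ℕ) → ℕ) : Prop :=
  ∃ b : ℕ → ℕ, PolyBdd b ∧ (∀ x m, Ok x m → (f x m).size ≤ b (num x)) ∧
    ∀ (ρ : ℕ → ℕ) (t : ℕ), (∀ i < Ctx.d V, ρ i < t) → ∃ F : Frag, ∀ x m r, Ok x m → Rep ρ x r →
      ∃ r' k, F.Runs r m k r' m ∧ k ≤ b (num x) ∧ r' t = f x m ∧ ∀ i < t, r' i = r i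

section

variable {V : Type} [Ctx V] {f g : V → (ℕ → ℕ) → ℕ}

theorem Comp.const (a : ℕ) : Comp fun (_ : V) _ => a :=
  ⟨_, .const (1 + a.size), fun _ _ _ => Nat.le_add_left _ _, fun ρ t _ => ⟨.one (.const t a), fun x m r _ _ =>
    ⟨_, _, Frag.runs_const _ _ _ _, le_rfl, by simp, fun i hi => by simp [hi.ne]⟩⟩⟩

theorem comp_var {j : ℕ} (hj : j < Ctx.d V) : Comp fun (x : V) _ => Ctx.var j x := by
  refine ⟨_, polyBdd_size_cap.add (.const 2), fun x m h =>
    (Nat.size_le_size (h.var j hj)).trans (by omega), fun ρ t hρ =>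
    -- A register is copied by adding it to zero.
    ⟨(Frag.one (.const t 0)).seq (.one (.add t t (ρ j))), fun x m r h hr => ?_⟩⟩
  refine ⟨_, _, (Frag.runs_const _ _ _ _).seq (Frag.runs_add _ _ _ _ _), ?_, ?_, ?_⟩
  · have := Nat.size_le_size (h.var j hj)
    simp only [Function.update_self, Nat.size_zero, Function.update_of_ne (hρ j hj).ne, hr j hj]
    omega
  · simp [(hρ j hj).ne, hr j hj]
  · intro i hi
    simp [hi.ne]

theorem Comp.num : Comp fun (x : V) _ => num x := comp_var Ctx.d_pos

theorem Comp.last : Comp fun (x : V × ℕ) _ => x.2 := by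
  simpa [Ctx.var] using comp_var (V := V × ℕ) (j := Ctx.d V) (Nat.lt_succ_self _)

theorem Comp.wk (hf : Comp f) : Comp fun (x : V × ℕ) m => f x.1 m := by
  obtain ⟨b, hb, hs, hF⟩ := hf
  refine ⟨b, hb, fun x m h => by simpa using hs x.1 m h.fst, fun ρ t hρ => ?_⟩
  obtain ⟨F, hF⟩ := hF ρ t fun i hi => hρ i (Nat.lt_succ_of_lt hi)
  refine ⟨F, fun x m r h hr => ?_⟩
  rw [num_pair]
  exact hF x.1 m r h.fst fun i hi => (hr i (Nat.lt_succ_of_lt hi)).trans (if_pos hi)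

theorem comp_binop {I : ℕ → ℕ → ℕ → Instr} {op : ℕ → ℕ → ℕ}
    (hI : ∀ d a b r m, (Frag.one (I d a b)).Runs r m (1 + Nat.size (r a) + Nat.size (r b))
      (Function.update r d (op (r a) (r b))) m)
    (hop : ∀ a b, (op a b).size ≤ a.size + b.size + 1) (hf : Comp f) (hg : Comp g) :
    Comp fun x m => op (f x m) (g x m) := by
  obtain ⟨b, hb, hs, hF⟩ := hf
  obtain ⟨b', hb', hs', hG⟩ := hg
  refine ⟨_, ((hb.add hb).add (hb'.add hb')).add (.const 1), fun x m h => ?_, fun ρ t hρ => ?_⟩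
  · have := hop (f x m) (g x m)
    have := hs x m h
    have := hs' x m h
    beta_reduce
    omega
  obtain ⟨F, hF⟩ := hF ρ t hρ
  obtain ⟨G, hG⟩ := hG ρ (t + 1) fun i hi => (hρ i hi).trans (Nat.lt_succ_self t)
  -- The first operand waits in register `t` while the second is computed with `t + 1` as the lowest
  -- scratch register.
  refine ⟨F.seq (G.seq (.one (I t t (t + 1)))), fun x m r h hr => ?_⟩
  obtain ⟨r₁, k₁, hr₁, hk₁, ht₁, hp₁⟩ := hF x m r h hr
  obtain ⟨r₂, k₂, hr₂, hk₂, ht₂, hp₂⟩ := hG x m r₁ h (hr.congr hρ hp₁)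
  have ht : r₂ t = f x m := (hp₂ t (Nat.lt_succ_self t)).trans ht₁
  refine ⟨_, _, hr₁.seq (hr₂.seq (hI _ _ _ _ _)), ?_, ?_, ?_⟩
  · have := hs x m h
    have := hs' x m h
    rw [ht, ht₂]
    omega
  · simp [ht, ht₂]
  · intro i hi
    rw [Function.update_of_ne hi.ne, hp₂ i (by omega), hp₁ i hi]

theorem Comp.add (hf : Comp f) (hg : Comp g) : Comp fun x m => f x m + g x m :=
  comp_binop Frag.runs_add size_add_le hf hg

theorem Comp.sub (hf : Comp f) (hg : Comp g) : Comp fun x m => f x m - g x m :=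
  comp_binop Frag.runs_sub (fun a b => (Nat.size_le_size (Nat.sub_le a b)).trans (by omega)) hf hg

theorem Comp.mul (hf : Comp f) (hg : Comp g) : Comp fun x m => f x m * g x m :=
  comp_binop Frag.runs_mul (fun a b => (size_mul_le a b).trans (by omega)) hf hg

theorem Comp.div (hf : Comp f) (hg : Comp g) : Comp fun x m => f x m / g x m :=
  comp_binop Frag.runs_div (fun a b => (Nat.size_le_size (Nat.div_le_self a b)).trans (by omega))
    hf hg

theorem Comp.mod (hf : Comp f) (hg : Comp g) : Comp fun x m => f x m % g x m := by
  simpa only [Nat.mod_eq_sub_div_mul] using hf.sub ((hf.div hg).mul hg)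

theorem Comp.load (hf : Comp f) : Comp fun x m => m (f x m) := by
  obtain ⟨b, hb, hs, hF⟩ := hf
  refine ⟨_, ((hb.add hb).add polyBdd_size_cap).add (.const 1), fun x m h =>
    (Nat.size_le_size (h.mem _)).trans (by omega), fun ρ t hρ => ?_⟩
  obtain ⟨F, hF⟩ := hF ρ t hρ
  refine ⟨F.seq (.one (.load t t)), fun x m r h hr => ?_⟩
  obtain ⟨r₁, k₁, hr₁, hk₁, ht₁, hp₁⟩ := hF x m r h hr
  refine ⟨_, _, hr₁.seq (Frag.runs_load _ _ _ _), ?_, ?_, ?_⟩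
  · have := hs x m h
    have := Nat.size_le_size (h.mem (f x m))
    rw [ht₁]
    omega
  · simp [ht₁]
  · intro i hi
    rw [Function.update_of_ne hi.ne, hp₁ i hi]

/-- Fold `op` over the values of `g` at the numbers below `N`, starting with `e`. -/
def foldOp (op : ℕ → ℕ → ℕ) (e : ℕ) (g : ℕ → ℕ) : ℕ → ℕ
  | 0 => e
  | N + 1 => op (foldOp op e g N) (g N)

/-- Lengths add up under each operation, so even an `n`-fold product has polynomial length. -/
theorem size_foldOp_le {op : ℕ → ℕ → ℕ} (hop : ∀ a b, (op a b).size ≤ a.size + b.size + 1)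
    {e s : ℕ} {g : ℕ → ℕ} {N : ℕ} (hg : ∀ j < N, (g j).size ≤ s) :
    (foldOp op e g N).size ≤ e.size + N * (s + 1) := by
  induction N with
  | zero => simp [foldOp]
  | succ N ih =>
    have h1 := ih fun j hj => hg j (by omega)
    have h2 := hg N (by omega)
    have h3 := hop (foldOp op e g N) (g N)
    rw [add_mul, foldOp]
    omega

/-- Register `t` holds the accumulator, `t + 1` the counter, `t + 2` the index and `t + 3` the
current value, reused as the scratch register of the loop. The operation may destroy the value
register, as the maximum `a + (b - a)` does. -/
theorem comp_fold {op : ℕ → ℕ → ℕ} (e : ℕ)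
    (hop : ∀ a b, (op a b).size ≤ a.size + b.size + 1)
    (hO : ∀ a b : ℕ, a ≠ b → ∃ O : Frag, ∀ r m, ∃ r' k, O.Runs r m k r' m ∧
      k ≤ 10 * (1 + (r a).size + (r b).size) ∧ r' a = op (r a) (r b) ∧
        ∀ i, i ≠ a → i ≠ b → r' i = r i)
    {h : V → (ℕ → ℕ) → ℕ → ℕ} (hh : Comp fun (x : V × ℕ) m => h x.1 m x.2) :
    Comp fun x m => foldOp op e (h x m) (RAM.num x) := by
  obtain ⟨b, hb, hs, hF⟩ := hh
  obtain ⟨bn, hbn, hsn, hN⟩ := Comp.num (V := V)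
  have hs' : ∀ (x : V) m, Ok x m → ∀ j < RAM.num x, (h x m j).size ≤ b (RAM.num x) :=
    fun x m hx j hj => by
      simpa using hs (x, j) m (hx.pair (hj.le.trans hx.num_le))
  have hfs : ∀ (x : V) m, Ok x m → ∀ N ≤ RAM.num x, (foldOp op e (h x m) N).size ≤
      e.size + RAM.num x * (b (RAM.num x) + 1) := fun x m hx N hN' =>
    (size_foldOp_le hop fun j hj => hs' x m hx j (hj.trans_le hN')).trans
      (Nat.add_le_add_left (Nat.mul_le_mul_right _ hN') _)
  let B : ℕ → ℕ := fun n => e.size + n * (b n + 1)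
  have hB : PolyBdd B := (PolyBdd.const _).add (PolyBdd.id.mul (hb.add (.const 1)))
  refine ⟨fun n => n * (b n + 10 * (1 + B n + b n) + 10 * (n + 1)) + bn n + 3 + B n,
    (((PolyBdd.id.mul ((hb.add ((PolyBdd.const 10).mul (((PolyBdd.const 1).add hB).add hb))).add
      ((PolyBdd.const 10).mul (PolyBdd.id.add (.const 1))))).add hbn).add (.const 3)).add hB,
    fun x m hx => (hfs x m hx _ le_rfl).trans (Nat.le_add_left _ _), fun ρ t hρ => ?_⟩
  obtain ⟨G, hG⟩ := hN ρ (t + 1) fun i hi => (hρ i hi).trans (Nat.lt_succ_self t)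
  obtain ⟨F, hF⟩ := hF (Function.update ρ (Ctx.d V) (t + 2)) (t + 3) fun i hi => by
    rcases eq_or_ne i (Ctx.d V) with rfl | h'
    · simp
    · rw [Function.update_of_ne h']
      have := hρ i (lt_of_le_of_ne (Nat.le_of_lt_succ hi) h')
      omega
  obtain ⟨O, hO⟩ := hO t (t + 3) (by omega)
  refine ⟨(Frag.one (.const t e)).seq (G.seq (Frag.for (t + 1) (t + 2) (t + 3) (F.seq O))),
    fun x m r hx hr => ?_⟩
  have e1 := Frag.runs_const t e r m
  set r₁ := Function.update r t e with hr₁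
  have hp₁ : ∀ i < t, r₁ i = r i := fun i hi => by simp [hr₁, hi.ne]
  obtain ⟨r₂, k₂, hr₂, hk₂, ht₂, hp₂⟩ := hG x m r₁ hx (hr.congr hρ hp₁)
  obtain ⟨r', m', k, hrun, ⟨hm, hacc, hpres⟩, hk⟩ := Frag.runs_for (ctr := t + 1) (idx := t + 2)
    (one := t + 3) (by omega) (by omega) (by omega) (body := F.seq O)
    (fun j r' m' => m' = m ∧ r' t = foldOp op e (h x m) j ∧ ∀ i < t, r' i = r i) (RAM.num x)
    (fun _ => b (RAM.num x) + 10 * (1 + B (RAM.num x) + b (RAM.num x)))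
    (fun j hj r' m' ⟨hm', ha, hp⟩ hj' => by
      subst hm'
      obtain ⟨r₃, k₃, hr₃, hk₃, ht₃, hp₃⟩ := hF (x, j) m' r'
        (hx.pair (hj.le.trans hx.num_le)) (hr.pair hρ hp hj')
      obtain ⟨r₄, k₄, hr₄, hk₄, ht₄, hp₄⟩ := hO r₃ m'
      have hta : r₃ t = foldOp op e (h x m') j := (hp₃ t (by omega)).trans ha
      rw [num_pair] at hk₃
      rw [hta, ht₃] at hk₄ ht₄
      refine ⟨r₄, m', _, hr₃.seq hr₄, ?_, ⟨rfl, ht₄, fun i hi => ?_⟩, ?_, ?_⟩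
      · have h1 := hfs x m' hx j hj.le
        have h2 := hs' x m' hx j hj
        simp only at hk₃ hk₄
        change _ ≤ b (RAM.num x) + 10 * (1 + (e.size + RAM.num x * (b (RAM.num x) + 1)) +
          b (RAM.num x))
        omega
      · rw [hp₄ i (by omega) (by omega), hp₃ i (by omega), hp i hi]
      · rw [hp₄ _ (by omega) (by omega), hp₃ _ (by omega)]
      · rw [hp₄ _ (by omega) (by omega), hp₃ _ (by omega), hj'])
    (fun j r' r'' m' heq ⟨hm', ha, hp⟩ => ⟨hm', by rw [heq t (by omega) (by omega) (by omega), ha],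
      fun i hi => by rw [heq i (by omega) (by omega) (by omega), hp i hi]⟩)
    r₂ m ⟨rfl, by rw [hp₂ t (by omega)]; simp [hr₁, foldOp], fun i hi => by
      rw [hp₂ i (by omega), hp₁ i hi]⟩ ht₂
  subst hm
  refine ⟨r', _, e1.seq (hr₂.seq hrun), ?_, hacc, hpres⟩
  rw [Finset.sum_const, Finset.card_range, smul_eq_mul] at hk
  have h1 : RAM.num x * (b (RAM.num x) + 10 * (1 + B (RAM.num x) + b (RAM.num x)) +
      10 * ((RAM.num x).size + 1)) ≤ RAM.num x * (b (RAM.num x) +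
        10 * (1 + B (RAM.num x) + b (RAM.num x)) + 10 * (RAM.num x + 1)) :=
    Nat.mul_le_mul_left _ (by have := size_le_self (RAM.num x); omega)
  have h2 : e.size ≤ B (RAM.num x) := Nat.le_add_right _ _
  beta_reduce
  omega

theorem Comp.sum {h : V → (ℕ → ℕ) → ℕ → ℕ} (hh : Comp fun (x : V × ℕ) m => h x.1 m x.2) :
    Comp fun x m => ∑ j ∈ Finset.range (RAM.num x), h x m j := by
  have e : ∀ (g : ℕ → ℕ) N, foldOp (· + ·) 0 g N = ∑ j ∈ Finset.range N, g j := fun g N => by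
    induction N with
    | zero => rfl
    | succ N ih => rw [Finset.sum_range_succ, foldOp, ih]
  simp_rw [← e]
  refine comp_fold 0 size_add_le (fun a b _ => ⟨.one (.add a a b), fun r m =>
    ⟨_, _, Frag.runs_add _ _ _ _ _, by omega, by simp, fun i hi _ => by simp [hi]⟩⟩) hh

theorem Comp.prod {h : V → (ℕ → ℕ) → ℕ → ℕ} (hh : Comp fun (x : V × ℕ) m => h x.1 m x.2) :
    Comp fun x m => ∏ j ∈ Finset.range (RAM.num x), h x m j := by
  have e : ∀ (g : ℕ → ℕ) N, foldOp (· * ·) 1 g N = ∏ j ∈ Finset.range N, g j := fun g N => by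
    induction N with
    | zero => rfl
    | succ N ih => rw [Finset.prod_range_succ, foldOp, ih]
  simp_rw [← e]
  refine comp_fold 1 (fun a b => (size_mul_le a b).trans (by omega)) (fun a b _ =>
    ⟨.one (.mul a a b), fun r m =>
      ⟨_, _, Frag.runs_mul _ _ _ _ _, by omega, by simp, fun i hi _ => by simp [hi]⟩⟩) hh

theorem Comp.max (hf : Comp f) (hg : Comp g) : Comp fun x m => max (f x m) (g x m) := by
  simpa only [show ∀ a b : ℕ, Max.max a b = a + (b - a) from fun a b => by omega] using
    hf.add (hg.sub hf)

theorem Comp.sup {h : V → (ℕ → ℕ) → ℕ → ℕ} (hh : Comp fun (x : V × ℕ) m => h x.1 m x.2) :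
    Comp fun x m => (Finset.range (RAM.num x)).sup (h x m) := by
  have e : ∀ (g : ℕ → ℕ) N, foldOp Max.max 0 g N = (Finset.range N).sup g := fun g N => by
    induction N with
    | zero => rfl
    | succ N ih => rw [Finset.range_add_one, Finset.sup_insert, foldOp, ih, sup_comm]
  simp_rw [← e]
  refine comp_fold 0 (fun a b => ?_) (fun a b hab => ⟨(Frag.one (.sub b b a)).seq
    (.one (.add a a b)), fun r m =>
    ⟨_, _, (Frag.runs_sub _ _ _ _ _).seq (Frag.runs_add _ _ _ _ _), ?_, ?_, fun i hi hi' => by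
      simp [hi, hi']⟩⟩) hh
  · rcases max_cases a b with h | h <;> rw [h.1] <;> omega
  · have := Nat.size_le_size (Nat.sub_le (r b) (r a))
    simp only [Function.update_of_ne hab, Function.update_self]
    omega
  · simp only [Function.update_of_ne hab, Function.update_self]
    omega

end

/-! ### Commands -/

/-- Write the value of `g` to the cell given by `f`. The second component of the result of a
command is its duration. -/
def storeC {V : Type} (f g : V → (ℕ → ℕ) → ℕ) (x : V) (m : ℕ → ℕ) : (ℕ → ℕ) × ℕ :=
  (Function.update m (f x m) (g x m), 1)

/-- One command after the other. -/
def seqC {V : Type} (c c' : V → (ℕ → ℕ) → (ℕ → ℕ) × ℕ) (x : V) (m : ℕ → ℕ) : (ℕ → ℕ) × ℕ :=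
  ((c' x (c x m).1).1, (c x m).2 + (c' x (c x m).1).2)

/-- The result of running `c 0`, `c 1`, …, `c (N - 1)`. -/
def iterC (c : ℕ → (ℕ → ℕ) → (ℕ → ℕ) × ℕ) (m : ℕ → ℕ) : ℕ → (ℕ → ℕ) × ℕ
  | 0 => (m, 1)
  | N + 1 => ((c N (iterC c m N).1).1, (iterC c m N).2 + ((c N (iterC c m N).1).2 + 1))

/-- Run `c` for all the values of a new variable below `f`. -/
def forC {V : Type} (f : V → (ℕ → ℕ) → ℕ) (c : V × ℕ → (ℕ → ℕ) → (ℕ → ℕ) × ℕ) (x : V)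
    (m : ℕ → ℕ) : (ℕ → ℕ) × ℕ :=
  iterC (fun j => c (x, j)) m (f x m)

/-- The command `c` is carried out by a fragment of code, within a polynomial factor of the
duration of the command. -/
def CompC {V : Type} [Ctx V] (c : V → (ℕ → ℕ) → (ℕ → ℕ) × ℕ) : Prop :=
  (∀ x m, Ok x m → ∀ a, (c x m).1 a ≤ cap (num x)) ∧ ∃ b : ℕ → ℕ, PolyBdd b ∧
    ∀ (ρ : ℕ → ℕ) (t : ℕ), (∀ i < Ctx.d V, ρ i < t) → ∃ F : Frag, ∀ x m r, Ok x m → Rep ρ x r →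
      ∃ r' k, F.Runs r m k r' (c x m).1 ∧ k ≤ b (num x) * (c x m).2 ∧ ∀ i < t, r' i = r i

section

variable {V : Type} [Ctx V] {f g : V → (ℕ → ℕ) → ℕ} {c c' : V → (ℕ → ℕ) → (ℕ → ℕ) × ℕ}

theorem CompC.store (hf : Comp f) (hg : Comp g) (hcap : ∀ x m, Ok x m → g x m ≤ cap (num x)) :
    CompC (storeC f g) := by
  obtain ⟨b, hb, hs, hF⟩ := hf
  obtain ⟨b', hb', hs', hG⟩ := hg
  refine ⟨fun x m h a => ?_, _, ((hb.add hb).add (hb'.add hb')).add (.const 1), fun ρ t hρ => ?_⟩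
  · rcases eq_or_ne a (f x m) with rfl | ha
    · simpa [storeC] using hcap x m h
    · simpa [storeC, ha] using h.mem a
  obtain ⟨F, hF⟩ := hF ρ t hρ
  obtain ⟨G, hG⟩ := hG ρ (t + 1) fun i hi => (hρ i hi).trans (Nat.lt_succ_self t)
  refine ⟨F.seq (G.seq (.one (.store t (t + 1)))), fun x m r h hr => ?_⟩
  obtain ⟨r₁, k₁, hr₁, hk₁, ht₁, hp₁⟩ := hF x m r h hr
  obtain ⟨r₂, k₂, hr₂, hk₂, ht₂, hp₂⟩ := hG x m r₁ h (hr.congr hρ hp₁)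
  have ht : r₂ t = f x m := (hp₂ t (Nat.lt_succ_self t)).trans ht₁
  have hst := Frag.runs_store t (t + 1) r₂ m
  rw [ht, ht₂] at hst
  refine ⟨_, _, hr₁.seq (hr₂.seq hst), ?_, fun i hi => ?_⟩
  · have := hs x m h
    have := hs' x m h
    simp only [storeC]
    omega
  · rw [hp₂ i (by omega), hp₁ i hi]

theorem CompC.seq (hc : CompC c) (hc' : CompC c') : CompC (seqC c c') := by
  obtain ⟨ho, b, hb, hF⟩ := hc
  obtain ⟨ho', b', hb', hG⟩ := hc'
  refine ⟨fun x m h => ho' x _ ⟨h.var, ho x m h⟩, _, hb.add hb', fun ρ t hρ => ?_⟩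
  obtain ⟨F, hF⟩ := hF ρ t hρ
  obtain ⟨G, hG⟩ := hG ρ t hρ
  refine ⟨F.seq G, fun x m r h hr => ?_⟩
  obtain ⟨r₁, k₁, hr₁, hk₁, hp₁⟩ := hF x m r h hr
  obtain ⟨r₂, k₂, hr₂, hk₂, hp₂⟩ := hG x _ r₁ ⟨h.var, ho x m h⟩ (hr.congr hρ hp₁)
  refine ⟨_, _, hr₁.seq hr₂, ?_, fun i hi => by rw [hp₂ i hi, hp₁ i hi]⟩
  simp only [seqC]
  nlinarith

/-- The memory stays within `cap` after every iteration, so one polynomial bounds the cost factor of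
all iterations. The extra unit that `iterC` counts per iteration pays for the loop overhead. -/
theorem CompC.for {c : V × ℕ → (ℕ → ℕ) → (ℕ → ℕ) × ℕ} (hf : Comp f)
    (hcap : ∀ x m, Ok x m → f x m ≤ cap (num x)) (hc : CompC c) : CompC (forC f c) := by
  obtain ⟨ho, b, hb, hF⟩ := hc
  obtain ⟨bn, hbn, hsn, hN⟩ := hf
  have hok : ∀ (x : V) m, Ok x m → ∀ j ≤ f x m,
      ∀ a, (iterC (fun j => c (x, j)) m j).1 a ≤ cap (num x) := by
    intro x m hx j hj
    induction j with
    | zero => exact hx.mem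
    | succ j ih =>
      have := ho (x, j) _ (Ok.pair ⟨hx.var, ih (by omega)⟩ ((Nat.le_of_lt hj).trans (hcap x m hx)))
      simpa [iterC] using this
  refine ⟨fun x m hx => hok x m hx _ le_rfl, _, ((hbn.add hb).add ((PolyBdd.const 10).mul
    (polyBdd_size_cap.add (.const 1)))).add (.const 2), fun ρ t hρ => ?_⟩
  obtain ⟨G, hG⟩ := hN ρ t hρ
  obtain ⟨F, hF⟩ := hF (Function.update ρ (Ctx.d V) (t + 1)) (t + 2) fun i hi => by
    rcases eq_or_ne i (Ctx.d V) with rfl | h'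
    · simp
    · rw [Function.update_of_ne h']
      have := hρ i (lt_of_le_of_ne (Nat.le_of_lt_succ hi) h')
      omega
  refine ⟨G.seq (Frag.for t (t + 1) (t + 2) F), fun x m r hx hr => ?_⟩
  obtain ⟨r₁, k₁, hr₁, hk₁, ht₁, hp₁⟩ := hG x m r hx hr
  set M : ℕ → (ℕ → ℕ) × ℕ := iterC (fun j => c (x, j)) m with hM
  obtain ⟨r', m', k, hrun, ⟨hm, hpres⟩, hk⟩ := Frag.runs_for (ctr := t) (idx := t + 1)
    (one := t + 2) (by omega) (by omega) (by omega) (body := F)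
    (fun j r' m' => m' = (M j).1 ∧ ∀ i < t, r' i = r i) (f x m)
    (fun j => b (num x) * (c (x, j) (M j).1).2)
    (fun j hj r' m' ⟨hm', hp⟩ hj' => by
      subst hm'
      obtain ⟨r₃, k₃, hr₃, hk₃, hp₃⟩ := hF (x, j) (M j).1 r'
        (Ok.pair ⟨hx.var, hok x m hx j hj.le⟩ (hj.le.trans (hcap x m hx))) (hr.pair hρ hp hj')
      rw [num_pair] at hk₃
      exact ⟨r₃, _, k₃, hr₃, hk₃, ⟨rfl, fun i hi => (hp₃ i (by omega)).trans (hp i hi)⟩,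
        hp₃ _ (by omega), (hp₃ _ (by omega)).trans hj'⟩)
    (fun j r' r'' m' heq ⟨hm', hp⟩ => ⟨hm', fun i hi => by
      rw [heq i (by omega) (by omega) (by omega), hp i hi]⟩)
    r₁ m ⟨rfl, hp₁⟩ ht₁
  subst hm
  refine ⟨r', _, hr₁.seq hrun, ?_, hpres⟩
  have h1 : ∀ j, (M j).2 = ∑ i ∈ Finset.range j, ((c (x, i) (M i).1).2 + 1) + 1 := fun j => by
    induction j with
    | zero => rfl
    | succ j ih =>
      rw [Finset.sum_range_succ]
      simp only [hM, iterC] at ih ⊢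
      omega
  have h2 := Nat.size_le_size (hcap x m hx)
  change _ ≤ _ * (M (f x m)).2
  rw [h1, mul_add, mul_one]
  refine (add_le_add hk₁ hk).trans ?_
  have h3 : ∑ j ∈ Finset.range (f x m), (b (num x) * (c (x, j) (M j).1).2 +
      10 * ((f x m).size + 1)) ≤ (bn (num x) + b (num x) + 10 * ((cap (num x)).size + 1) + 2) *
        ∑ i ∈ Finset.range (f x m), ((c (x, i) (M i).1).2 + 1) := by
    rw [Finset.mul_sum]
    refine Finset.sum_le_sum fun j _ => ?_
    have : 10 * ((f x m).size + 1) ≤ 10 * ((cap (num x)).size + 1) := by omega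
    nlinarith [Nat.zero_le ((c (x, j) (M j).1).2), Nat.zero_le (bn (num x)),
      Nat.zero_le (bn (num x) * (c (x, j) (M j).1).2),
      Nat.zero_le ((cap (num x)).size * (c (x, j) (M j).1).2), Nat.zero_le (b (num x))]
  omega

end

/-- A command whose only variable is the size of the instance gives a program. -/
theorem CompC.exists_program {c : ℕ → (ℕ → ℕ) → (ℕ → ℕ) × ℕ} (hc : CompC c) :
    ∃ (P : Program) (b : ℕ → ℕ), PolyBdd b ∧ ∀ (n : ℕ) (r m : ℕ → ℕ), r 0 = n →
      (∀ a, m a ≤ cap n) → ∃ (t : ℕ) (d : Config), HaltsIn P ⟨0, r, m⟩ t d ∧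
        t ≤ b n * (c n m).2 ∧ d.mem = (c n m).1 := by
  obtain ⟨-, b, hb, hF⟩ := hc
  obtain ⟨F, hF⟩ := hF (fun _ => 0) 1 fun _ _ => one_pos
  refine ⟨F.code 0, b, hb, fun n r m hr hm => ?_⟩
  have hok : Ok n m := ⟨fun i _ => le_cap (show n ≤ 11 * n ^ 2 + 11 by nlinarith), hm⟩
  obtain ⟨r', k, hrun, hk, -⟩ := hF n m r hok fun i _ => hr
  refine ⟨k, _, (hrun (F.code 0) 0 fun i _ => by simp).haltsIn ?_, hk, rfl⟩
  simp [F.length_code]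

/-! ### The arithmetic of the algorithm -/

/-- The indicator of `a < b`. -/
def ind (a b : ℕ) : ℕ := if a < b then 1 else 0

/-- The power `(b + 1) ^ i`, for `i ≤ n`. -/
def pw (n b i : ℕ) : ℕ := ∏ j ∈ Finset.range n, (1 + ind j i * b)

/-- The binary digit of `U` at position `i`, for `i ≤ n`. Numbers below `2 ^ n` represent subsets of
`{0, …, n - 1}`. -/
def bit (n U i : ℕ) : ℕ := U / pw n 1 i % 2

/-- The size of the set `U`. -/
def pop (n U : ℕ) : ℕ := ∑ i ∈ Finset.range n, bit n U i

/-- The vertex with label `i`. -/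
def lab (n r i : ℕ) : ℕ := (i + r) % n

/-- The adjacency matrix in terms of labels. -/
def adj (n r : ℕ) (m : ℕ → ℕ) (i j : ℕ) : ℕ := m (n * lab n r i + lab n r j)

/-- The number of arcs from `x` to `U`. -/
def outTo (n : ℕ) (a : ℕ → ℕ → ℕ) (U x : ℕ) : ℕ := ∑ i ∈ Finset.range n, bit n U i * a x i

/-- The number of arcs to `x` from outside `U` and `Z`. -/
def inFrom (n : ℕ) (a : ℕ → ℕ → ℕ) (Z U x : ℕ) : ℕ :=
  ∑ i ∈ Finset.range n, (1 - bit n U i) * (1 - bit n Z i) * a i x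

/-- Indicates that the vertex `x ∈ Z` is to be placed before the vertices outside `U`. -/
def trig (n : ℕ) (a : ℕ → ℕ → ℕ) (Z U x : ℕ) : ℕ := ind (inFrom n a Z U x) (outTo n a U x)

/-- Indicates that the vertex `x ∈ Z` is to be placed directly before `p`, where `p` is the vertex
following `U`. -/
def newTrig (n : ℕ) (a : ℕ → ℕ → ℕ) (Z U p x : ℕ) : ℕ :=
  bit n Z x * (trig n a Z (U + pw n 1 p) x - trig n a Z U x)

/-- The cost of continuing with the vertex `p` after the vertices of `U`. -/
def stepCost (n : ℕ) (a : ℕ → ℕ → ℕ) (Z U p : ℕ) : ℕ :=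
  outTo n a U p +
    ∑ x ∈ Finset.range n, newTrig n a Z U p x * (outTo n a U x + inFrom n a Z U x)

/-- The code of the sort keys given to `p` and to the vertices placed directly before it. -/
def stepCode (n r : ℕ) (a : ℕ → ℕ → ℕ) (Z U p : ℕ) : ℕ :=
  2 * (n - pop n U) * pw n (2 * n + 1) (lab n r p) +
    ∑ x ∈ Finset.range n, newTrig n a Z U p x * (2 * (n - pop n U) + 1) *
      pw n (2 * n + 1) (lab n r x)

/-- Cost and sort keys combined. -/
def stepWeight (n r : ℕ) (a : ℕ → ℕ → ℕ) (Z U p : ℕ) : ℕ :=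
  stepCost n a Z U p * pw n (2 * n + 1) n + stepCode n r a Z U p

/-- The number of arcs inside `Y`. -/
def arcs (n : ℕ) (a : ℕ → ℕ → ℕ) (Y : ℕ) : ℕ :=
  ∑ i ∈ Finset.range n, ∑ j ∈ Finset.range n, bit n Y i * bit n Y j * a i j

/-- The number of arcs entering `Y` within the last `q` vertices. -/
def cross (n q : ℕ) (a : ℕ → ℕ → ℕ) (Y : ℕ) : ℕ :=
  ∑ i ∈ Finset.range n, ∑ j ∈ Finset.range n,
    ind (n - q) (i + 1) * (1 - bit n Y i) * (ind (n - q) (j + 1) * bit n Y j) * a i j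

/-- The number of common elements. -/
def inter (n Y Z : ℕ) : ℕ := ∑ i ∈ Finset.range n, bit n Y i * bit n Z i

/-- The set of the last `q` vertices coded by `A < 2 ^ q`. -/
def up (n q A : ℕ) : ℕ := A * pw n 1 (n - q)

/-- A number exceeding all the values in the search for a sparse set. -/
def searchCap (n q : ℕ) : ℕ := (n * n + 1) * pw n 1 q

/-- The value of `A` in the search for a sparse set. -/
def searchVal (n q : ℕ) (a : ℕ → ℕ → ℕ) (A : ℕ) : ℕ :=
  ind q (2 * pop n A + 1) * (searchCap n q - (arcs n a (up n q A) * pw n 1 q + A))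

/-- The memory cell used in the search for a sparse set. -/
def searchCell (n r : ℕ) : ℕ := n * n + (1 + r)

/-- The number of arcs inside the sparse set. -/
def sparseArcs (n q r : ℕ) (m : ℕ → ℕ) : ℕ := (searchCap n q - m (searchCell n r)) / pw n 1 q

/-- The sparse set. -/
def sparseSet (n q r : ℕ) (m : ℕ → ℕ) : ℕ :=
  up n q ((searchCap n q - m (searchCell n r)) % pw n 1 q)

/-- The set of vertices that are placed according to thresholds. -/
def zset (n q r mode : ℕ) (m : ℕ → ℕ) : ℕ := (1 - mode) * sparseSet n q r m

/-- The set `Y` is admissible if this is zero. -/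
def defect (n q r mode : ℕ) (m : ℕ → ℕ) (Y : ℕ) : ℕ :=
  mode * (8 * cross n q (adj n r m) Y + 1 - sparseArcs n q r m) +
    (1 - mode) * inter n (sparseSet n q r m) Y

/-- The initial value of the dynamic program. -/
def initVal (n q r mode : ℕ) (m : ℕ → ℕ) : ℕ :=
  cap n - (1 - mode) * sparseArcs n q r m * pw n (2 * n + 1) n

/-- The cells of the table of the dynamic program. -/
def tableCell (n r mode U : ℕ) : ℕ := n * n + (n + 1) + (2 * r + mode) * pw n 1 n + U

/-- The value of the dynamic program at `U`. -/
def tableVal (n q r mode : ℕ) (m : ℕ → ℕ) (U : ℕ) : ℕ :=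
  max ((1 - U) * initVal n q r mode m) ((Finset.range n).sup fun v => bit n U v *
    (m (tableCell n r mode (U - pw n 1 v)) -
      stepWeight n r (adj n r m) (zset n q r mode m) (U - pw n 1 v) v))

/-- The sort key of a vertex coded in the best value found. -/
def key (n : ℕ) (m : ℕ → ℕ) (v : ℕ) : ℕ := (cap n - m (n * n)) / pw n (2 * n + 1) v % (2 * n + 2)

/-- The position of a vertex in the order of decreasing sort keys. -/
def rank (n : ℕ) (κ : ℕ → ℕ) (v : ℕ) : ℕ :=
  ∑ u ∈ Finset.range n, ind (κ v * n + v) (κ u * n + u)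

/-! ### The algorithm -/

section

variable (k : ℕ)

/-- The search for a sparse set among the last vertices. -/
def searchC : ℕ × ℕ → (ℕ → ℕ) → (ℕ → ℕ) × ℕ :=
  forC (fun x _ => pw (num x) 1 (num x / k)) <|
    storeC (fun x _ => searchCell (num x) x.1.2) fun x m => max (m (searchCell (num x) x.1.2))
      (searchVal (num x) (num x / k) (adj (num x) x.1.2 m) x.2)

/-- One entry of the table. -/
def entryC : ((((ℕ × ℕ) × ℕ) × ℕ) × ℕ) × ℕ → (ℕ → ℕ) → (ℕ → ℕ) × ℕ :=
  storeC (fun x _ => tableCell (num x) x.1.1.1.1.2 x.1.1.1.2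
      (up (num x) (num x / k) x.1.1.2 + x.2))
    fun x m => tableVal (num x) (num x / k) x.1.1.1.1.2 x.1.1.1.2 m
      (up (num x) (num x / k) x.1.1.2 + x.2)

/-- The dynamic program. -/
def tableC : (ℕ × ℕ) × ℕ → (ℕ → ℕ) → (ℕ → ℕ) × ℕ :=
  forC (fun x _ => pw (num x) 1 (num x / k)) <|
    forC (fun x m => 1 - defect (num x) (num x / k) x.1.1.2 x.1.2 m
        (up (num x) (num x / k) x.2)) <|
      forC (fun x _ => pw (num x) 1 (num x - num x / k)) (entryC k)

/-- Update of the best value found. -/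
def bestC : (ℕ × ℕ) × ℕ → (ℕ → ℕ) → (ℕ → ℕ) × ℕ :=
  storeC (fun x _ => num x * num x) fun x m => max (m (num x * num x))
    (m (tableCell (num x) x.1.2 x.2
      (pw (num x) 1 (num x) - 1 - zset (num x) (num x / k) x.1.2 x.2 m)))

/-- The whole algorithm. -/
def mainC : ℕ → (ℕ → ℕ) → (ℕ → ℕ) × ℕ :=
  seqC (forC (fun x _ => num x) (seqC (searchC k) (forC (fun _ _ => 2) (seqC (tableC k) (bestC k)))))
    (forC (fun x _ => num x) (storeC (fun x _ => x.2) fun x m => rank (num x) (key (num x) m) x.2))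

end

/-! ### The algorithm runs on the machine -/

section

variable {V : Type} [Ctx V] {f g h r z p : V → (ℕ → ℕ) → ℕ} {k : ℕ}

theorem Comp.ind (hf : Comp f) (hg : Comp g) : Comp fun x m => ind (f x m) (g x m) := by
  simpa only [show ∀ a b, RAM.ind a b = 1 - (1 - (b - a)) from fun a b => by
    unfold RAM.ind; split_ifs <;> omega] using (Comp.const 1).sub ((Comp.const 1).sub (hg.sub hf))

theorem Comp.pw (hf : Comp f) (hg : Comp g) :
    Comp fun x m => pw (RAM.num x) (f x m) (g x m) :=
  .prod ((Comp.const 1).add ((Comp.last.ind hg.wk).mul hf.wk))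

theorem Comp.bit (hf : Comp f) (hg : Comp g) : Comp fun x m => bit (RAM.num x) (f x m) (g x m) :=
  (hf.div (.pw (.const 1) hg)).mod (.const 2)

theorem Comp.bit' (hf : Comp f) :
    Comp fun (x : V × ℕ) m => RAM.bit (RAM.num x.1) (f x.1 m) x.2 := by
  simpa only [num_pair] using hf.wk.bit .last

theorem Comp.pop (hf : Comp f) : Comp fun x m => pop (RAM.num x) (f x m) := .sum hf.bit'

theorem Comp.lab (hr : Comp r) (hf : Comp f) : Comp fun x m => lab (RAM.num x) (r x m) (f x m) :=
  (hf.add hr).mod .num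

theorem Comp.adj (hr : Comp r) (hf : Comp f) (hg : Comp g) :
    Comp fun x m => adj (RAM.num x) (r x m) m (f x m) (g x m) :=
  ((Comp.num.mul (hr.lab hf)).add (hr.lab hg)).load

theorem Comp.outTo (hr : Comp r) (hf : Comp f) (hg : Comp g) :
    Comp fun x m => outTo (RAM.num x) (RAM.adj (RAM.num x) (r x m) m) (f x m) (g x m) :=
  .sum (hf.bit'.mul (by simpa only [num_pair] using hr.wk.adj hg.wk .last))

theorem Comp.inFrom (hr : Comp r) (hz : Comp z) (hf : Comp f) (hg : Comp g) : Comp fun x m =>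
    inFrom (RAM.num x) (RAM.adj (RAM.num x) (r x m) m) (z x m) (f x m) (g x m) :=
  .sum ((((Comp.const 1).sub hf.bit').mul ((Comp.const 1).sub hz.bit')).mul
    (by simpa only [num_pair] using hr.wk.adj .last hg.wk))

theorem Comp.trig (hr : Comp r) (hz : Comp z) (hf : Comp f) (hg : Comp g) : Comp fun x m =>
    trig (RAM.num x) (RAM.adj (RAM.num x) (r x m) m) (z x m) (f x m) (g x m) :=
  (hr.inFrom hz hf hg).ind (hr.outTo hf hg)

theorem Comp.newTrig (hr : Comp r) (hz : Comp z) (hf : Comp f) (hp : Comp p) (hg : Comp g) :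
    Comp fun x m =>
      newTrig (RAM.num x) (RAM.adj (RAM.num x) (r x m) m) (z x m) (f x m) (p x m) (g x m) :=
  (hz.bit hg).mul ((hr.trig hz (hf.add (.pw (.const 1) hp)) hg).sub (hr.trig hz hf hg))

theorem Comp.stepCost (hr : Comp r) (hz : Comp z) (hf : Comp f) (hp : Comp p) : Comp fun x m =>
    stepCost (RAM.num x) (RAM.adj (RAM.num x) (r x m) m) (z x m) (f x m) (p x m) :=
  (hr.outTo hf hp).add (.sum (by
    simpa only [num_pair] using (hr.wk.newTrig hz.wk hf.wk hp.wk .last).mul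
      ((hr.wk.outTo hf.wk .last).add (hr.wk.inFrom hz.wk hf.wk .last))))

theorem Comp.stepCode (hr : Comp r) (hz : Comp z) (hf : Comp f) (hp : Comp p) : Comp fun x m =>
    stepCode (RAM.num x) (r x m) (RAM.adj (RAM.num x) (r x m) m) (z x m) (f x m) (p x m) := by
  have h1 := (Comp.const 2).mul (Comp.num.sub hf.pop)
  have h2 := ((Comp.const 2).mul (Comp.num (V := V))).add (.const 1)
  refine (h1.mul (h2.pw (hr.lab hp))).add (.sum ?_)
  have h3 := h2.wk.pw (hr.wk.lab .last)
  have h4 := (hr.wk.newTrig hz.wk hf.wk hp.wk .last).mul (h1.add (.const 1)).wk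
  simpa only [num_pair] using h4.mul h3

theorem Comp.stepWeight (hr : Comp r) (hz : Comp z) (hf : Comp f) (hp : Comp p) :
    Comp fun x m =>
      stepWeight (RAM.num x) (r x m) (RAM.adj (RAM.num x) (r x m) m) (z x m) (f x m) (p x m) :=
  ((hr.stepCost hz hf hp).mul ((((Comp.const 2).mul .num).add (.const 1)).pw .num)).add
    (hr.stepCode hz hf hp)

theorem Comp.q : Comp fun (x : V) _ => RAM.num x / k := Comp.num.div (.const k)

theorem Comp.arcs (hr : Comp r) (hf : Comp f) :
    Comp fun x m => arcs (RAM.num x) (RAM.adj (RAM.num x) (r x m) m) (f x m) := by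
  refine .sum ?_
  simpa only [num_pair] using Comp.sum (V := V × ℕ) (h := fun x m j =>
    RAM.bit (RAM.num x) (f x.1 m) x.2 * RAM.bit (RAM.num x) (f x.1 m) j *
      RAM.adj (RAM.num x) (r x.1 m) m x.2 j) (by
    simpa only [num_pair] using (((hf.wk.bit .last).wk).mul (hf.wk.wk.bit .last)).mul
      (hr.wk.wk.adj Comp.last.wk .last))

theorem Comp.cross (hr : Comp r) (hf : Comp f) :
    Comp fun x m => cross (RAM.num x) (RAM.num x / k) (RAM.adj (RAM.num x) (r x m) m) (f x m) := by
  refine .sum ?_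
  have hnq := (Comp.num (V := (V × ℕ) × ℕ)).sub (.q (k := k))
  have hi := Comp.last (V := V).wk
  simpa only [num_pair] using Comp.sum (V := V × ℕ) (h := fun x m j =>
    RAM.ind (RAM.num x - RAM.num x / k) (x.2 + 1) * (1 - RAM.bit (RAM.num x) (f x.1 m) x.2) *
      (RAM.ind (RAM.num x - RAM.num x / k) (j + 1) * RAM.bit (RAM.num x) (f x.1 m) j) *
      RAM.adj (RAM.num x) (r x.1 m) m x.2 j) (by
    simpa only [num_pair] using (((hnq.ind (hi.add (.const 1))).mul ((Comp.const 1).sub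
      (hf.wk.wk.bit hi))).mul ((hnq.ind (Comp.last.add (.const 1))).mul
        (hf.wk.wk.bit .last))).mul (hr.wk.wk.adj hi .last))

theorem Comp.inter (hf : Comp f) (hg : Comp g) :
    Comp fun x m => inter (RAM.num x) (f x m) (g x m) := .sum (hf.bit'.mul hg.bit')

theorem Comp.up (hf : Comp f) : Comp fun x m => up (RAM.num x) (RAM.num x / k) (f x m) :=
  hf.mul (.pw (.const 1) (Comp.num.sub .q))

theorem Comp.searchCap : Comp fun (x : V) _ => searchCap (RAM.num x) (RAM.num x / k) :=
  ((Comp.num.mul .num).add (.const 1)).mul (.pw (.const 1) .q)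

theorem Comp.searchVal (hr : Comp r) (hf : Comp f) : Comp fun x m =>
    searchVal (RAM.num x) (RAM.num x / k) (RAM.adj (RAM.num x) (r x m) m) (f x m) :=
  (Comp.q.ind (((Comp.const 2).mul hf.pop).add (.const 1))).mul
    (Comp.searchCap.sub (((hr.arcs hf.up).mul (.pw (.const 1) .q)).add hf))

theorem Comp.searchCell (hr : Comp r) : Comp fun x m => searchCell (RAM.num x) (r x m) :=
  (Comp.num.mul .num).add ((Comp.const 1).add hr)

theorem Comp.sparseArcs (hr : Comp r) :
    Comp fun x m => sparseArcs (RAM.num x) (RAM.num x / k) (r x m) m :=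
  (Comp.searchCap.sub hr.searchCell.load).div (.pw (.const 1) .q)

theorem Comp.sparseSet (hr : Comp r) :
    Comp fun x m => sparseSet (RAM.num x) (RAM.num x / k) (r x m) m :=
  ((Comp.searchCap.sub hr.searchCell.load).mod (.pw (.const 1) .q)).up

theorem Comp.zset (hr : Comp r) (hf : Comp f) :
    Comp fun x m => zset (RAM.num x) (RAM.num x / k) (r x m) (f x m) m :=
  ((Comp.const 1).sub hf).mul hr.sparseSet

theorem Comp.defect (hr : Comp r) (hf : Comp f) (hg : Comp g) :
    Comp fun x m => defect (RAM.num x) (RAM.num x / k) (r x m) (f x m) m (g x m) :=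
  (hf.mul ((((Comp.const 8).mul (hr.cross hg)).add (.const 1)).sub hr.sparseArcs)).add
    (((Comp.const 1).sub hf).mul (hr.sparseSet.inter hg))

theorem Comp.cap : Comp fun (x : V) _ => cap (RAM.num x) := by
  have h : ∀ n, RAM.cap n = RAM.pw n (2 * n + 1) n * (11 * (n * n) + 11) := fun n => by
    rw [RAM.cap, RAM.pw, Finset.prod_congr rfl (g := fun _ => 2 * n + 2), Finset.prod_const,
      Finset.card_range, pow_two]
    intro i hi
    rw [RAM.ind, if_pos (Finset.mem_range.1 hi)]
    omega
  simp_rw [h]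
  exact ((((Comp.const 2).mul .num).add (.const 1)).pw .num).mul
    (((Comp.const 11).mul (Comp.num.mul .num)).add (.const 11))

theorem Comp.initVal (hr : Comp r) (hf : Comp f) :
    Comp fun x m => initVal (RAM.num x) (RAM.num x / k) (r x m) (f x m) m :=
  Comp.cap.sub ((((Comp.const 1).sub hf).mul hr.sparseArcs).mul
    ((((Comp.const 2).mul .num).add (.const 1)).pw .num))

theorem Comp.tableCell (hr : Comp r) (hf : Comp f) (hg : Comp g) :
    Comp fun x m => tableCell (RAM.num x) (r x m) (f x m) (g x m) :=
  (((Comp.num.mul .num).add (Comp.num.add (.const 1))).add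
    ((((Comp.const 2).mul hr).add hf).mul (.pw (.const 1) .num))).add hg

theorem Comp.tableVal (hr : Comp r) (hf : Comp f) (hg : Comp g) :
    Comp fun x m => tableVal (RAM.num x) (RAM.num x / k) (r x m) (f x m) m (g x m) := by
  refine ((((Comp.const 1).sub hg).mul (hr.initVal hf))).max (.sup ?_)
  have hU := hg.wk.sub (.pw (.const 1) .last)
  simpa only [num_pair] using (hg.wk.bit .last).mul
    ((hr.wk.tableCell hf.wk hU).load.sub (hr.wk.stepWeight (hr.wk.zset hf.wk) hU .last))

theorem Comp.key (hf : Comp f) : Comp fun x m => key (RAM.num x) m (f x m) :=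
  ((Comp.cap.sub (Comp.num.mul .num).load).div ((((Comp.const 2).mul .num).add (.const 1)).pw
    hf)).mod (((Comp.const 2).mul .num).add (.const 2))

theorem Comp.rank (hf : Comp f) :
    Comp fun x m => rank (RAM.num x) (RAM.key (RAM.num x) m) (f x m) := by
  refine .sum ?_
  simpa only [num_pair] using ((hf.wk.key.mul .num).add hf.wk).ind
    ((Comp.last.key.mul .num).add .last)

end

/-! ### Size bounds and assembly of the program -/

theorem ind_le_one (a b : ℕ) : ind a b ≤ 1 := by
  unfold ind; split_ifs <;> omega

theorem bit_le_one (n U i : ℕ) : bit n U i ≤ 1 := by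
  unfold bit; omega

/-- `pw` is a product over all `j < n`, with trivial factors from `i` on, because the available
folds have exactly `n` terms. This is why `i ≤ n` is needed. -/
theorem pw_eq {n i : ℕ} (h : i ≤ n) (b : ℕ) : pw n b i = (b + 1) ^ i := by
  rw [pw, Finset.prod_congr rfl (g := fun j => if j < i then b + 1 else 1)]
  · rw [Finset.prod_ite, Finset.prod_const, Finset.prod_const_one, mul_one]
    congr
    rw [show (Finset.range n).filter (· < i) = Finset.range i by ext; simp; omega,
      Finset.card_range]
  · intro j _
    unfold ind
    split_ifs <;> omega

theorem pw_two_le_cap {n i : ℕ} (h : i ≤ n) : pw n 1 i ≤ cap n := by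
  rw [pw_eq h]
  exact le_cap_of_le ((Nat.pow_le_pow_right (by omega) h).trans (Nat.pow_le_pow_left (by omega) n))

theorem rank_le (n : ℕ) (κ : ℕ → ℕ) (v : ℕ) : rank n κ v ≤ n :=
  (Finset.sum_le_sum fun _ _ => ind_le_one _ _).trans (by simp)

theorem searchCap_le_cap {n q : ℕ} (h : q ≤ n) : searchCap n q ≤ cap n := by
  rw [searchCap, pw_eq h, cap, mul_comm]
  refine Nat.mul_le_mul ?_ (by nlinarith)
  exact (Nat.pow_le_pow_right (by omega) h).trans (Nat.pow_le_pow_left (by omega) n)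

theorem compC_searchC (k : ℕ) : CompC (searchC k) := by
  refine .for (.pw (.const 1) .q) (fun x m _ => pw_two_le_cap (Nat.div_le_self _ _)) ?_
  refine .store Comp.last.wk.searchCell
    (Comp.last.wk.searchCell.load.max (Comp.last.wk.searchVal .last)) fun x m hx => ?_
  refine max_le (hx.mem _) (le_trans ?_ (searchCap_le_cap (Nat.div_le_self (num x) k)))
  refine (Nat.mul_le_mul (ind_le_one _ _) (Nat.sub_le _ _)).trans (by rw [one_mul])

theorem compC_entryC (k : ℕ) : CompC (entryC k) := by
  have h1 := Comp.last (V := ℕ).wk.wk.wk.wk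
  have h2 := Comp.last (V := ℕ × ℕ).wk.wk.wk
  have hU := (Comp.up (k := k) (Comp.last (V := (ℕ × ℕ) × ℕ).wk.wk)).add .last
  refine .store (h1.tableCell h2 hU) (h1.tableVal h2 hU) fun x m hx => ?_
  refine max_le ?_ (Finset.sup_le fun v _ => ?_)
  · exact (Nat.mul_le_mul (Nat.sub_le 1 _) (Nat.sub_le _ _)).trans (by rw [one_mul])
  · exact (Nat.mul_le_mul (bit_le_one _ _ _) (Nat.sub_le _ _)).trans
      (by rw [one_mul]; exact hx.mem _)

theorem compC_tableC (k : ℕ) : CompC (tableC k) := by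
  refine .for (.pw (.const 1) .q) (fun x m _ => pw_two_le_cap (Nat.div_le_self _ _)) ?_
  -- The conditional is a loop that runs `1 - defect` times: once for an admissible set and never
  -- otherwise.
  refine .for ((Comp.const 1).sub (.defect Comp.last.wk.wk Comp.last.wk (.up .last)))
    (fun x m _ => (Nat.sub_le _ _).trans (le_cap (by omega))) ?_
  exact .for (.pw (.const 1) (Comp.num.sub .q)) (fun x m _ => pw_two_le_cap (Nat.sub_le _ _))
    (compC_entryC k)

theorem compC_bestC (k : ℕ) : CompC (bestC k) := by
  refine .store (Comp.num.mul .num) ((Comp.num.mul .num).load.max (.load (.tableCell Comp.last.wk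
    .last (((Comp.pw (.const 1) .num).sub (.const 1)).sub (.zset Comp.last.wk .last)))))
    fun x m hx => max_le (hx.mem _) (hx.mem _)

theorem compC_mainC (k : ℕ) : CompC (mainC k) := by
  refine .seq (.for .num (fun x m hx => hx.num_le) (.seq (compC_searchC k)
    (.for (.const 2) (fun x m _ => le_cap (by omega)) (.seq (compC_tableC k) (compC_bestC k)))))
    (.for .num (fun x m hx => hx.num_le) (.store .last (.rank .last) fun x m hx => ?_))
  exact (rank_le _ _ _).trans hx.num_le

/-! ### Counting sets that respect most arcs -/

section

variable {ι : Type*} [DecidableEq ι]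

/-- Double counting: if every arc inside `Y` were violated by more than an eighth of `B`, the
violations would on average be at least `m / 8` per member of `B`. -/
theorem exists_arc_rarely_violated (a : ι → ι → ℕ) (Y : Finset ι) (B : Finset (Finset ι)) (m : ℕ)
    (hB : B.Nonempty) (hcross : ∀ A ∈ B, 8 * ∑ i ∈ Y, ∑ j ∈ Y, (if i ∉ A ∧ j ∈ A then a i j else 0) < m)
    (hm : m ≤ ∑ i ∈ Y, ∑ j ∈ Y, a i j) :
    ∃ i ∈ Y, ∃ j ∈ Y, a i j ≠ 0 ∧ 8 * (B.filter fun A => i ∉ A ∧ j ∈ A).card ≤ B.card := by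
  by_contra! h
  have h1 : ∑ A ∈ B, 8 * ∑ i ∈ Y, ∑ j ∈ Y, (if i ∉ A ∧ j ∈ A then a i j else 0) < B.card * m := by
    rw [← smul_eq_mul, ← Finset.sum_const]
    exact Finset.sum_lt_sum_of_nonempty hB hcross
  have h2 : ∑ A ∈ B, 8 * ∑ i ∈ Y, ∑ j ∈ Y, (if i ∉ A ∧ j ∈ A then a i j else 0) =
      ∑ i ∈ Y, ∑ j ∈ Y, a i j * (8 * (B.filter fun A => i ∉ A ∧ j ∈ A).card) := by
    rw [← Finset.mul_sum, Finset.sum_comm, Finset.mul_sum]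
    refine Finset.sum_congr rfl fun i _ => ?_
    rw [Finset.sum_comm, Finset.mul_sum]
    refine Finset.sum_congr rfl fun j _ => ?_
    rw [← Finset.sum_filter, Finset.sum_const, smul_eq_mul]
    ring
  have h3 : ∑ i ∈ Y, ∑ j ∈ Y, a i j * B.card ≤
      ∑ i ∈ Y, ∑ j ∈ Y, a i j * (8 * (B.filter fun A => i ∉ A ∧ j ∈ A).card) :=
    Finset.sum_le_sum fun i hi => Finset.sum_le_sum fun j hj => by
      rcases eq_or_ne (a i j) 0 with h0 | h0
      · simp [h0]
      · exact Nat.mul_le_mul_left _ (h i hi j hj h0).le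
  simp_rw [← Finset.sum_mul] at h3
  have h4 := Nat.mul_le_mul_right B.card hm
  rw [mul_comm] at h1
  omega

/-- A family of sets each of which is entered by fewer than an eighth of `m` arcs is small if all
large sets contain `m` arcs. -/
theorem card_family_le (a : ι → ι → ℕ) (ha : ∀ i, a i i = 0) (m s : ℕ) (Y : Finset ι)
    (B : Finset (Finset ι)) (hBY : ∀ A ∈ B, A ⊆ Y)
    (hcross : ∀ A ∈ B, 8 * ∑ i ∈ Y, ∑ j ∈ Y, (if i ∉ A ∧ j ∈ A then a i j else 0) < m)
    (hm : ∀ Y' ⊆ Y, Y.card ≤ Y'.card + 2 * s → m ≤ ∑ i ∈ Y', ∑ j ∈ Y', a i j) :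
    B.card * 7 ^ s ≤ 6 ^ s * 2 ^ Y.card := by
  induction s generalizing Y B with
  | zero =>
    simpa using Finset.card_le_card (show B ⊆ Y.powerset from fun A hA =>
      Finset.mem_powerset.2 (hBY A hA))
  | succ s ih =>
    rcases B.eq_empty_or_nonempty with rfl | hne
    · simp
    obtain ⟨u, hu, w, hw, huw, hviol⟩ := exists_arc_rarely_violated a Y B m hne hcross
      (hm Y subset_rfl (by omega))
    have hne' : u ≠ w := fun h => huw (h ▸ ha u)
    set Y' := (Y.erase u).erase w with hY'
    have hw' : w ∈ Y.erase u := Finset.mem_erase.2 ⟨hne'.symm, hw⟩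
    have hcard : Y.card = Y'.card + 2 := by
      have h1 := Finset.card_erase_add_one hu
      have h2 := Finset.card_erase_add_one hw'
      rw [← hY'] at h2
      omega
    have hsub : Y' ⊆ Y := (Finset.erase_subset _ _).trans (Finset.erase_subset _ _)
    -- Among the sets with a fixed pattern on `u` and `w`, deleting both vertices is injective and
    -- creates no new crossing arcs. The loss of two vertices is covered by the slack `2 * s`, so
    -- the induction hypothesis applies on `Y'`.
    have key : ∀ b c : Prop, [Decidable b] → [Decidable c] →
        (B.filter fun A => (u ∈ A ↔ b) ∧ (w ∈ A ↔ c)).card * 7 ^ s ≤ 6 ^ s * 2 ^ Y'.card := by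
      intro b c _ _
      set C := B.filter fun A => (u ∈ A ↔ b) ∧ (w ∈ A ↔ c) with hC
      have hinj : Set.InjOn (fun A : Finset ι => (A.erase u).erase w) C := by
        intro A hA A' hA' h
        simp only [hC, Finset.coe_filter, Set.mem_ofPred_eq] at hA hA'
        ext i
        rcases eq_or_ne i u with rfl | hi
        · exact hA.2.1.trans hA'.2.1.symm
        rcases eq_or_ne i w with rfl | hi'
        · exact hA.2.2.trans hA'.2.2.symm
        have := congrArg (i ∈ ·) h
        simpa [hi, hi'] using this
      rw [← Finset.card_image_of_injOn hinj]
      refine ih Y' _ ?_ ?_ fun Y'' hY'' hc => hm Y'' (hY''.trans hsub) (by omega)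
      · intro A hA
        obtain ⟨A', hA', rfl⟩ := Finset.mem_image.1 hA
        exact Finset.erase_subset_erase _
          (Finset.erase_subset_erase _ (hBY A' (Finset.mem_filter.1 hA').1))
      · intro A hA
        obtain ⟨A', hA', rfl⟩ := Finset.mem_image.1 hA
        refine lt_of_le_of_lt (Nat.mul_le_mul_left _ ?_) (hcross A' (Finset.mem_filter.1 hA').1)
        refine le_trans (Finset.sum_le_sum fun i hi => ?_)
          (Finset.sum_le_sum_of_subset hsub)
        refine le_trans (Finset.sum_le_sum fun j hj => ?_)
          (Finset.sum_le_sum_of_subset hsub)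
        simp only [hY', Finset.mem_erase] at hi hj
        simp only [Finset.mem_erase, hi.1, hi.2.1, hj.1, hj.2.1, ne_eq, not_false_eq_true, true_and]
        exact le_rfl
    have hcover : B ⊆ (B.filter fun A => u ∉ A ∧ w ∈ A) ∪
        ((B.filter fun A => (u ∈ A ↔ False) ∧ (w ∈ A ↔ False)) ∪
        ((B.filter fun A => (u ∈ A ↔ True) ∧ (w ∈ A ↔ False)) ∪
        (B.filter fun A => (u ∈ A ↔ True) ∧ (w ∈ A ↔ True)))) := by
      intro A hA
      simp only [Finset.mem_union, Finset.mem_filter, hA, true_and, iff_true, iff_false]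
      tauto
    have h0 := Finset.card_le_card hcover
    have h1 := Finset.card_union_le (B.filter fun A => u ∉ A ∧ w ∈ A)
      ((B.filter fun A => (u ∈ A ↔ False) ∧ (w ∈ A ↔ False)) ∪
        ((B.filter fun A => (u ∈ A ↔ True) ∧ (w ∈ A ↔ False)) ∪
        (B.filter fun A => (u ∈ A ↔ True) ∧ (w ∈ A ↔ True))))
    have h2 := Finset.card_union_le (B.filter fun A => (u ∈ A ↔ False) ∧ (w ∈ A ↔ False))
      ((B.filter fun A => (u ∈ A ↔ True) ∧ (w ∈ A ↔ False)) ∪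
        (B.filter fun A => (u ∈ A ↔ True) ∧ (w ∈ A ↔ True)))
    have h3 := Finset.card_union_le (B.filter fun A => (u ∈ A ↔ True) ∧ (w ∈ A ↔ False))
      (B.filter fun A => (u ∈ A ↔ True) ∧ (w ∈ A ↔ True))
    have k1 := key False False
    have k2 := key True False
    have k3 := key True True
    rw [hcard, pow_succ, pow_succ, pow_add]
    generalize (B.filter fun A => (u ∈ A ↔ False) ∧ (w ∈ A ↔ False)).card = x at *
    generalize (B.filter fun A => (u ∈ A ↔ True) ∧ (w ∈ A ↔ False)).card = y at *
    generalize (B.filter fun A => (u ∈ A ↔ True) ∧ (w ∈ A ↔ True)).card = z at *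
    -- The pattern violating the arc takes at most an eighth of `B`, so the other three take at
    -- least seven eighths. The resulting factor `8 * 3 / 7` for two vertices is `6 / 7` of the
    -- trivial factor `4`.
    have h5 : 7 * B.card ≤ 8 * (x + y + z) := by omega
    calc B.card * (7 ^ s * 7) = 7 * B.card * 7 ^ s := by ring
      _ ≤ 8 * (x + y + z) * 7 ^ s := Nat.mul_le_mul_right _ h5
      _ = 8 * (x * 7 ^ s + y * 7 ^ s + z * 7 ^ s) := by ring
      _ ≤ 8 * (6 ^ s * 2 ^ Y'.card + 6 ^ s * 2 ^ Y'.card + 6 ^ s * 2 ^ Y'.card) := by omega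
      _ = 6 ^ s * 6 * (2 ^ Y'.card * 2 ^ 2) := by ring

end

/-! ### Binary digits -/

section

variable {n U V i v : ℕ}

theorem bit_eq (h : i ≤ n) : bit n U i = (U.testBit i).toNat := by
  rw [bit, pw_eq h, Nat.toNat_testBit]

theorem bit_eq_one (h : i ≤ n) : bit n U i = 1 ↔ U.testBit i = true := by
  rw [bit_eq h]; cases U.testBit i <;> simp

theorem bit_eq_zero (h : i ≤ n) : bit n U i = 0 ↔ U.testBit i = false := by
  rw [bit_eq h]; cases U.testBit i <;> simp

theorem bit_zero_left (n i : ℕ) : bit n 0 i = 0 := by simp [bit]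

/-- The digit at `v` is zero, so adding `2 ^ v` produces no carry. -/
theorem testBit_add_two_pow (h : U.testBit v = false) (i : ℕ) :
    (U + 2 ^ v).testBit i = if i = v then true else U.testBit i := by
  have hl := Nat.mod_lt U (Nat.two_pow_pos v)
  have hU : U = 2 ^ v * (U / 2 ^ v) + U % 2 ^ v := (Nat.div_add_mod _ _).symm
  have hU' : U + 2 ^ v = 2 ^ v * (U / 2 ^ v + 1) + U % 2 ^ v := by rw [mul_add]; omega
  have he : U / 2 ^ v % 2 = 0 := by
    have := Nat.toNat_testBit U v
    rw [h] at this
    exact this.symm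
  rw [hU', Nat.testBit_two_pow_mul_add _ hl]
  conv_rhs => rw [hU, Nat.testBit_two_pow_mul_add _ hl]
  rcases lt_trichotomy i v with hi | rfl | hi
  · simp [hi, hi.ne]
  · simp [Nat.testBit_zero]; omega
  · obtain ⟨d, rfl⟩ := Nat.exists_eq_add_of_lt hi
    rw [if_neg (by omega), if_neg (by omega), if_neg (by omega),
      show v + d + 1 - v = d + 1 by omega, Nat.testBit_succ, Nat.testBit_succ]
    congr 1
    omega

theorem bit_add_pw (hv : v < n) (h : bit n U v = 0) (hi : i < n) :
    bit n (U + pw n 1 v) i = if i = v then 1 else bit n U i := by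
  rw [bit_eq_zero hv.le] at h
  rw [bit_eq hi.le, pw_eq hv.le, testBit_add_two_pow h]
  split_ifs
  · rfl
  · rw [bit_eq hi.le]

theorem pw_le_of_bit (hv : v < n) (h : bit n U v = 1) : pw n 1 v ≤ U := by
  rw [bit_eq_one hv.le] at h
  rw [pw_eq hv.le]
  exact Nat.ge_two_pow_of_testBit h

theorem bit_sub_pw_self (hv : v < n) (h : bit n U v = 1) : bit n (U - pw n 1 v) v = 0 := by
  have hle := pw_le_of_bit hv h
  rw [bit, pw_eq hv.le] at *
  have hp := Nat.two_pow_pos v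
  have h1 : (U - 2 ^ v) / 2 ^ v = U / 2 ^ v - 1 := by
    simpa using Nat.sub_mul_div_of_le U (2 ^ v) 1 (by simpa using hle)
  rw [show (1 + 1 : ℕ) = 2 from rfl] at *
  omega

theorem eq_of_bit_eq (hU : U < 2 ^ n) (hV : V < 2 ^ n) (h : ∀ i < n, bit n U i = bit n V i) :
    U = V := by
  refine Nat.eq_of_testBit_eq fun i => ?_
  rcases lt_or_ge i n with hi | hi
  · have := h i hi
    rw [bit_eq hi.le, bit_eq hi.le] at this
    cases hx : U.testBit i <;> cases hy : V.testBit i <;> simp_all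
  · rw [Nat.testBit_lt_two_pow (hU.trans_le (Nat.pow_le_pow_right (by omega) hi)),
      Nat.testBit_lt_two_pow (hV.trans_le (Nat.pow_le_pow_right (by omega) hi))]

theorem add_pw_lt (hU : U < 2 ^ n) (hv : v < n) (h : bit n U v = 0) : U + pw n 1 v < 2 ^ n := by
  refine Nat.lt_pow_two_of_testBit _ fun i hi => ?_
  rw [bit_eq_zero hv.le] at h
  rw [pw_eq hv.le, testBit_add_two_pow h, if_neg (by omega)]
  exact Nat.testBit_lt_two_pow (hU.trans_le (Nat.pow_le_pow_right (by omega) hi))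

theorem bit_compl (hU : U < 2 ^ n) (hi : i < n) : bit n (pw n 1 n - 1 - U) i = 1 - bit n U i := by
  rw [pw_eq le_rfl, Nat.sub_sub, add_comm 1 U, bit_eq hi.le, bit_eq hi.le,
    Nat.testBit_two_pow_sub_succ hU]
  cases U.testBit i <;> simp [hi]

theorem bit_up_add {q A P : ℕ} (hP : P < 2 ^ (n - q)) (hi : i < n) :
    bit n (up n q A + P) i = if i < n - q then bit n P i else bit n A (i - (n - q)) := by
  rw [up, pw_eq (Nat.sub_le _ _), mul_comm, bit_eq hi.le, Nat.testBit_two_pow_mul_add _ hP]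
  split_ifs
  · rw [bit_eq hi.le]
  · rw [bit_eq (by omega)]

theorem bit_up {q A : ℕ} (hi : i < n) :
    bit n (up n q A) i = if i < n - q then 0 else bit n A (i - (n - q)) := by
  simpa [bit_zero_left] using bit_up_add (A := A) (Nat.two_pow_pos (n - q)) hi

theorem up_lt {q A P : ℕ} (hq : q ≤ n) (hA : A < 2 ^ q) (hP : P < 2 ^ (n - q)) :
    up n q A + P < 2 ^ n := by
  have h : 2 ^ n = 2 ^ q * 2 ^ (n - q) := by rw [← pow_add, Nat.add_sub_cancel' hq]
  rw [up, pw_eq (Nat.sub_le _ _), h]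
  calc A * 2 ^ (n - q) + P < (A + 1) * 2 ^ (n - q) := by rw [add_mul]; omega
    _ ≤ 2 ^ q * 2 ^ (n - q) := Nat.mul_le_mul_right _ hA

theorem bit_up_right {q A i : ℕ} (hq : q ≤ n) (hi : i < q) :
    bit n (up n q A) (n - q + i) = bit n A i := by
  rw [bit_up (by omega), if_neg (by omega), Nat.add_sub_cancel_left]

/-- Every set of numbers below `q` has a code. -/
theorem exists_code {q : ℕ} (hq : q ≤ n) (S : Finset ℕ) (hS : S ⊆ Finset.range q) :
    ∃ A < 2 ^ q, ∀ i < n, bit n A i = if i ∈ S then 1 else 0 := by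
  induction S using Finset.induction_on with
  | empty => exact ⟨0, Nat.two_pow_pos q, fun i _ => by simp [bit_zero_left]⟩
  | insert v S hv ih =>
    obtain ⟨A, hA, hb⟩ := ih ((Finset.subset_insert _ _).trans hS)
    have hvq : v < q := Finset.mem_range.1 (hS (Finset.mem_insert_self _ _))
    have h0 : bit n A v = 0 := by rw [hb v (by omega), if_neg hv]
    refine ⟨A + pw n 1 v, ?_, fun i hi => ?_⟩
    · have : bit q A v = 0 := by
        rw [bit_eq_zero hvq.le]; rwa [bit_eq_zero (by omega)] at h0
      have := add_pw_lt hA hvq this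
      rw [pw_eq hvq.le] at this
      rwa [pw_eq (show v ≤ n by omega)]
    · rw [bit_add_pw (by omega) h0 hi, hb i hi]
      rcases eq_or_ne i v with rfl | hiv
      · simp
      · simp [hiv]

end

/-! ### Counting the admissible codes in the window -/

theorem sum_shift {n q : ℕ} (hq : q ≤ n) (f : ℕ → ℕ) (hf : ∀ i < n - q, f i = 0) :
    ∑ i ∈ Finset.range n, f i = ∑ i ∈ Finset.range q, f (n - q + i) := by
  obtain ⟨d, rfl⟩ := Nat.exists_eq_add_of_le' hq
  rw [Nat.add_sub_cancel] at *
  rw [Finset.sum_range_add, Finset.sum_eq_zero fun i hi => hf i (Finset.mem_range.1 hi), zero_add]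

/-- Few sets of the last vertices are entered by few arcs if all large sets contain many arcs. -/
theorem card_cross_le {n q : ℕ} (hq : q ≤ n) (a : ℕ → ℕ → ℕ) (ha : ∀ i, a i i = 0) (m : ℕ)
    (hm : ∀ A < 2 ^ q, q ≤ 2 * pop n A → m ≤ arcs n a (up n q A)) :
    ((Finset.range (2 ^ q)).filter fun A => 8 * cross n q a (up n q A) < m).card * 7 ^ (q / 4) ≤
      6 ^ (q / 4) * 2 ^ q := by
  let S : ℕ → Finset ℕ := fun A => (Finset.range q).filter fun i => bit n A i = 1
  set B := (Finset.range (2 ^ q)).filter fun A => 8 * cross n q a (up n q A) < m with hB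
  have hinj : Set.InjOn S B := by
    intro A hA A' hA' h
    simp only [hB, Finset.coe_filter, Finset.mem_range, Set.mem_ofPred_eq] at hA hA'
    refine eq_of_bit_eq hA.1 hA'.1 fun i hi => ?_
    have h1 : i ∈ S A ↔ i ∈ S A' := by rw [h]
    simp only [S, Finset.mem_filter, Finset.mem_range, hi, true_and,
      bit_eq_one (show i ≤ n by omega)] at h1
    rw [bit_eq hi.le, bit_eq hi.le]
    cases hx : A.testBit i <;> cases hy : A'.testBit i <;> simp_all
  rw [← Finset.card_image_of_injOn hinj]
  -- With `s = q / 4`, at most `2 * (q / 4) ≤ q / 2` vertices are deleted, so the remaining sets are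
  -- large enough for `hm`.
  have := card_family_le (fun i j => a (n - q + i) (n - q + j)) (fun i => ha _) m (q / 4)
    (Finset.range q) (B.image S) ?_ ?_ ?_
  · simpa using this
  · intro A hA
    obtain ⟨A', -, rfl⟩ := Finset.mem_image.1 hA
    exact Finset.filter_subset _ _
  · intro A hA
    obtain ⟨A', hA', rfl⟩ := Finset.mem_image.1 hA
    convert (Finset.mem_filter.1 hA').2 using 2
    rw [cross, sum_shift hq]
    · refine Finset.sum_congr rfl fun i hi => ?_
      rw [sum_shift hq]
      · refine Finset.sum_congr rfl fun j hj => ?_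
        have hi := Finset.mem_range.1 hi
        have hj := Finset.mem_range.1 hj
        have e : ∀ i, ind (n - q) (n - q + i + 1) = 1 := fun i => if_pos (by omega)
        rw [bit_up_right hq hi, bit_up_right hq hj, e, e]
        have h1 := bit_le_one n A' i
        have h2 := bit_le_one n A' j
        simp only [S, Finset.mem_filter, Finset.mem_range, hi, hj, true_and]
        interval_cases bit n A' i <;> interval_cases bit n A' j <;> simp
      · intro j hj
        rw [ind, ind, if_neg (show ¬ n - q < j + 1 by omega)]
        simp
    · intro i hi
      refine Finset.sum_eq_zero fun j _ => ?_
      rw [ind, if_neg (by omega)]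
      simp
  · intro Y hY hc
    obtain ⟨A, hA, hb⟩ := exists_code hq Y hY
    have hpop : pop n A = Y.card := by
      rw [pop, Finset.sum_congr rfl fun i hi => hb i (Finset.mem_range.1 hi),
        Finset.sum_ite_mem, Finset.inter_eq_right.2 (hY.trans (Finset.range_subset_range.2 hq))]
      simp
    refine (hm A hA (by rw [Finset.card_range] at hc; omega)).trans (le_of_eq ?_)
    rw [arcs, sum_shift hq]
    · rw [← Finset.inter_eq_right.2 hY, ← Finset.sum_ite_mem]
      refine Finset.sum_congr rfl fun i hi => ?_
      have hi := Finset.mem_range.1 hi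
      rw [sum_shift hq]
      · rw [← Finset.sum_ite_mem]
        split_ifs with h
        · refine Finset.sum_congr rfl fun j hj => ?_
          have hj := Finset.mem_range.1 hj
          rw [bit_up_right hq hi, bit_up_right hq hj, hb i (by omega), hb j (by omega), if_pos h]
          split_ifs <;> simp
        · refine Finset.sum_eq_zero fun j hj => ?_
          rw [bit_up_right hq hi, hb i (by omega), if_neg h]
          simp
      · intro j hj
        rw [bit_up (i := j) (by omega), if_pos hj]
        simp
    · intro i hi
      refine Finset.sum_eq_zero fun j _ => ?_
      rw [bit_up (by omega), if_pos hi]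
      simp

/-! ### Orderings as paths through subsets -/

/-- The sort keys given in one step. -/
def stepKey (n : ℕ) (a : ℕ → ℕ → ℕ) (Z U p i : ℕ) : ℕ :=
  (if i = p then 2 * (n - pop n U) else 0) + newTrig n a Z U p i * (2 * (n - pop n U) + 1)

/-- The sets reached by adding vertices one by one, all the sets being admissible, with the total
cost and the sort keys. -/
inductive Path (n : ℕ) (a : ℕ → ℕ → ℕ) (Z : ℕ) (good : ℕ → Prop) : ℕ → ℕ → (ℕ → ℕ) → Prop
  | zero (h : good 0) : Path n a Z good 0 0 fun _ => 0
  | step {U c : ℕ} {κ : ℕ → ℕ} (hU : Path n a Z good U c κ) {p : ℕ} (hp : p < n)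
      (hb : bit n U p = 0) (h : good (U + pw n 1 p)) :
      Path n a Z good (U + pw n 1 p) (c + stepCost n a Z U p) fun i => κ i + stepKey n a Z U p i

/-- The code of all the sort keys. -/
def code (n r : ℕ) (κ : ℕ → ℕ) : ℕ :=
  ∑ i ∈ Finset.range n, κ i * pw n (2 * n + 1) (lab n r i)

theorem code_add_stepKey {n p : ℕ} (hp : p < n) (r : ℕ) (a : ℕ → ℕ → ℕ) (Z U : ℕ) (κ : ℕ → ℕ) :
    code n r (fun i => κ i + stepKey n a Z U p i) = code n r κ + stepCode n r a Z U p := by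
  simp only [code, stepKey, stepCode, add_mul, Finset.sum_add_distrib, ite_mul, zero_mul,
    Finset.sum_ite_eq', Finset.mem_range, hp, if_true]

/-- The cost occupies the digits above all sort keys. Since both parts are additive along a path,
the dynamic program can minimise a single number that also records the ordering. -/
theorem stepWeight_eq (n r : ℕ) (a : ℕ → ℕ → ℕ) (Z U p c : ℕ) {κ : ℕ → ℕ} (hp : p < n) :
    (c + stepCost n a Z U p) * pw n (2 * n + 1) n +
      code n r (fun i => κ i + stepKey n a Z U p i) =
    c * pw n (2 * n + 1) n + code n r κ + stepWeight n r a Z U p := by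
  rw [code_add_stepKey hp, stepWeight]
  ring

section

variable {n Z U c p : ℕ} {a : ℕ → ℕ → ℕ} {good : ℕ → Prop} {κ : ℕ → ℕ}

theorem trig_le_one (n : ℕ) (a : ℕ → ℕ → ℕ) (Z U x : ℕ) : trig n a Z U x ≤ 1 := ind_le_one _ _

theorem newTrig_cases (n : ℕ) (a : ℕ → ℕ → ℕ) (Z U p i : ℕ) :
    (newTrig n a Z U p i = 0 ∨ newTrig n a Z U p i = 1) ∧ (newTrig n a Z U p i = 1 ↔
      bit n Z i = 1 ∧ trig n a Z U i = 0 ∧ trig n a Z (U + pw n 1 p) i = 1) := by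
  have h1 := bit_le_one n Z i
  have h2 := trig_le_one n a Z U i
  have h3 := trig_le_one n a Z (U + pw n 1 p) i
  unfold newTrig
  interval_cases bit n Z i <;> interval_cases trig n a Z U i <;>
    interval_cases trig n a Z (U + pw n 1 p) i <;> simp

theorem pop_add (hp : p < n) (hb : bit n U p = 0) : pop n (U + pw n 1 p) = pop n U + 1 := by
  rw [pop, Finset.sum_congr rfl fun i hi => bit_add_pw hp hb (Finset.mem_range.1 hi),
    ← Finset.add_sum_erase _ _ (Finset.mem_range.2 hp), if_pos rfl, pop,
    ← Finset.add_sum_erase _ _ (Finset.mem_range.2 hp), hb, zero_add, add_comm]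
  congr 1
  exact Finset.sum_congr rfl fun i hi => if_neg (Finset.ne_of_mem_erase hi)

theorem pop_le (n U : ℕ) : pop n U ≤ n :=
  (Finset.sum_le_sum fun i _ => bit_le_one n U i).trans (by simp)

theorem bit_le_bit_add (hp : p < n) (hb : bit n U p = 0) {i : ℕ} (hi : i < n) :
    bit n U i ≤ bit n (U + pw n 1 p) i := by
  rw [bit_add_pw hp hb hi]
  split_ifs
  · exact bit_le_one _ _ _
  · exact le_rfl

theorem outTo_mono (hp : p < n) (hb : bit n U p = 0) (x : ℕ) :
    outTo n a U x ≤ outTo n a (U + pw n 1 p) x :=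
  Finset.sum_le_sum fun _ hi => Nat.mul_le_mul_right _ (bit_le_bit_add hp hb (Finset.mem_range.1 hi))

theorem inFrom_anti (hp : p < n) (hb : bit n U p = 0) (x : ℕ) :
    inFrom n a Z (U + pw n 1 p) x ≤ inFrom n a Z U x :=
  Finset.sum_le_sum fun _ hi => Nat.mul_le_mul_right _ (Nat.mul_le_mul_right _
    (Nat.sub_le_sub_left (bit_le_bit_add hp hb (Finset.mem_range.1 hi)) _))

/-- As `U` grows, arcs to `U` accumulate and arcs from outside disappear. A vertex of `Z` thus
crosses its threshold at most once. -/
theorem trig_mono (hp : p < n) (hb : bit n U p = 0) (x : ℕ) :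
    trig n a Z U x ≤ trig n a Z (U + pw n 1 p) x := by
  have h1 := outTo_mono (a := a) hp hb x
  have h2 := inFrom_anti (a := a) (Z := Z) hp hb x
  unfold trig ind
  split_ifs <;> omega

theorem Path.isGood (h : Path n a Z good U c κ) : good U := by
  cases h <;> assumption

theorem Path.lt (h : Path n a Z good U c κ) : U < 2 ^ n := by
  induction h with
  | zero => exact Nat.two_pow_pos n
  | step _ hp hb _ ih => exact add_pw_lt ih hp hb

theorem trig_zero (x : ℕ) : trig n a Z 0 x = 0 := by
  simp [trig, ind, outTo, bit_zero_left]

/-- The sort keys tell the order in which the vertices were placed. -/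
structure KeyInv (n : ℕ) (a : ℕ → ℕ → ℕ) (Z U : ℕ) (κ : ℕ → ℕ) : Prop where
  le : ∀ i < n, κ i ≤ 2 * n + 1
  mem : ∀ i < n, bit n U i = 1 → 2 * (n - pop n U) + 2 ≤ κ i
  trig : ∀ i < n, bit n Z i = 1 → trig n a Z U i = 1 → 2 * (n - pop n U) + 3 ≤ κ i
  zero : ∀ i < n, bit n U i = 0 → (bit n Z i = 1 → RAM.trig n a Z U i = 0) → κ i = 0

/-- The vertex added to `U` gets the even key `2 * (n - pop n U)`, and the vertices of `Z` placed
directly before it get the next odd number. These keys decrease along the path and are positive, and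
each vertex receives one at most once. Key `0` is thus left for vertices not yet placed. -/
theorem Path.keyInv (hgood : ∀ U, good U → ∀ i < n, bit n Z i = 1 → bit n U i = 0)
    (h : Path n a Z good U c κ) : KeyInv n a Z U κ := by
  induction h with
  | zero => exact ⟨by simp, by simp [bit_zero_left], by simp [trig_zero], by simp⟩
  | @step U c κ hU p hp hb hg ih =>
    have hpop := pop_add hp hb
    have hpn := pop_le n (U + pw n 1 p)
    have hnt := fun i (_ : i < n) => newTrig_cases n a Z U p i
    have hz := hgood _ hg
    have hzU := hgood _ hU.isGood
    -- Three cases for a vertex: it is the one being added, it crosses its threshold now, or its key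
    -- does not change. The first two exclude each other because admissible sets avoid `Z`.
    have hstep : ∀ i < n, ∀ (P : ℕ → Prop), (i = p → newTrig n a Z U p i = 0 → κ i = 0 →
        P (2 * (n - pop n U))) → (i ≠ p → newTrig n a Z U p i = 1 → κ i = 0 →
        P (2 * (n - pop n U) + 1)) → (i ≠ p → newTrig n a Z U p i = 0 → P (κ i)) →
        P (κ i + stepKey n a Z U p i) := by
      intro i hi P h1 h2 h3
      have hti := hnt i hi
      unfold stepKey
      rcases eq_or_ne i p with rfl | hip
      · have hzi : bit n Z i ≠ 1 := fun hzi => by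
          have := hz i hi hzi
          rw [bit_add_pw hp hb hi, if_pos rfl] at this
          omega
        have h0 : newTrig n a Z U i i = 0 := by
          rcases hti.1 with h | h
          · exact h
          · exact absurd (hti.2.1 h).1 hzi
        have hk := ih.zero i hi hb fun h => absurd h hzi
        simpa [h0, hk] using h1 rfl h0 hk
      · rcases hti.1 with h | h
        · simpa [h, hip] using h3 hip h
        · obtain ⟨hzi, ht0, -⟩ := hti.2.1 h
          have hk := ih.zero i hi (hzU i hi hzi) fun _ => ht0
          simpa [h, hip, hk] using h2 hip h hk
    refine ⟨fun i hi => hstep i hi (· ≤ _) ?_ ?_ ?_, fun i hi => hstep i hi (fun k => _ → _ ≤ k) ?_ ?_ ?_,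
      fun i hi => hstep i hi (fun k => _ → _ → _ ≤ k) ?_ ?_ ?_,
      fun i hi => hstep i hi (fun k => _ → _ → k = _) ?_ ?_ ?_⟩
    · intros; omega
    · intros; omega
    · intros; exact ih.le i hi
    · intros; omega
    · intro hip h1 _ h2
      have := hz i hi ((hnt i hi).2.1 h1).1
      omega
    · intro hip h0 h1
      rw [bit_add_pw hp hb hi, if_neg hip] at h1
      have := ih.mem i hi h1
      omega
    · intro hip _ _ h1
      have := hz i hi h1
      rw [bit_add_pw hp hb hi, if_pos hip] at this
      omega
    · intros; omega
    · intro hip h0 h1 h2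
      have h3 : RAM.trig n a Z U i = 1 := by
        have := trig_le_one n a Z U i
        by_contra h3
        have := (hnt i hi).2.2 ⟨h1, by omega, h2⟩
        omega
      have := ih.trig i hi h1 h3
      omega
    · intro hip _ _ h1
      rw [bit_add_pw hp hb hi, if_pos hip] at h1
      omega
    · intro _ h1 _ _ h2
      obtain ⟨h3, -, h4⟩ := (hnt i hi).2.1 h1
      have := h2 h3
      omega
    · intro hip h0 h1 h2
      rw [bit_add_pw hp hb hi, if_neg hip] at h1
      refine ih.zero i hi h1 fun h3 => ?_
      have := h2 h3
      have := trig_mono (a := a) (Z := Z) hp hb i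
      omega

/-- The arc `(i, j)` is known to be backward when the vertices of `U` have been placed. -/
def Bad (n : ℕ) (a : ℕ → ℕ → ℕ) (Z U : ℕ) (κ : ℕ → ℕ) (i j : ℕ) : Prop :=
  (κ i ≤ κ j ∧ ((bit n U i = 1 ∧ bit n U j = 1) ∨
    (bit n Z i = 1 ∧ trig n a Z U i = 1 ∧ bit n U j = 1) ∨
    (bit n Z j = 1 ∧ trig n a Z U j = 1 ∧ bit n U i = 1))) ∨
  (bit n Z j = 1 ∧ trig n a Z U j = 1 ∧ bit n U i = 0 ∧ bit n Z i = 0)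

/-- The three summands are the arcs from `p` to `U`, those from the newly inserted vertices of `Z`
to `U`, and those to these vertices from outside `U` and `Z`. -/
theorem stepCost_eq (hp : p < n) : stepCost n a Z U p = ∑ i ∈ Finset.range n, ∑ j ∈ Finset.range n,
    ((if i = p then bit n U j else 0) + newTrig n a Z U p i * bit n U j +
      newTrig n a Z U p j * ((1 - bit n U i) * (1 - bit n Z i))) * a i j := by
  simp only [add_mul, Finset.sum_add_distrib, stepCost, mul_add, add_assoc]
  congr 1
  · simp only [ite_mul, zero_mul]
    rw [Finset.sum_comm]
    simp [Finset.sum_ite_eq', hp, outTo]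
  congr 1
  · simp only [outTo, Finset.mul_sum, mul_assoc]
  · rw [Finset.sum_comm]
    simp only [inFrom, Finset.mul_sum, mul_assoc]

-- Each arc is charged at the step that decides it. The last alternative of `Bad` decides arcs to an
-- inserted vertex of `Z` in advance: their tails outside `Z` can only be placed later.
open Classical in
theorem Path.bad_le (ha : ∀ i, a i i = 0)
    (hgood : ∀ U, good U → ∀ i < n, bit n Z i = 1 → bit n U i = 0)
    (h : Path n a Z good U c κ) : ∑ i ∈ Finset.range n, ∑ j ∈ Finset.range n,
      (if Bad n a Z U κ i j then a i j else 0) ≤ c := by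
  induction h with
  | zero => simp [Bad, bit_zero_left, trig_zero]
  | @step U c κ hU p hp hb hg ih =>
    have hk := hU.keyInv hgood
    have hk' := (hU.step hp hb hg).keyInv hgood
    refine le_trans ?_ (Nat.add_le_add_right ih _)
    rw [stepCost_eq hp, ← Finset.sum_add_distrib]
    refine Finset.sum_le_sum fun i hi => ?_
    rw [← Finset.sum_add_distrib]
    refine Finset.sum_le_sum fun j hj => ?_
    have hi := Finset.mem_range.1 hi
    have hj := Finset.mem_range.1 hj
    rcases eq_or_ne i j with rfl | hij
    · simp [ha]
    by_cases h1 : Bad n a Z (U + pw n 1 p) (fun i => κ i + stepKey n a Z U p i) i j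
    swap
    · simp [h1]
    by_cases h2 : Bad n a Z U κ i j
    · simp [h1, h2]
    rw [if_pos h1, if_neg h2, zero_add]
    refine Nat.le_mul_of_pos_left _ ?_
    suffices h : (i = p ∧ bit n U j = 1) ∨ (newTrig n a Z U p i = 1 ∧ bit n U j = 1) ∨
        (newTrig n a Z U p j = 1 ∧ bit n U i = 0 ∧ bit n Z i = 0) by
      rcases h with ⟨rfl, h⟩ | ⟨h, h'⟩ | ⟨h, h', h''⟩
      · rw [if_pos rfl, h]; omega
      · rw [h, h']; omega
      · rw [h, h', h'']; omega
    have hpop := pop_add hp hb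
    have hpn := pop_le n (U + pw n 1 p)
    have hzp : bit n Z p = 0 := by
      have h3 := hgood _ hg p hp
      rw [bit_add_pw hp hb hp, if_pos rfl] at h3
      have := bit_le_one n Z p
      omega
    have hnt := newTrig_cases n a Z U p
    have hsame : ∀ i, i ≠ p → (bit n Z i = 0 ∨ trig n a Z U i = 1) →
        κ i + stepKey n a Z U p i = κ i := fun i hip hi => by
      have : newTrig n a Z U p i = 0 := by
        rcases (hnt i).1 with h | h
        · exact h
        · have := (hnt i).2.1 h
          omega
      simp [stepKey, hip, this]
    have hκp : κ p + stepKey n a Z U p p = 2 * (n - pop n U) := by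
      have : newTrig n a Z U p p = 0 := by
        rcases (hnt p).1 with h | h
        · exact h
        · have := (hnt p).2.1 h
          omega
      simp [stepKey, this, hk.zero p hp hb (by omega)]
    have hzU := hgood _ hU.isGood
    have hz1 := fun i => bit_le_one n Z i
    have ht1 := fun i => trig_le_one n a Z U i
    rcases h1 with ⟨hle, h1 | h1 | h1⟩ | h1
    · rcases eq_or_ne i p with rfl | hip
      · rw [bit_add_pw hp hb hj, if_neg hij.symm] at h1
        exact .inl ⟨rfl, h1.2⟩
      rw [bit_add_pw hp hb hi, if_neg hip] at h1
      have hzi : bit n Z i = 0 := by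
        have := hzU i hi
        have := hz1 i
        omega
      beta_reduce at hle
      rw [hsame i hip (.inl hzi)] at hle
      rcases eq_or_ne j p with rfl | hjp
      -- An arc from `U` to the new vertex is forward, since the new vertex has a smaller key than
      -- all of `U`.
      · rw [hκp] at hle
        have := hk.mem i hi h1.1
        omega
      rw [bit_add_pw hp hb hj, if_neg hjp] at h1
      have hzj : bit n Z j = 0 := by
        have := hzU j hj
        have := hz1 j
        omega
      rw [hsame j hjp (.inl hzj)] at hle
      exact absurd (.inl ⟨hle, .inl h1⟩) h2
    · obtain ⟨hzi, hti, huj⟩ := h1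
      have hip : i ≠ p := by rintro rfl; omega
      rcases eq_or_ne j p with rfl | hjp
      -- A vertex of `Z` that has crossed its threshold by now precedes the new vertex, so its arc
      -- to the new vertex is forward.
      · have := hk'.trig i hi hzi hti
        beta_reduce at hle this
        omega
      rw [bit_add_pw hp hb hj, if_neg hjp] at huj
      by_cases ht : trig n a Z U i = 1
      · have hzj : bit n Z j = 0 := by
          have := hzU j hj
          have := hz1 j
          omega
        beta_reduce at hle
        rw [hsame i hip (.inr ht), hsame j hjp (.inl hzj)] at hle
        exact absurd (.inl ⟨hle, .inr (.inl ⟨hzi, ht, huj⟩)⟩) h2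
      · exact .inr (.inl ⟨(hnt i).2.2 ⟨hzi, by have := ht1 i; omega, hti⟩, huj⟩)
    · obtain ⟨hzj, htj, hui⟩ := h1
      have hjp : j ≠ p := by rintro rfl; omega
      by_cases ht : trig n a Z U j = 1
      · refine absurd ?_ h2
        -- An arc from `p` to a vertex inserted earlier was already charged at that insertion,
        -- through the last alternative of `Bad`.
        rcases eq_or_ne i p with rfl | hip
        · exact .inr ⟨hzj, ht, hb, hzp⟩
        rw [bit_add_pw hp hb hi, if_neg hip] at hui
        have hzi : bit n Z i = 0 := by
          have := hzU i hi
          have := hz1 i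
          omega
        beta_reduce at hle
        rw [hsame j hjp (.inr ht), hsame i hip (.inl hzi)] at hle
        exact .inl ⟨hle, .inr (.inr ⟨hzj, ht, hui⟩)⟩
      have hntj := (hnt j).2.2 ⟨hzj, by have := ht1 j; omega, htj⟩
      rcases eq_or_ne i p with rfl | hip
      · exact .inr (.inr ⟨hntj, hb, hzp⟩)
      rw [bit_add_pw hp hb hi, if_neg hip] at hui
      have hzi : bit n Z i = 0 := by
        have := hzU i hi
        have := hz1 i
        omega
      have h3 := hk.mem i hi hui
      have h4 := hk.zero j hj (hzU j hj hzj) fun _ => ((hnt j).2.1 hntj).2.1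
      beta_reduce at hle
      rw [hsame i hip (.inl hzi), h4, stepKey, if_neg hjp, hntj] at hle
      omega
    · obtain ⟨hzj, htj, hui, hzi⟩ := h1
      have hip : i ≠ p := by
        rintro rfl
        rw [bit_add_pw hp hb hi, if_pos rfl] at hui
        omega
      rw [bit_add_pw hp hb hi, if_neg hip] at hui
      by_cases ht : trig n a Z U j = 1
      · exact absurd (.inr ⟨hzj, ht, hui, hzi⟩) h2
      · exact .inr (.inr ⟨(hnt j).2.2 ⟨hzj, by have := ht1 j; omega, htj⟩, hui, hzi⟩)

open Classical in
/-- The order of decreasing sort keys has at most as many backward arcs as computed. -/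
theorem Path.sum_le (ha : ∀ i, a i i = 0)
    (hgood : ∀ U, good U → ∀ i < n, bit n Z i = 1 → bit n U i = 0)
    (h : Path n a Z good U c κ) (hfull : ∀ i < n, bit n Z i = 0 → bit n U i = 1) :
    ∑ i ∈ Finset.range n, ∑ j ∈ Finset.range n, (if κ i ≤ κ j then a i j else 0) ≤
      c + arcs n a Z := by
  have hk := h.keyInv hgood
  refine le_trans ?_ (Nat.add_le_add_right (h.bad_le ha hgood) _)
  rw [arcs, ← Finset.sum_add_distrib]
  refine Finset.sum_le_sum fun i hi => ?_
  rw [← Finset.sum_add_distrib]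
  refine Finset.sum_le_sum fun j hj => ?_
  have hi := Finset.mem_range.1 hi
  have hj := Finset.mem_range.1 hj
  split_ifs with h1 h2
  · omega
  rotate_left
  · exact Nat.zero_le _
  · exact Nat.zero_le _
  rw [zero_add]
  have hz1 := fun i => bit_le_one n Z i
  have ht1 := fun i => trig_le_one n a Z U i
  have hzU := hgood _ h.isGood
  by_cases hzi : bit n Z i = 1
  · by_cases hzj : bit n Z j = 1
    · simp [hzi, hzj]
    have huj := hfull j hj (by have := hz1 j; omega)
    by_cases ht : trig n a Z U i = 1
    · exact absurd (.inl ⟨h1, .inr (.inl ⟨hzi, ht, huj⟩)⟩) h2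
    -- Nothing remains outside `U` and `Z`, so a vertex below its threshold has no arcs to `U`
    -- either, and placing it at the end is free.
    have h3 : inFrom n a Z U i = 0 := Finset.sum_eq_zero fun l hl => by
      have hl := Finset.mem_range.1 hl
      rcases (Nat.le_one_iff_eq_zero_or_eq_one.1 (hz1 l)) with h | h
      · simp [hfull l hl h]
      · simp [h]
    have h4 : outTo n a U i = 0 := by
      rw [trig, ind, h3] at ht
      split_ifs at ht with h5
      · exact absurd rfl ht
      · omega
    have h5 := Finset.sum_eq_zero_iff.1 h4 j (Finset.mem_range.2 hj)
    rw [huj, one_mul] at h5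
    omega
  · have hui := hfull i hi (by have := hz1 i; omega)
    by_cases hzj : bit n Z j = 1
    · by_cases ht : trig n a Z U j = 1
      · exact absurd (.inl ⟨h1, .inr (.inr ⟨hzj, ht, hui⟩)⟩) h2
      -- A vertex of `Z` that never crossed its threshold has key `0` and follows all of `U`, so the
      -- arc is forward.
      · have h3 := hk.mem i hi hui
        have h4 := hk.zero j hj (hzU j hj hzj) fun _ => by have := ht1 j; omega
        omega
    · have huj := hfull j hj (by have := hz1 j; omega)
      exact absurd (.inl ⟨h1, .inl ⟨hui, huj⟩⟩) h2

/-! ### Comparison of paths with a given ordering -/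

/-- The number of backward arcs between `x` and the vertices outside `Z`. -/
def backDeg (n : ℕ) (a : ℕ → ℕ → ℕ) (Z : ℕ) (π : ℕ → ℕ) (x : ℕ) : ℕ :=
  ∑ i ∈ Finset.range n, (1 - bit n Z i) * (ind (π i) (π x) * a x i + ind (π x) (π i) * a i x)

/-- Placing a vertex of `Z` according to the threshold is optimal up to a factor of two. -/
theorem outTo_add_inFrom_le {π : ℕ → ℕ} (hπ : ∀ i < n, ∀ j < n, π i = π j → i = j)
    (ha1 : ∀ i j, a i j ≤ 1) (hp : p < n) (hzp : bit n Z p = 0)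
    (hU : ∀ i < n, bit n U i = 1 ↔ bit n Z i = 0 ∧ π i < π p) {x : ℕ} (hx : x < n)
    (h : newTrig n a Z U p x = 1) : outTo n a U x + inFrom n a Z U x ≤ 2 * backDeg n a Z π x := by
  obtain ⟨hz, ht, ht'⟩ := (newTrig_cases n a Z U p x).2.1 h
  have hb : bit n U p = 0 := by
    have := hU p hp
    have := bit_le_one n U p
    omega
  have h1 : outTo n a U x ≤ inFrom n a Z U x := by
    unfold trig ind at ht
    split_ifs at ht with h'
    omega
  have h2 : inFrom n a Z (U + pw n 1 p) x < outTo n a (U + pw n 1 p) x := by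
    unfold trig ind at ht'
    split_ifs at ht' with h'
    exact h'
  -- Before the threshold is crossed, `outTo` is at most `inFrom`, so the sum is at most twice
  -- `inFrom`.
  suffices inFrom n a Z U x ≤ backDeg n a Z π x by omega
  have hxp : π x ≠ π p := fun h => by
    have := hπ x hx p hp h
    subst this
    omega
  -- If `x` precedes `p` in `π`, then it precedes all vertices outside `U` and `Z`, and every arc
  -- counted by `inFrom` is backward. Otherwise the arcs from `x` to `U` and to `p` are backward;
  -- they outnumber `inFrom` after the addition of `p`, which differs from `inFrom` before it by at
  -- most one.
  rcases lt_or_gt_of_ne hxp with hlt | hlt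
  · refine Finset.sum_le_sum fun i hi => ?_
    have hi := Finset.mem_range.1 hi
    have h3 := hU i hi
    have h4 := bit_le_one n U i
    have h5 := bit_le_one n Z i
    rw [mul_add]
    refine le_trans ?_ (Nat.le_add_left _ _)
    rw [← mul_assoc]
    refine Nat.mul_le_mul_right _ ?_
    rcases Nat.le_one_iff_eq_zero_or_eq_one.1 h5 with h5 | h5
    · rcases Nat.le_one_iff_eq_zero_or_eq_one.1 h4 with h4 | h4
      · rw [h4, h5, ind, if_pos (by omega)]
      · simp [h4]
    · simp [h5]
  · have h3 : outTo n a (U + pw n 1 p) x ≤ backDeg n a Z π x := by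
      refine Finset.sum_le_sum fun i hi => ?_
      have hi := Finset.mem_range.1 hi
      rw [mul_add]
      refine le_trans ?_ (Nat.le_add_right _ _)
      rw [← mul_assoc]
      refine Nat.mul_le_mul_right _ ?_
      rw [bit_add_pw hp hb hi]
      split_ifs with hip
      · subst hip
        simp [hzp, ind, hlt]
      · rcases Nat.le_one_iff_eq_zero_or_eq_one.1 (bit_le_one n U i) with h4 | h4
        · simp [h4]
        · have h5 := (hU i hi).1 h4
          simp [h4, h5.1, ind, h5.2.trans hlt]
    have h4 : inFrom n a Z U x ≤ inFrom n a Z (U + pw n 1 p) x + 1 := by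
      have : ∑ i ∈ Finset.range n, (if i = p then 1 else 0) = 1 := by simp [hp]
      refine le_of_le_of_eq ?_ (congrArg _ this)
      rw [inFrom, inFrom, ← Finset.sum_add_distrib]
      refine Finset.sum_le_sum fun i hi => ?_
      rw [bit_add_pw hp hb (Finset.mem_range.1 hi)]
      split_ifs with hip
      · subst hip
        rw [hb, hzp]
        simpa using ha1 i x
      · exact le_rfl
    omega

/-- The cost along an ordering `π`. -/
theorem exists_path {π : ℕ → ℕ} (hπ : ∀ i < n, ∀ j < n, π i = π j → i = j)
    (hπn : ∀ i < n, π i < n) (ha1 : ∀ i j, a i j ≤ 1)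
    (hgood : ∀ U, (∀ i < n, bit n U i = 1 → bit n Z i = 0) →
      (∀ i < n, ∀ j < n, bit n U i = 1 → bit n Z j = 0 → π j < π i → bit n U j = 1) → good U) :
    ∃ U c κ, Path n a Z good U c κ ∧ (∀ i < n, bit n U i = 1 ↔ bit n Z i = 0) ∧
      c ≤ ∑ i ∈ Finset.range n, ∑ j ∈ Finset.range n,
          (1 - bit n Z i) * (1 - bit n Z j) * (ind (π j) (π i) * a i j) +
        ∑ x ∈ Finset.range n, bit n Z x * (2 * backDeg n a Z π x) := by
  have hz1 := fun i => bit_le_one n Z i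
  -- The set after time `s` consists of the vertices outside `Z` at positions below `s`. The second
  -- sum collects only the vertices of `Z` that have crossed their thresholds.
  have key : ∀ s, ∃ U c κ, Path n a Z good U c κ ∧
      (∀ i < n, bit n U i = 1 ↔ bit n Z i = 0 ∧ π i < s) ∧
      c ≤ ∑ i ∈ Finset.range n, ∑ j ∈ Finset.range n,
          bit n U i * bit n U j * (ind (π j) (π i) * a i j) +
        ∑ x ∈ Finset.range n, bit n Z x * trig n a Z U x * (2 * backDeg n a Z π x) := by
    intro s
    induction s with
    | zero =>
      exact ⟨0, 0, _, .zero (hgood 0 (by simp [bit_zero_left]) (by simp [bit_zero_left])),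
        by simp [bit_zero_left], Nat.zero_le _⟩
    | succ s ih =>
      obtain ⟨U, c, κ, hP, hU, hc⟩ := ih
      by_cases hs : ∃ p < n, bit n Z p = 0 ∧ π p = s
      · obtain ⟨p, hp, hzp, rfl⟩ := hs
        have hb : bit n U p = 0 := by
          have := hU p hp
          have := bit_le_one n U p
          omega
        have hU' : ∀ i < n, bit n (U + pw n 1 p) i = 1 ↔ bit n Z i = 0 ∧ π i < π p + 1 := by
          intro i hi
          rw [bit_add_pw hp hb hi]
          split_ifs with hip
          · subst hip
            simp [hzp]
          · rw [hU i hi]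
            have : π i ≠ π p := fun h => hip (hπ i hi p hp h)
            omega
        refine ⟨_, _, _, hP.step hp hb (hgood _ (fun i hi h => ((hU' i hi).1 h).1)
          fun i hi j hj h h' h'' => (hU' j hj).2 ⟨h', ?_⟩), hU', ?_⟩
        · have := ((hU' i hi).1 h).2
          omega
        · refine (Nat.add_le_add_right hc _).trans ?_
          have h1 : ∑ i ∈ Finset.range n, ∑ j ∈ Finset.range n,
              bit n U i * bit n U j * (ind (π j) (π i) * a i j) + outTo n a U p ≤
              ∑ i ∈ Finset.range n, ∑ j ∈ Finset.range n, bit n (U + pw n 1 p) i *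
                bit n (U + pw n 1 p) j * (ind (π j) (π i) * a i j) := by
            have : outTo n a U p = ∑ i ∈ Finset.range n, ∑ j ∈ Finset.range n,
                (if i = p then bit n U j * a i j else 0) := by
              rw [Finset.sum_comm]
              simp [Finset.sum_ite_eq', hp, outTo]
            rw [this, ← Finset.sum_add_distrib]
            refine Finset.sum_le_sum fun i hi => ?_
            rw [← Finset.sum_add_distrib]
            refine Finset.sum_le_sum fun j hj => ?_
            have hi := Finset.mem_range.1 hi
            have hj := Finset.mem_range.1 hj
            split_ifs with hip
            · subst hip
              rw [hb, bit_add_pw hp hb hi, if_pos rfl]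
              rcases Nat.le_one_iff_eq_zero_or_eq_one.1 (bit_le_one n U j) with h4 | h4
              · simp [h4]
              · have h5 := (hU j hj).1 h4
                have h6 := bit_le_bit_add hp hb hj
                have h7 := bit_le_one n (U + pw n 1 i) j
                rw [ind, if_pos h5.2, show bit n (U + pw n 1 i) j = 1 by omega, h4]
                simp
            · rw [add_zero]
              exact Nat.mul_le_mul_right _ (Nat.mul_le_mul (bit_le_bit_add hp hb hi)
                (bit_le_bit_add hp hb hj))
          have h2 : ∑ x ∈ Finset.range n, bit n Z x * trig n a Z U x * (2 * backDeg n a Z π x) +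
              ∑ x ∈ Finset.range n, newTrig n a Z U p x *
                (outTo n a U x + inFrom n a Z U x) ≤
              ∑ x ∈ Finset.range n, bit n Z x * trig n a Z (U + pw n 1 p) x *
                (2 * backDeg n a Z π x) := by
            rw [← Finset.sum_add_distrib]
            refine Finset.sum_le_sum fun x hx => ?_
            have hx := Finset.mem_range.1 hx
            have h3 := trig_mono (a := a) (Z := Z) hp hb x
            rcases (newTrig_cases n a Z U p x).1 with h4 | h4
            · rw [h4, zero_mul, add_zero]
              exact Nat.mul_le_mul_right _ (Nat.mul_le_mul_left _ h3)
            · have h5 := outTo_add_inFrom_le hπ ha1 hp hzp hU hx h4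
              obtain ⟨h6, h7, h8⟩ := (newTrig_cases n a Z U p x).2.1 h4
              rw [h4, h6, h7, h8]
              omega
          rw [stepCost]
          omega
      · refine ⟨U, c, κ, hP, fun i hi => ?_, hc⟩
        rw [hU i hi]
        have : bit n Z i = 0 → π i ≠ s := fun h h' => hs ⟨i, hi, h, h'⟩
        omega
  obtain ⟨U, c, κ, hP, hU, hc⟩ := key n
  have hU' : ∀ i < n, bit n U i = 1 ↔ bit n Z i = 0 := fun i hi => by
    rw [hU i hi]
    have := hπn i hi
    omega
  refine ⟨U, c, κ, hP, hU', hc.trans (add_le_add ?_ ?_)⟩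
  · refine Finset.sum_le_sum fun i hi => Finset.sum_le_sum fun j hj => ?_
    have hbz : ∀ i < n, bit n U i ≤ 1 - bit n Z i := fun i hi => by
      have := hU' i hi
      have := bit_le_one n U i
      have := hz1 i
      omega
    exact Nat.mul_le_mul_right _ (Nat.mul_le_mul (hbz i (Finset.mem_range.1 hi))
      (hbz j (Finset.mem_range.1 hj)))
  · refine Finset.sum_le_sum fun x _ => Nat.mul_le_mul_right _ ?_
    calc _ ≤ bit n Z x * 1 := Nat.mul_le_mul_left _ (trig_le_one _ _ _ _ _)
      _ = _ := mul_one _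

end

/-! ### Coding the sort keys -/

theorem sum_digits_lt {M : ℕ} {d : ℕ → ℕ} (hd : ∀ v, d v < M) (N : ℕ) :
    ∑ v ∈ Finset.range N, d v * M ^ v < M ^ N := by
  induction N with
  | zero => simp
  | succ N ih =>
    rw [Finset.sum_range_succ]
    calc _ < M ^ N + d N * M ^ N := by omega
      _ = (d N + 1) * M ^ N := by ring
      _ ≤ M * M ^ N := Nat.mul_le_mul_right _ (hd N)
      _ = M ^ (N + 1) := by ring

theorem digit_eq {M : ℕ} {d : ℕ → ℕ} (hd : ∀ v, d v < M) {N v : ℕ} (hv : v < N) (c : ℕ) :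
    (c * M ^ N + ∑ v ∈ Finset.range N, d v * M ^ v) / M ^ v % M = d v := by
  have hM : 0 < M := (Nat.zero_le _).trans_lt (hd 0)
  induction N generalizing c with
  | zero => omega
  | succ N ih =>
    have h : c * M ^ (N + 1) + ∑ v ∈ Finset.range (N + 1), d v * M ^ v =
        (c * M + d N) * M ^ N + ∑ v ∈ Finset.range N, d v * M ^ v := by
      rw [Finset.sum_range_succ]
      ring
    rw [h]
    rcases Nat.lt_succ_iff_lt_or_eq.1 hv with hv | rfl
    · exact ih hv _
    · rw [add_comm, Nat.add_mul_div_right _ _ (by positivity),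
        Nat.div_eq_of_lt (sum_digits_lt hd v), zero_add, mul_comm, Nat.mul_add_mod,
        Nat.mod_eq_of_lt (hd v)]

section

variable {n r : ℕ} {κ : ℕ → ℕ}

/-- The label of a vertex. -/
def unlab (n r v : ℕ) : ℕ := lab n (n - r) v

theorem lab_lt (hn : 0 < n) (r i : ℕ) : lab n r i < n := Nat.mod_lt _ hn

theorem lab_unlab (hr : r ≤ n) {v : ℕ} (hv : v < n) : lab n r (unlab n r v) = v := by
  rw [unlab, lab, lab, Nat.mod_add_mod, show v + (n - r) + r = v + n by omega, Nat.add_mod_right,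
    Nat.mod_eq_of_lt hv]

theorem unlab_lab (hr : r ≤ n) {i : ℕ} (hi : i < n) : unlab n r (lab n r i) = i := by
  rw [unlab, lab, lab, Nat.mod_add_mod, show i + r + (n - r) = i + n by omega, Nat.add_mod_right,
    Nat.mod_eq_of_lt hi]

theorem sum_lab (hr : r ≤ n) (f : ℕ → ℕ) :
    ∑ i ∈ Finset.range n, f (lab n r i) = ∑ v ∈ Finset.range n, f v := by
  rcases n.eq_zero_or_pos with rfl | hn
  · rfl
  · exact Finset.sum_nbij' (lab n r) (unlab n r) (by simp [lab_lt hn]) (by simp [unlab, lab_lt hn])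
      (fun i hi => unlab_lab hr (Finset.mem_range.1 hi))
      (fun v hv => lab_unlab hr (Finset.mem_range.1 hv)) fun _ _ => rfl

theorem code_eq (hr : r ≤ n) (hκ : ∀ i < n, κ i ≤ 2 * n + 1) : ∃ d : ℕ → ℕ,
    (∀ v, d v < 2 * n + 2) ∧ (∀ i < n, d (lab n r i) = κ i) ∧
      code n r κ = ∑ v ∈ Finset.range n, d v * (2 * n + 2) ^ v := by
  refine ⟨fun v => if unlab n r v < n then κ (unlab n r v) else 0, fun v => ?_, fun i hi => ?_, ?_⟩
  · dsimp only
    split_ifs with h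
    · exact Nat.lt_succ_of_le (hκ _ h)
    · omega
  · simp only [unlab_lab hr hi, hi, if_true]
  · rw [← sum_lab hr]
    refine Finset.sum_congr rfl fun i hi => ?_
    have hi := Finset.mem_range.1 hi
    beta_reduce
    rw [unlab_lab hr hi, if_pos hi, pw_eq (lab_lt (by omega) r i).le]

theorem code_lt (hr : r ≤ n) (hκ : ∀ i < n, κ i ≤ 2 * n + 1) :
    code n r κ < (2 * n + 2) ^ n := by
  obtain ⟨d, hd, -, h⟩ := code_eq hr hκ
  exact h ▸ sum_digits_lt hd n

/-- Digits are indexed by vertices, not by labels, so `key` can read them without knowing which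
rotation produced the best value. -/
theorem decode (hr : r ≤ n) (hκ : ∀ i < n, κ i ≤ 2 * n + 1) (c : ℕ) {i : ℕ} (hi : i < n) :
    (c * (2 * n + 2) ^ n + code n r κ) / (2 * n + 2) ^ (lab n r i) % (2 * n + 2) = κ i := by
  obtain ⟨d, hd, hd', h⟩ := code_eq hr hκ
  rw [h, digit_eq hd (lab_lt (by omega) r i), hd' i hi]

end

/-! ### What the algorithm computes -/

/-- `x` is the maximum of `I - t` (truncated) over all `t` in `S`. -/
def IsBest (S : ℕ → Prop) (I x : ℕ) : Prop := (∀ t, S t → I - t ≤ x) ∧ (x = 0 ∨ ∃ t, S t ∧ x = I - t)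

theorem IsBest.max {S S' : ℕ → Prop} {I x y : ℕ} (h : IsBest S I x) (h' : IsBest S' I y) :
    IsBest (fun t => S t ∨ S' t) I (max x y) := by
  refine ⟨fun t ht => ?_, ?_⟩
  · rcases ht with ht | ht
    · exact (h.1 t ht).trans (le_max_left _ _)
    · exact (h'.1 t ht).trans (le_max_right _ _)
  · rcases max_choice x y with e | e <;> rw [e]
    · exact h.2.imp id fun ⟨t, ht, hx⟩ => ⟨t, .inl ht, hx⟩
    · exact h'.2.imp id fun ⟨t, ht, hx⟩ => ⟨t, .inr ht, hx⟩

/-- An untouched cell holds `0`, which is correct for a set that no path reaches. -/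
theorem isBest_zero {S : ℕ → Prop} {I : ℕ} (h : ∀ t, ¬ S t) : IsBest S I 0 :=
  ⟨fun t ht => absurd ht (h t), .inl rfl⟩

theorem IsBest.congr {S S' : ℕ → Prop} {I x : ℕ} (h : IsBest S I x) (hS : ∀ t, S' t ↔ S t) :
    IsBest S' I x := by
  rwa [show S' = S from funext fun t => propext (hS t)]

/-- Admissible sets. -/
def Good (n q r mode : ℕ) (m : ℕ → ℕ) (Y : ℕ) : Prop := defect n q r mode m Y = 0

instance (n q r mode : ℕ) (m : ℕ → ℕ) : DecidablePred (Good n q r mode m) :=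
  fun _ => instDecidableEqNat _ _

/-- The total weights of the paths to `U`. -/
def Total (n q r mode : ℕ) (m : ℕ → ℕ) (U t : ℕ) : Prop :=
  ∃ c κ, Path n (adj n r m) (zset n q r mode m) (Good n q r mode m) U c κ ∧
    t = c * pw n (2 * n + 1) n + code n r κ

section

variable {n q r mode U : ℕ} {m : ℕ → ℕ}

theorem Path.cases_on {a : ℕ → ℕ → ℕ} {Z c : ℕ} {good : ℕ → Prop} {κ : ℕ → ℕ}
    (h : Path n a Z good U c κ) : (U = 0 ∧ c = 0 ∧ κ = fun _ => 0) ∨ ∃ U' c' κ' p,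
      Path n a Z good U' c' κ' ∧ p < n ∧ bit n U' p = 0 ∧ U = U' + pw n 1 p ∧
        c = c' + stepCost n a Z U' p ∧ κ = fun i => κ' i + stepKey n a Z U' p i := by
  cases h with
  | zero => exact .inl ⟨rfl, rfl, rfl⟩
  | step hU hp hb _ => exact .inr ⟨_, _, _, _, hU, hp, hb, rfl, rfl, rfl⟩

/-- This is the recursion over the last vertex added. Truncated subtraction keeps the value `0` of
unreachable predecessors at `0`, so they never win. -/
theorem tableVal_isBest (hg : Good n q r mode m U)
    (h : ∀ v < n, bit n U v = 1 → IsBest (Total n q r mode m (U - pw n 1 v))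
      (initVal n q r mode m) (m (tableCell n r mode (U - pw n 1 v)))) :
    IsBest (Total n q r mode m U) (initVal n q r mode m) (tableVal n q r mode m U) := by
  rcases eq_or_ne U 0 with rfl | hU
  · have hv : tableVal n q r mode m 0 = initVal n q r mode m := by simp [tableVal, bit_zero_left]
    rw [hv]
    exact ⟨fun t _ => Nat.sub_le _ _, .inr ⟨0, ⟨0, _, .zero hg, by simp [code]⟩, rfl⟩⟩
  have hv : tableVal n q r mode m U = (Finset.range n).sup fun v => bit n U v *
    (m (tableCell n r mode (U - pw n 1 v)) -
      stepWeight n r (adj n r m) (zset n q r mode m) (U - pw n 1 v) v) := by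
    rw [tableVal, show 1 - U = 0 by omega, zero_mul, Nat.zero_max]
  rw [hv]
  constructor
  · rintro t ⟨c, κ, hP, rfl⟩
    rcases hP.cases_on with ⟨h0, -⟩ | ⟨U', c', κ', p, hP', hp, hb, rfl, rfl, rfl⟩
    · exact absurd h0 hU
    have hb1 : bit n (U' + pw n 1 p) p = 1 := by rw [bit_add_pw hp hb hp, if_pos rfl]
    have h1 := h p hp hb1
    have hle := Finset.le_sup (f := fun v => bit n (U' + pw n 1 p) v *
      (m (tableCell n r mode (U' + pw n 1 p - pw n 1 v)) - stepWeight n r (adj n r m)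
        (zset n q r mode m) (U' + pw n 1 p - pw n 1 v) v)) (Finset.mem_range.2 hp)
    refine le_trans ?_ hle
    rw [Nat.add_sub_cancel] at h1
    rw [hb1, one_mul, Nat.add_sub_cancel, stepWeight_eq _ _ _ _ _ _ _ hp, ← Nat.sub_sub]
    exact Nat.sub_le_sub_right (h1.1 _ ⟨c', κ', hP', rfl⟩) _
  · rcases (Finset.range n).eq_empty_or_nonempty with he | hne
    · left; simp [he]
    obtain ⟨v, hv, he⟩ := Finset.exists_mem_eq_sup _ hne fun v => bit n U v *
      (m (tableCell n r mode (U - pw n 1 v)) -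
        stepWeight n r (adj n r m) (zset n q r mode m) (U - pw n 1 v) v)
    have hv := Finset.mem_range.1 hv
    rw [he]
    rcases Nat.le_one_iff_eq_zero_or_eq_one.1 (bit_le_one n U v) with hb | hb
    · left; simp [hb]
    rcases (h v hv hb).2 with h0 | ⟨t, ⟨c, κ, hP, rfl⟩, ht⟩
    · left; simp [h0]
    · right
      have hP' := hP.step hv (bit_sub_pw_self hv hb)
        (by rwa [Nat.sub_add_cancel (pw_le_of_bit hv hb)])
      rw [Nat.sub_add_cancel (pw_le_of_bit hv hb)] at hP'
      exact ⟨_, ⟨_, _, hP', rfl⟩, by rw [stepWeight_eq _ _ _ _ _ _ _ hv, hb, one_mul, ht,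
        Nat.sub_sub]⟩

/-- `m'` holds the same input and the same sparse set as `m`. -/
structure SameData (n r : ℕ) (m m' : ℕ → ℕ) : Prop where
  lt : ∀ a < n * n, m' a = m a
  cell : m' (searchCell n r) = m (searchCell n r)

theorem adj_congr {m' : ℕ → ℕ} (hn : 0 < n) (h : ∀ a < n * n, m' a = m a) :
    adj n r m' = adj n r m := by
  funext i j
  refine h _ ?_
  have h1 := lab_lt hn r i
  have h2 := lab_lt hn r j
  nlinarith

theorem SameData.sparseArcs {m' : ℕ → ℕ} (h : SameData n r m m') :
    sparseArcs n q r m' = RAM.sparseArcs n q r m := by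
  rw [RAM.sparseArcs, h.cell, RAM.sparseArcs]

theorem SameData.sparseSet {m' : ℕ → ℕ} (h : SameData n r m m') :
    sparseSet n q r m' = RAM.sparseSet n q r m := by
  rw [RAM.sparseSet, h.cell, RAM.sparseSet]

theorem SameData.zset {m' : ℕ → ℕ} (h : SameData n r m m') :
    zset n q r mode m' = RAM.zset n q r mode m := by
  rw [RAM.zset, h.sparseSet, RAM.zset]

theorem SameData.initVal {m' : ℕ → ℕ} (h : SameData n r m m') :
    initVal n q r mode m' = RAM.initVal n q r mode m := by
  rw [RAM.initVal, h.sparseArcs, RAM.initVal]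

theorem SameData.defect {m' : ℕ → ℕ} (hn : 0 < n) (h : SameData n r m m') :
    defect n q r mode m' = RAM.defect n q r mode m := by
  funext Y
  rw [RAM.defect, h.sparseArcs, h.sparseSet, adj_congr hn h.lt, RAM.defect]

theorem SameData.total {m' : ℕ → ℕ} (hn : 0 < n) (h : SameData n r m m') :
    Total n q r mode m' = Total n q r mode m := by
  funext U t
  rw [Total, adj_congr hn h.lt, h.zset, show Good n q r mode m' = Good n q r mode m by
    funext Y; rw [Good, h.defect hn, Good], Total]

/-- Admissibility sees only the last `q` labels, which are the top binary digits. One test therefore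
decides a whole block of `2 ^ (n - q)` consecutive sets. -/
theorem defect_up_add {A P : ℕ} (hP : P < 2 ^ (n - q)) :
    defect n q r mode m (up n q A + P) = defect n q r mode m (up n q A) := by
  have hb : ∀ i < n, n - q ≤ i → bit n (up n q A + P) i = bit n (up n q A) i := fun i hi h => by
    rw [bit_up_add hP hi, bit_up hi, if_neg (by omega), if_neg (by omega)]
  have h1 : ∀ i < n, ∀ x y, (n - q ≤ i → x = y) → ind (n - q) (i + 1) * x =
      ind (n - q) (i + 1) * y := fun i hi x y h => by
    unfold ind
    split_ifs with h'
    · rw [h (by omega)]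
    · simp
  rw [defect, defect]
  congr 2
  · congr 3
    refine Finset.sum_congr rfl fun i hi => Finset.sum_congr rfl fun j hj => ?_
    rw [h1 i (Finset.mem_range.1 hi) _ (1 - bit n (up n q A) i) fun h => by
        rw [hb i (Finset.mem_range.1 hi) h],
      h1 j (Finset.mem_range.1 hj) _ (bit n (up n q A) j) fun h => by
        rw [hb j (Finset.mem_range.1 hj) h]]
  · refine Finset.sum_congr rfl fun i hi => ?_
    have hi := Finset.mem_range.1 hi
    rcases lt_or_ge i (n - q) with h | h
    · rw [sparseSet, bit_up hi, if_pos h, zero_mul, zero_mul]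
    · rw [hb i hi h]

end

/-! ### Loop invariants -/

theorem iterC_inv {c : ℕ → (ℕ → ℕ) → (ℕ → ℕ) × ℕ} {m : ℕ → ℕ} (N : ℕ) (Inv : ℕ → (ℕ → ℕ) → Prop)
    (b : ℕ → ℕ) (h0 : Inv 0 m)
    (hs : ∀ j < N, ∀ m', Inv j m' → Inv (j + 1) (c j m').1 ∧ (c j m').2 ≤ b j) :
    Inv N (iterC c m N).1 ∧ (iterC c m N).2 ≤ 1 + ∑ j ∈ Finset.range N, (b j + 1) := by
  induction N with
  | zero => exact ⟨h0, by simp [iterC]⟩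
  | succ N ih =>
    obtain ⟨h1, h2⟩ := ih fun j hj => hs j (by omega)
    obtain ⟨h3, h4⟩ := hs N (by omega) _ h1
    refine ⟨h3, ?_⟩
    rw [Finset.sum_range_succ, iterC]
    dsimp only
    omega

section

variable {n q k r mode : ℕ} {m₀ : ℕ → ℕ}

/-- The state of the dynamic program after the first `B` entries. -/
structure TableInv (n q r mode : ℕ) (m₀ : ℕ → ℕ) (B : ℕ) (m : ℕ → ℕ) : Prop where
  lt : ∀ a < tableCell n r mode 0, m a = m₀ a
  best : ∀ U < B, IsBest (Total n q r mode m₀ U) (initVal n q r mode m₀)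
    (m (tableCell n r mode U))
  zero : ∀ a, tableCell n r mode B ≤ a → m a = 0

theorem TableInv.sameData {B : ℕ} {m : ℕ → ℕ} (h : TableInv n q r mode m₀ B m) (hr : r < n) :
    SameData n r m₀ m :=
  ⟨fun a ha => h.lt a (by unfold tableCell; omega),
    h.lt _ (by unfold searchCell tableCell; omega)⟩

theorem TableInv.entry {B : ℕ} {m : ℕ → ℕ} (h : TableInv n q r mode m₀ B m) (hr : r < n)
    (hg : Good n q r mode m₀ B) :
    TableInv n q r mode m₀ (B + 1)
      (Function.update m (tableCell n r mode B) (tableVal n q r mode m B)) := by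
  have hd := h.sameData hr
  have hn : 0 < n := by omega
  refine ⟨fun a ha => ?_, fun U hU => ?_, fun a ha => ?_⟩
  · rw [Function.update_of_ne (by unfold tableCell at *; omega), h.lt a ha]
  · rcases Nat.lt_succ_iff_lt_or_eq.1 hU with hU | rfl
    · rw [Function.update_of_ne (by unfold tableCell at *; omega)]
      exact h.best U hU
    · rw [Function.update_self, ← hd.initVal, ← hd.total hn]
      refine tableVal_isBest (by rwa [Good, hd.defect hn]) fun v hv hb => ?_
      rw [hd.initVal, hd.total hn]
      -- Removing an element decreases the code, so all predecessors come earlier in numerical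
      -- order.
      refine h.best _ ?_
      have := pw_le_of_bit hv hb
      have : 0 < pw n 1 v := by rw [pw_eq hv.le]; positivity
      omega
  · rw [Function.update_of_ne (by unfold tableCell at *; omega)]
    exact h.zero a (by unfold tableCell at *; omega)

/-- No path ends in an inadmissible set, so the zeros in the skipped cells are already the right
values. -/
theorem TableInv.skip {B d : ℕ} {m : ℕ → ℕ} (h : TableInv n q r mode m₀ B m)
    (hg : ∀ P < d, ¬ Good n q r mode m₀ (B + P)) : TableInv n q r mode m₀ (B + d) m := by
  refine ⟨h.lt, fun U hU => ?_, fun a ha => h.zero a (by unfold tableCell at *; omega)⟩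
  rcases lt_or_ge U B with hU' | hU'
  · exact h.best U hU'
  · rw [h.zero _ (by unfold tableCell; omega)]
    obtain ⟨P, rfl⟩ := Nat.exists_eq_add_of_le hU'
    exact isBest_zero fun t ⟨c, κ, hP, _⟩ => hg P (by omega) hP.isGood

/-- Inadmissible blocks cost only their test, hence the factor counting admissible traces. Every run
needs a fresh region of zeros, which is what `h0` provides. -/
theorem tableC_spec (hr : r < n) (h0 : ∀ a, tableCell n r mode 0 ≤ a → m₀ a = 0) :
    TableInv n (n / k) r mode m₀ (2 ^ n) (tableC k ((n, r), mode) m₀).1 ∧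
    (tableC k ((n, r), mode) m₀).2 ≤ 1 + 2 * 2 ^ (n / k) +
      ((Finset.range (2 ^ (n / k))).filter fun A =>
        Good n (n / k) r mode m₀ (up n (n / k) A)).card * (2 + 2 * 2 ^ (n - n / k)) := by
  set q := n / k with hq
  have hqn : q ≤ n := Nat.div_le_self _ _
  have hn : 0 < n := by omega
  have key := iterC_inv (c := fun A => forC (fun x m => 1 - defect (num x) (num x / k) x.1.1.2 x.1.2 m
      (up (num x) (num x / k) x.2)) (forC (fun x _ => pw (num x) 1 (num x - num x / k)) (entryC k))
        (((n, r), mode), A)) (m := m₀) (2 ^ q)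
    (fun A m => TableInv n q r mode m₀ (up n q A) m)
    (fun A => 1 + if Good n q r mode m₀ (up n q A) then 2 + 2 * 2 ^ (n - q) else 0)
    (by
      refine ⟨fun _ _ => rfl, fun U hU => by simp [up] at hU, fun a ha => h0 a ?_⟩
      simpa [up] using ha) ?_
  · have e : tableC k ((n, r), mode) m₀ = iterC (fun A => forC (fun x m => 1 - defect (num x)
        (num x / k) x.1.1.2 x.1.2 m (up (num x) (num x / k) x.2))
        (forC (fun x _ => pw (num x) 1 (num x - num x / k)) (entryC k))
        (((n, r), mode), A)) m₀ (2 ^ q) := by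
      rw [tableC, forC]
      simp only [num_pair, num_nat, ← hq, pw_eq hqn]
    rw [e]
    refine ⟨?_, key.2.trans ?_⟩
    · convert key.1 using 1
      rw [up, pw_eq (Nat.sub_le _ _), ← pow_add]
      congr 1
      omega
    · rw [Finset.sum_add_distrib, Finset.sum_add_distrib, ← Finset.sum_filter, Finset.sum_const,
        Finset.sum_const, Finset.card_range]
      simp only [smul_eq_mul]
      omega
  · intro A hA m hm
    have hd := hm.sameData hr
    have hup : up n q (A + 1) = up n q A + 2 ^ (n - q) := by
      rw [up, up, pw_eq (Nat.sub_le _ _)]; ring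
    simp only [forC, num_pair, num_nat, ← hq, hd.defect hn]
    by_cases hg : Good n q r mode m₀ (up n q A)
    · have hg' : defect n q r mode m₀ (up n q A) = 0 := hg
      rw [if_pos hg, hg', hup]
      have key := iterC_inv (c := fun P => entryC k (((((n, r), mode), A), 0), P)) (m := m)
        (2 ^ (n - q)) (fun P m => TableInv n q r mode m₀ (up n q A + P) m) (fun _ => 1) hm
        (fun P hP m' hm' => ⟨by
          have := hm'.entry hr (by rwa [Good, defect_up_add hP])
          simpa only [entryC, storeC, num_pair, num_nat, ← hq, add_assoc] using this, le_rfl⟩)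
      simp only [iterC, forC, ← hq, pw_eq (Nat.sub_le n q), one_add_one_eq_two]
      refine ⟨key.1, ?_⟩
      have h2 := key.2
      rw [Finset.sum_const, Finset.card_range, smul_eq_mul] at h2
      omega
    · have hg' : 1 - defect n q r mode m₀ (up n q A) = 0 := by
        have : defect n q r mode m₀ (up n q A) ≠ 0 := hg
        omega
      rw [if_neg hg, hg', hup]
      refine ⟨hm.skip fun P hP => ?_, le_rfl⟩
      rwa [Good, defect_up_add hP]

theorem searchC_spec (hr : r < n) (h0 : m₀ (searchCell n r) = 0) :
    (∀ a, a ≠ searchCell n r → (searchC k (n, r) m₀).1 a = m₀ a) ∧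
    (searchC k (n, r) m₀).1 (searchCell n r) =
      (Finset.range (2 ^ (n / k))).sup (searchVal n (n / k) (adj n r m₀)) ∧
    (searchC k (n, r) m₀).2 ≤ 1 + 2 * 2 ^ (n / k) := by
  set q := n / k with hq
  have hqn : q ≤ n := Nat.div_le_self _ _
  have hn : 0 < n := by omega
  have key := iterC_inv (c := fun A => storeC (fun (x : (ℕ × ℕ) × ℕ) _ =>
      searchCell (num x) x.1.2) (fun x m => max (m (searchCell (num x) x.1.2))
      (searchVal (num x) (num x / k) (adj (num x) x.1.2 m) x.2)) ((n, r), A)) (m := m₀) (2 ^ q)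
    (fun A m => (∀ a, a ≠ searchCell n r → m a = m₀ a) ∧
      m (searchCell n r) = (Finset.range A).sup (searchVal n q (adj n r m₀)))
    (fun _ => 1) ⟨fun _ _ => rfl, by simpa using h0⟩ ?_
  · have e : searchC k (n, r) m₀ = iterC (fun A => storeC (fun (x : (ℕ × ℕ) × ℕ) _ =>
        searchCell (num x) x.1.2) (fun x m => max (m (searchCell (num x) x.1.2))
        (searchVal (num x) (num x / k) (adj (num x) x.1.2 m) x.2)) ((n, r), A)) m₀ (2 ^ q) := by
      rw [searchC, forC]
      simp only [num_pair, num_nat, ← hq, pw_eq hqn]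
    rw [e]
    refine ⟨key.1.1, key.1.2, key.2.trans ?_⟩
    rw [Finset.sum_const, Finset.card_range, smul_eq_mul]
    omega
  · rintro A hA m ⟨hm, hm'⟩
    have ha : adj n r m = adj n r m₀ := adj_congr hn fun a ha => hm a (by
      unfold searchCell; omega)
    simp only [storeC, num_pair, num_nat, ← hq]
    refine ⟨⟨fun a hne => ?_, ?_⟩, le_rfl⟩
    · rw [Function.update_of_ne hne, hm a hne]
    · rw [Function.update_self, hm', ha, Finset.range_add_one, Finset.sup_insert, sup_comm]

/-- The input together with the results of all the searches. -/
def withSearch (n k : ℕ) (m : ℕ → ℕ) (a : ℕ) : ℕ :=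
  if a < n * n then m a else
    (Finset.range (2 ^ (n / k))).sup (searchVal n (n / k) (adj n (a - (n * n + 1)) m))

/-- The total weights of the complete orderings considered for `r` and `mode`. -/
def Candidate (n k r mode : ℕ) (m : ℕ → ℕ) (t : ℕ) : Prop :=
  ∃ c κ, Path n (adj n r m) (zset n (n / k) r mode (withSearch n k m))
      (Good n (n / k) r mode (withSearch n k m))
      (pw n 1 n - 1 - zset n (n / k) r mode (withSearch n k m)) c κ ∧
    t = (c + (1 - mode) * sparseArcs n (n / k) r (withSearch n k m)) * pw n (2 * n + 1) n +
      code n r κ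

/-- The state of the algorithm before round `e / 2` with mode `e % 2`. -/
structure MainInv (n k : ℕ) (m₀ : ℕ → ℕ) (e : ℕ) (m : ℕ → ℕ) : Prop where
  lt : ∀ a < n * n, m a = m₀ a
  zero : ∀ a, n * n + (n + 1) + e * 2 ^ n ≤ a → m a = 0
  best : IsBest (fun t => ∃ r mode, mode < 2 ∧ 2 * r + mode < e ∧ Candidate n k r mode m₀ t)
    (cap n) (m (n * n))

/-- The number of sets admitted for `r` and `mode`. -/
def numGood (n k r mode : ℕ) (m : ℕ → ℕ) : ℕ :=
  ((Finset.range (2 ^ (n / k))).filter fun A =>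
    Good n (n / k) r mode (withSearch n k m) (up n (n / k) A)).card

theorem withSearch_cell (n k r : ℕ) (m : ℕ → ℕ) : withSearch n k m (searchCell n r) =
    (Finset.range (2 ^ (n / k))).sup (searchVal n (n / k) (adj n r m)) := by
  rw [withSearch, searchCell, if_neg (by omega), show n * n + (1 + r) - (n * n + 1) = r by omega]

/-- The arcs inside the sparse set are charged in advance through `initVal`, so the table entry at
the complement of `zset` is the value of a complete ordering. -/
theorem round_spec {m : ℕ → ℕ} (hr : r < n) (hmode : mode < 2)
    (h : MainInv n k m₀ (2 * r + mode) m)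
    (hc : m (searchCell n r) = withSearch n k m₀ (searchCell n r)) :
    MainInv n k m₀ (2 * r + (mode + 1)) (seqC (tableC k) (bestC k) ((n, r), mode) m).1 ∧
    (∀ r', r' < n → (seqC (tableC k) (bestC k) ((n, r), mode) m).1 (searchCell n r') =
      m (searchCell n r')) ∧
    (seqC (tableC k) (bestC k) ((n, r), mode) m).2 ≤ 2 + 2 * 2 ^ (n / k) +
      numGood n k r mode m₀ * (2 + 2 * 2 ^ (n - n / k)) := by
  have hn : 0 < n := by omega
  have hqn : n / k ≤ n := Nat.div_le_self _ _
  have hpw : pw n 1 n = 2 ^ n := pw_eq le_rfl 1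
  have hd : SameData n r (withSearch n k m₀) m :=
    ⟨fun a ha => by rw [h.lt a ha, withSearch, if_pos ha], hc⟩
  obtain ⟨hT, htime⟩ := tableC_spec (k := k) (mode := mode) (m₀ := m) hr fun a ha => h.zero a (by
    rw [tableCell, hpw] at ha; omega)
  have hd' := hT.sameData hr
  simp only [seqC, bestC, storeC, num_pair, num_nat]
  set m' := (tableC k ((n, r), mode) m).1 with hm'
  have hZ : zset n (n / k) r mode m' = zset n (n / k) r mode (withSearch n k m₀) :=
    hd'.zset.trans hd.zset
  rw [hZ]
  set U := pw n 1 n - 1 - zset n (n / k) r mode (withSearch n k m₀) with hU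
  have hU2 : U < 2 ^ n := by
    have := Nat.two_pow_pos n
    omega
  have hnn : n ≤ n * n := Nat.le_mul_of_pos_left n hn
  refine ⟨⟨fun a ha => ?_, fun a ha => ?_, ?_⟩, fun r' hr' => ?_, ?_⟩
  · rw [Function.update_of_ne ha.ne, hT.lt a (by unfold tableCell; omega), h.lt a ha]
  · rw [Function.update_of_ne (by omega)]
    refine hT.zero a ?_
    rw [tableCell, hpw]
    have : (2 * r + (mode + 1)) * 2 ^ n = (2 * r + mode) * 2 ^ n + 2 ^ n := by ring
    omega
  · rw [Function.update_self, hT.lt _ (by unfold tableCell; omega)]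
    have h1 := hT.best U hU2
    rw [hd.initVal, hd.total hn] at h1
    have h2 : IsBest (Candidate n k r mode m₀) (cap n) (m' (tableCell n r mode U)) := by
      have ha : adj n r (withSearch n k m₀) = adj n r m₀ :=
        adj_congr hn fun a ha => by rw [withSearch, if_pos ha]
      refine ⟨?_, h1.2.imp id ?_⟩
      · rintro t ⟨c, κ, hP, rfl⟩
        refine le_trans (le_of_eq ?_) (h1.1 _ ⟨c, κ, by rwa [ha], rfl⟩)
        rw [initVal, Nat.sub_sub]
        congr 1
        ring
      · rintro ⟨t, ⟨c, κ, hP, rfl⟩, ht⟩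
        refine ⟨_, ⟨c, κ, by rwa [ha] at hP, rfl⟩, ?_⟩
        rw [ht, initVal, Nat.sub_sub]
        congr 1
        ring
    refine (h.best.max h2).congr fun t => ⟨?_, ?_⟩
    · rintro ⟨r', mode', hmo, hlt, hC⟩
      have : 2 * r' + mode' < 2 * r + mode ∨ (r' = r ∧ mode' = mode) := by omega
      rcases this with hlt | ⟨rfl, rfl⟩
      · exact .inl ⟨r', mode', hmo, hlt, hC⟩
      · exact .inr hC
    · rintro (⟨r', mode', hmo, hlt, hC⟩ | hC)
      · exact ⟨r', mode', hmo, by omega, hC⟩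
      · exact ⟨r, mode, hmode, by omega, hC⟩
  · rw [Function.update_of_ne (by unfold searchCell; omega)]
    exact hT.lt _ (by unfold searchCell tableCell; omega)
  · have e : numGood n k r mode m₀ = ((Finset.range (2 ^ (n / k))).filter fun A =>
        Good n (n / k) r mode m (up n (n / k) A)).card := by
      unfold numGood
      congr 1
      refine Finset.filter_congr fun A _ => ?_
      rw [Good, Good, hd.defect hn]
    rw [e]
    omega

/-- The memory before the output of the ordering is computed. -/
theorem mainLoop_spec (hn : 0 < n) (h0 : ∀ a, n * n ≤ a → m₀ a = 0) (D : ℕ)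
    (hD : ∀ r < n, ∀ mode < 2, numGood n k r mode m₀ ≤ D) :
    let x := forC (fun x _ => num x) (seqC (searchC k) (forC (fun _ _ => 2)
      (seqC (tableC k) (bestC k)))) n m₀
    MainInv n k m₀ (2 * n) x.1 ∧
      x.2 ≤ 1 + n * (9 + 6 * 2 ^ (n / k) + 2 * (D * (2 + 2 * 2 ^ (n - n / k)))) := by
  intro x
  have key := iterC_inv (c := fun r => seqC (searchC k) (forC (fun _ _ => 2)
      (seqC (tableC k) (bestC k))) (n, r)) (m := m₀) n
    (fun r m => MainInv n k m₀ (2 * r) m ∧ ∀ r', r ≤ r' → r' < n → m (searchCell n r') = 0)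
    (fun _ => 8 + 6 * 2 ^ (n / k) + 2 * (D * (2 + 2 * 2 ^ (n - n / k))))
    ⟨⟨fun _ _ => rfl, fun a ha => h0 a (by omega), by
        rw [h0 _ le_rfl]
        exact isBest_zero fun t ⟨_, _, _, h, _⟩ => by omega⟩,
      fun r' _ _ => h0 _ (by unfold searchCell; omega)⟩ ?_
  · refine ⟨key.1.1, key.2.trans (le_of_eq ?_)⟩
    rw [Finset.sum_const, Finset.card_range, smul_eq_mul]
    congr 2
    omega
  · rintro r hr m ⟨hm, hm0⟩
    obtain ⟨s1, s2, s3⟩ := searchC_spec (k := k) hr (hm0 r le_rfl hr)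
    rw [adj_congr hn hm.lt, ← withSearch_cell] at s2
    simp only [seqC, forC]
    set m₁ := (searchC k (n, r) m).1 with hm₁
    have hm₁' : MainInv n k m₀ (2 * r) m₁ := by
      refine ⟨fun a ha => ?_, fun a ha => ?_, ?_⟩
      · rw [s1 a (by unfold searchCell; omega), hm.lt a ha]
      · rw [s1 a (by unfold searchCell; omega), hm.zero a ha]
      · rw [s1 _ (by unfold searchCell; omega)]
        exact hm.best
    have key := iterC_inv (c := fun mode => seqC (tableC k) (bestC k) ((n, r), mode)) (m := m₁) 2
      (fun mode m => MainInv n k m₀ (2 * r + mode) m ∧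
        ∀ r' < n, m (searchCell n r') = m₁ (searchCell n r'))
      (fun mode => 2 + 2 * 2 ^ (n / k) + D * (2 + 2 * 2 ^ (n - n / k))) ⟨hm₁', fun _ _ => rfl⟩
      (fun mode hmode m' ⟨h1, h2⟩ => by
        obtain ⟨r1, r2, r3⟩ := round_spec hr hmode h1 ((h2 r hr).trans s2)
        refine ⟨⟨r1, fun r' hr' => (r2 r' hr').trans (h2 r' hr')⟩, r3.trans ?_⟩
        exact Nat.add_le_add_left (Nat.mul_le_mul_right _ (hD r hr mode hmode)) _)
    refine ⟨⟨key.1.1, fun r' hr' hr'' => ?_⟩, ?_⟩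
    · rw [key.1.2 r' hr'', s1 _ (by unfold searchCell; omega), hm0 r' (by omega) hr'']
    · have := key.2
      simp only [Finset.sum_range_succ, Finset.sum_range_zero] at this
      omega

theorem mainC_spec (hn : 0 < n) (h0 : ∀ a, n * n ≤ a → m₀ a = 0) (D : ℕ)
    (hD : ∀ r < n, ∀ mode < 2, numGood n k r mode m₀ ≤ D) :
    ∃ m : ℕ → ℕ, MainInv n k m₀ (2 * n) m ∧
      (∀ v < n, (mainC k n m₀).1 v = rank n (key n m) v) ∧
      (mainC k n m₀).2 ≤ 2 + n * (11 + 6 * 2 ^ (n / k) + 2 * (D * (2 + 2 * 2 ^ (n - n / k)))) := by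
  obtain ⟨h1, h2⟩ := mainLoop_spec (k := k) hn h0 D hD
  refine ⟨_, h1, ?_⟩
  rw [mainC, seqC]
  set m := (forC (fun x _ => num x) (seqC (searchC k) (forC (fun _ _ => 2)
      (seqC (tableC k) (bestC k)))) n m₀).1 with hm
  have hnn : n ≤ n * n := Nat.le_mul_of_pos_left n hn
  have key := iterC_inv (c := fun v => storeC (fun (x : ℕ × ℕ) _ => x.2)
      (fun x m => rank (num x) (key (num x) m) x.2) (n, v)) (m := m) n
    (fun v m' => (∀ u < v, m' u = rank n (key n m) u) ∧ m' (n * n) = m (n * n)) (fun _ => 1)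
    ⟨fun u hu => absurd hu (Nat.not_lt_zero u), rfl⟩ ?_
  · refine ⟨key.1.1, ?_⟩
    have := key.2
    rw [Finset.sum_const, Finset.card_range, smul_eq_mul] at this
    change _ + (iterC _ _ n).2 ≤ _
    have e : n * (11 + 6 * 2 ^ (n / k) + 2 * (D * (2 + 2 * 2 ^ (n - n / k)))) = n * 2 +
      n * (9 + 6 * 2 ^ (n / k) + 2 * (D * (2 + 2 * 2 ^ (n - n / k)))) := by ring
    rw [e]
    omega
  · rintro v hv m' ⟨h3, h4⟩
    have hk : RAM.key n m' = RAM.key n m := by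
      funext u
      rw [RAM.key, h4, RAM.key]
    simp only [storeC, num_pair, num_nat, hk]
    refine ⟨⟨fun u hu => ?_, ?_⟩, le_rfl⟩
    · rcases Nat.lt_succ_iff_lt_or_eq.1 hu with hu | rfl
      · rw [Function.update_of_ne hu.ne, h3 u hu]
      · rw [Function.update_self]
    · rw [Function.update_of_ne (by omega), h4]

end

/-! ### The quality of the orderings considered -/

section

variable {n k r mode : ℕ} {m₀ : ℕ → ℕ}

theorem adj_withSearch (hn : 0 < n) (k r : ℕ) (m₀ : ℕ → ℕ) :
    adj n r (withSearch n k m₀) = adj n r m₀ :=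
  adj_congr hn fun a ha => by rw [withSearch, if_pos ha]

theorem pop_pred_two_pow {q : ℕ} (hq : q ≤ n) : q ≤ pop n (2 ^ q - 1) := by
  rw [pop]
  calc q = ∑ i ∈ Finset.range q, 1 := by simp
    _ ≤ ∑ i ∈ Finset.range q, bit n (2 ^ q - 1) i := Finset.sum_le_sum fun i hi => by
        have hi := Finset.mem_range.1 hi
        rw [bit_eq (by omega), Nat.testBit_two_pow_sub_one]
        simp [hi]
    _ ≤ _ := Finset.sum_le_sum_of_subset (Finset.range_subset_range.2 hq)

theorem arcs_le {a : ℕ → ℕ → ℕ} (ha : ∀ i j, a i j ≤ 1) (Y : ℕ) : arcs n a Y ≤ n * n := by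
  refine (Finset.sum_le_sum fun i _ => Finset.sum_le_sum fun j _ =>
    Nat.mul_le_mul (Nat.mul_le_mul (bit_le_one n Y i) (bit_le_one n Y j)) (ha i j)).trans ?_
  simp

/-- The search finds a sparsest set of at least half of the last vertices. -/
theorem search_spec (hm : ∀ a, m₀ a ≤ 1) (k r : ℕ) : ∃ A < 2 ^ (n / k),
    n / k ≤ 2 * pop n A ∧
    sparseArcs n (n / k) r (withSearch n k m₀) = arcs n (adj n r m₀) (up n (n / k) A) ∧
    sparseSet n (n / k) r (withSearch n k m₀) = up n (n / k) A ∧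
    ∀ A' < 2 ^ (n / k), n / k ≤ 2 * pop n A' →
      arcs n (adj n r m₀) (up n (n / k) A) ≤ arcs n (adj n r m₀) (up n (n / k) A') := by
  set q := n / k with hq
  have hqn : q ≤ n := Nat.div_le_self _ _
  have hpos := Nat.two_pow_pos q
  set a := adj n r m₀ with ha
  -- The number of arcs and the code `A` are packed as quotient and remainder modulo `2 ^ q`.
  -- Subtracting from `searchCap` turns the minimum into a maximum, and this bound keeps the value
  -- of every large enough set positive.
  have hlt : ∀ A < 2 ^ q, arcs n a (up n q A) * 2 ^ q + A < searchCap n q := fun A hA => by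
    have := Nat.mul_le_mul_right (2 ^ q) (arcs_le (n := n) (a := a) (fun i j => hm _) (up n q A))
    rw [searchCap, pw_eq hqn, one_add_one_eq_two, add_mul]
    omega
  have hval : ∀ A, q ≤ 2 * pop n A →
      searchVal n q a A = searchCap n q - (arcs n a (up n q A) * 2 ^ q + A) := fun A hA => by
    rw [searchVal, ind, if_pos (by omega), one_mul, pw_eq hqn]
  have hne : (Finset.range (2 ^ q)).Nonempty := ⟨0, Finset.mem_range.2 hpos⟩
  obtain ⟨A, hA, he⟩ := Finset.exists_mem_eq_sup _ hne (searchVal n q a)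
  have hA := Finset.mem_range.1 hA
  have hle : ∀ A' < 2 ^ q, searchVal n q a A' ≤ searchVal n q a A := fun A' hA' =>
    he ▸ Finset.le_sup (Finset.mem_range.2 hA')
  have hpop : q ≤ 2 * pop n A := by
    by_contra h
    have h0 : searchVal n q a A = 0 := by rw [searchVal, ind, if_neg (by omega), zero_mul]
    -- The whole window is large enough and has a positive value, so the maximum is not attained at
    -- a set that is too small, whose value is `0`.
    have h1 := hle (2 ^ q - 1) (by omega)
    have h2 := hlt (2 ^ q - 1) (by omega)
    have h3 := pop_pred_two_pow hqn
    rw [h0, hval _ (by omega)] at h1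
    omega
  have hcell : searchCap n q - withSearch n k m₀ (searchCell n r) =
      arcs n a (up n q A) * 2 ^ q + A := by
    have := hlt A hA
    rw [withSearch_cell, ← hq, he, hval A hpop]
    omega
  refine ⟨A, hA, hpop, ?_, ?_, fun A' hA' hpop' => ?_⟩
  · rw [sparseArcs, hcell, pw_eq hqn]
    rw [one_add_one_eq_two, add_comm, Nat.add_mul_div_right _ _ hpos, Nat.div_eq_of_lt hA, zero_add]
  · rw [sparseSet, hcell, pw_eq hqn]
    rw [one_add_one_eq_two, add_comm, Nat.add_mul_mod_self_right, Nat.mod_eq_of_lt hA]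
  · have h1 := hle A' hA'
    rw [hval A hpop, hval A' hpop'] at h1
    have h2 := hlt A hA
    have h3 := hlt A' hA'
    by_contra! h4
    have := Nat.mul_le_mul_right (2 ^ q) h4
    rw [Nat.succ_mul] at this
    omega

theorem card_disjoint_le {q : ℕ} (hq : q ≤ n) {A₀ : ℕ} (hA₀ : A₀ < 2 ^ q) :
    ((Finset.range (2 ^ q)).filter fun A => inter n (up n q A₀) (up n q A) = 0).card *
      2 ^ pop n A₀ ≤ 2 ^ q := by
  let S : ℕ → Finset ℕ := fun A => (Finset.range q).filter fun i => bit n A i = 1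
  have hinj : Set.InjOn S ((Finset.range (2 ^ q)).filter fun A =>
      inter n (up n q A₀) (up n q A) = 0) := by
    intro A hA A' hA' h
    have hA := Finset.mem_range.1 (Finset.mem_filter.1 hA).1
    have hA' := Finset.mem_range.1 (Finset.mem_filter.1 hA').1
    refine eq_of_bit_eq hA hA' fun i hi => ?_
    have h1 : i ∈ S A ↔ i ∈ S A' := by rw [h]
    simp only [S, Finset.mem_filter, Finset.mem_range, hi, true_and,
      bit_eq_one (show i ≤ n by omega)] at h1
    rw [bit_eq hi.le, bit_eq hi.le]
    cases hx : A.testBit i <;> cases hy : A'.testBit i <;> simp_all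
  have hpop : pop n A₀ = (S A₀).card := by
    have h0 : ∀ i < n, q ≤ i → bit n A₀ i = 0 := fun i hi h => by
      rw [bit_eq_zero hi.le]
      exact Nat.testBit_lt_two_pow (hA₀.trans_le (Nat.pow_le_pow_right (by omega) h))
    rw [pop, Finset.card_filter, ← Finset.sum_subset (Finset.range_subset_range.2 hq)]
    · refine Finset.sum_congr rfl fun i _ => ?_
      have := bit_le_one n A₀ i
      split_ifs <;> omega
    · intro i hi hi'
      exact h0 i (Finset.mem_range.1 hi) (by simpa using hi')
  rw [← Finset.card_image_of_injOn hinj, hpop]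
  have hsub : ((Finset.range (2 ^ q)).filter fun A => inter n (up n q A₀) (up n q A) = 0).image S ⊆
      (Finset.range q \ S A₀).powerset := by
    intro B hB
    obtain ⟨A, hA, rfl⟩ := Finset.mem_image.1 hB
    have hA := (Finset.mem_filter.1 hA).2
    refine Finset.mem_powerset.2 fun i hi => ?_
    obtain ⟨hi, hb⟩ := Finset.mem_filter.1 hi
    refine Finset.mem_sdiff.2 ⟨hi, fun hi' => ?_⟩
    have hb' := (Finset.mem_filter.1 hi').2
    have hi := Finset.mem_range.1 hi
    have := Finset.sum_eq_zero_iff.1 hA (n - q + i) (Finset.mem_range.2 (by omega))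
    rw [bit_up_right hq hi, bit_up_right hq hi, hb, hb'] at this
    omega
  refine (Nat.mul_le_mul_right _ (Finset.card_le_card hsub)).trans (le_of_eq ?_)
  rw [Finset.card_powerset, ← pow_add,
    Finset.card_sdiff_add_card_eq_card (Finset.filter_subset _ _), Finset.card_range]

/-- Few sets are admitted. -/
theorem numGood_le (hn : 0 < n) (hm : ∀ a, m₀ a ≤ 1) (hdiag : ∀ u < n, m₀ (n * u + u) = 0)
    (k r : ℕ) (hmode : mode < 2) :
    numGood n k r mode m₀ * 7 ^ (n / k / 4) ≤ 6 ^ (n / k / 4) * 2 ^ (n / k) := by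
  obtain ⟨A₀, hA₀, hpop, harcs, hset, hmin⟩ := search_spec (n := n) hm k r
  set q := n / k with hq
  have hqn : q ≤ n := Nat.div_le_self _ _
  unfold numGood
  rw [← hq]
  interval_cases mode
  · have h1 := card_disjoint_le hqn hA₀
    have e : ((Finset.range (2 ^ q)).filter fun A => Good n q r 0 (withSearch n k m₀) (up n q A)) =
        (Finset.range (2 ^ q)).filter fun A => inter n (up n q A₀) (up n q A) = 0 :=
      Finset.filter_congr fun A _ => by simp [Good, defect, hset]
    rw [e]
    -- The sparse set has at least `q / 2` elements, so avoiding it saves far more than the required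
    -- `(6 / 7) ^ (q / 4)`; comparing `7` with `12 = 6 * 2` suffices.
    have h2 : 7 ^ (q / 4) ≤ 6 ^ (q / 4) * 2 ^ pop n A₀ := by
      calc 7 ^ (q / 4) ≤ 12 ^ (q / 4) := Nat.pow_le_pow_left (by omega) _
        _ = 6 ^ (q / 4) * 2 ^ (q / 4) := by rw [← mul_pow]; norm_num
        _ ≤ _ := Nat.mul_le_mul_left _ (Nat.pow_le_pow_right (by omega) (by omega))
    refine (Nat.mul_le_mul_left _ h2).trans ?_
    rw [mul_left_comm]
    exact Nat.mul_le_mul_left _ h1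
  · have e : ((Finset.range (2 ^ q)).filter fun A => Good n q r 1 (withSearch n k m₀) (up n q A)) =
        (Finset.range (2 ^ q)).filter fun A => 8 * cross n q (adj n r m₀) (up n q A) <
          arcs n (adj n r m₀) (up n q A₀) :=
      Finset.filter_congr fun A _ => by
        simp only [Good, defect, harcs, adj_withSearch hn]
        omega
    rw [e]
    exact card_cross_le hqn _ (fun i => hdiag _ (lab_lt hn r i)) _ hmin

/-! ### From sort keys to orderings -/

/-- Backward arcs for the positions `s`. -/
def backSum (n : ℕ) (m : ℕ → ℕ) (s : ℕ → ℕ) : ℕ :=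
  ∑ u ∈ Finset.range n, ∑ v ∈ Finset.range n, ind (s v) (s u) * m (n * u + v)

theorem rank_lt_rank {κ : ℕ → ℕ} {u v : ℕ} (hu : u < n) (h : κ v * n + v < κ u * n + u) :
    rank n κ u < rank n κ v := by
  refine Finset.sum_lt_sum (fun w _ => ?_) ⟨u, Finset.mem_range.2 hu, ?_⟩
  · unfold ind
    split_ifs <;> omega
  · unfold ind
    split_ifs <;> omega

theorem rank_lt {κ : ℕ → ℕ} {v : ℕ} (hv : v < n) : rank n κ v < n := by
  have : rank n κ v < ∑ u ∈ Finset.range n, 1 :=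
    Finset.sum_lt_sum (fun w _ => ind_le_one _ _) ⟨v, Finset.mem_range.2 hv, by simp [ind]⟩
  simpa using this

theorem rank_inj {κ : ℕ → ℕ} {u v : ℕ} (hu : u < n) (hv : v < n) (h : rank n κ u = rank n κ v) :
    u = v := by
  rcases lt_trichotomy (κ v * n + v) (κ u * n + u) with h' | h' | h'
  · have := rank_lt_rank hu h'
    omega
  · have h1 := congrArg (· % n) h'
    simpa [Nat.mul_add_mod', Nat.mod_eq_of_lt hu, Nat.mod_eq_of_lt hv, eq_comm] using h1
  · have := rank_lt_rank hv h'
    omega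

/-- Equal keys are counted as backward on the right, so it does not matter how `rank` breaks ties.
-/
theorem backSum_rank_le {κ κ' : ℕ → ℕ} (hr : r ≤ n) (h : ∀ i < n, κ' (lab n r i) = κ i) :
    backSum n m₀ (rank n κ') ≤ ∑ i ∈ Finset.range n, ∑ j ∈ Finset.range n,
      (if κ i ≤ κ j then adj n r m₀ i j else 0) := by
  rw [backSum, ← sum_lab hr]
  refine Finset.sum_le_sum fun i hi => ?_
  rw [← sum_lab hr]
  refine Finset.sum_le_sum fun j hj => ?_
  have hi := Finset.mem_range.1 hi
  have hj := Finset.mem_range.1 hj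
  split_ifs with hij
  · exact (Nat.mul_le_mul_right _ (ind_le_one _ _)).trans (by rw [one_mul, adj])
  · rw [ind, if_neg, zero_mul]
    refine not_lt.2 (rank_lt_rank (lab_lt (by omega) r i) ?_).le
    rw [h i hi, h j hj]
    have h1 := lab_lt (show 0 < n by omega) r j
    have h2 := Nat.mul_le_mul_right n (show κ j + 1 ≤ κ i by omega)
    rw [Nat.succ_mul] at h2
    omega

theorem Good.disjoint {q : ℕ} (hmode : mode < 2) {m : ℕ → ℕ} {U i : ℕ} (h : Good n q r mode m U)
    (hi : i < n) (hz : bit n (zset n q r mode m) i = 1) : bit n U i = 0 := by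
  interval_cases mode
  · have h1 : inter n (sparseSet n q r m) U = 0 := by simpa [Good, defect] using h
    have h2 := Finset.sum_eq_zero_iff.1 h1 i (Finset.mem_range.2 hi)
    rw [zset, Nat.sub_zero, one_mul] at hz
    rw [hz] at h2
    omega
  · simp [zset, bit_zero_left] at hz

theorem zset_lt (hm : ∀ a, m₀ a ≤ 1) (hmode : mode < 2) :
    zset n (n / k) r mode (withSearch n k m₀) < 2 ^ n := by
  obtain ⟨A₀, hA₀, -, -, hset, -⟩ := search_spec (n := n) hm k r
  interval_cases mode
  · rw [zset, hset, Nat.sub_zero, one_mul]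
    simpa using up_lt (Nat.div_le_self n k) hA₀ (Nat.two_pow_pos _)
  · simp [zset]

/-- The ordering coded by a candidate is as good as its weight tells. -/
theorem Candidate.backSum_le (hr : r < n) (hm : ∀ a, m₀ a ≤ 1)
    (hdiag : ∀ u < n, m₀ (n * u + u) = 0) (hmode : mode < 2) {t : ℕ}
    (h : Candidate n k r mode m₀ t) (ht : t ≤ cap n) {m : ℕ → ℕ} (hb : m (n * n) = cap n - t) :
    backSum n m₀ (rank n (key n m)) ≤ t / (2 * n + 2) ^ n := by
  have hn : 0 < n := by omega
  obtain ⟨c, κ, hP, rfl⟩ := h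
  have hgood := fun U (hU : Good n (n / k) r mode (withSearch n k m₀) U) i (hi : i < n)
    (hz : bit n (zset n (n / k) r mode (withSearch n k m₀)) i = 1) => hU.disjoint hmode hi hz
  have hk := hP.keyInv hgood
  have hloop : ∀ i, adj n r m₀ i i = 0 := fun i => hdiag _ (lab_lt hn r i)
  have h1 := hP.sum_le hloop hgood fun i hi hz => by
    rw [bit_compl (zset_lt hm hmode) hi, hz]
  have hkey : ∀ i < n, key n m (lab n r i) = κ i := fun i hi => by
    rw [key, hb, Nat.sub_sub_self ht, pw_eq le_rfl, pw_eq (lab_lt hn r i).le]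
    exact decode hr.le hk.le _ hi
  refine (backSum_rank_le hr.le hkey).trans (h1.trans ?_)
  rw [Nat.le_div_iff_mul_le (by positivity), pw_eq le_rfl]
  -- The sort keys only increase the weight and can be dropped; what remains is that the arcs inside
  -- `zset` were charged.
  refine le_trans (Nat.mul_le_mul_right _ (Nat.add_le_add_left ?_ c)) (Nat.le_add_right _ _)
  obtain ⟨A₀, hA₀, -, harcs, hset, -⟩ := search_spec (n := n) hm k r
  interval_cases mode
  · rw [zset, hset, Nat.sub_zero, one_mul, one_mul, harcs]
  · simp [zset, arcs, bit_zero_left]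

/-! ### The averaging over rotations and the choice of mode -/

/-- Backward arcs that are incident to the last `q` vertices. -/
def backTop (n q : ℕ) (a : ℕ → ℕ → ℕ) (π : ℕ → ℕ) : ℕ :=
  ∑ i ∈ Finset.range n, ∑ j ∈ Finset.range n,
    if n - q ≤ i ∨ n - q ≤ j then ind (π j) (π i) * a i j else 0

/-- Each vertex lies in exactly `q` of the `n` windows. Reversing the order of the rotations turns
the label of a fixed vertex into a rotated index. -/
theorem sum_rotations {q : ℕ} (hq : q ≤ n) {u : ℕ} (hu : u < n) :
    ∑ r ∈ Finset.range n, (if n - q ≤ unlab n r u then 1 else 0) = q := by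
  have h1 : ∀ r ∈ Finset.range n, (if n - q ≤ unlab n r u then 1 else 0) =
      if n - q ≤ lab n (u + 1) (n - 1 - r) then 1 else 0 := fun r hr => by
    have := Finset.mem_range.1 hr
    rw [unlab, lab, lab, show n - 1 - r + (u + 1) = u + (n - r) by omega]
  rw [Finset.sum_congr rfl h1,
    Finset.sum_range_reflect (fun r => if n - q ≤ lab n (u + 1) r then 1 else 0),
    sum_lab (r := u + 1) hu (fun v => if n - q ≤ v then 1 else 0),
    sum_shift hq _ fun i hi => if_neg (by omega)]
  simp

/-- Some rotation has few backward arcs at the last vertices. -/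
theorem exists_rotation (hn : 0 < n) {q : ℕ} (hq : q ≤ n) (m₀ s : ℕ → ℕ) : ∃ r < n,
    n * backTop n q (adj n r m₀) (fun i => s (lab n r i)) ≤ 2 * q * backSum n m₀ s := by
  by_contra! h
  have h1 : ∑ r ∈ Finset.range n, 2 * q * backSum n m₀ s < ∑ r ∈ Finset.range n,
      n * backTop n q (adj n r m₀) (fun i => s (lab n r i)) :=
    Finset.sum_lt_sum_of_nonempty ⟨0, Finset.mem_range.2 hn⟩ fun r hr =>
      h r (Finset.mem_range.1 hr)
  rw [Finset.sum_const, Finset.card_range, smul_eq_mul, ← Finset.mul_sum] at h1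
  have h2 := Nat.lt_of_mul_lt_mul_left h1
  refine absurd h2 (not_lt.2 ?_)
  -- An arc is counted once for each of its endpoints in the window; this causes the factor `2` in
  -- the bound.
  have h3 : ∀ r ∈ Finset.range n, backTop n q (adj n r m₀) (fun i => s (lab n r i)) ≤
      ∑ u ∈ Finset.range n, ∑ v ∈ Finset.range n, ((if n - q ≤ unlab n r u then 1 else 0) +
        (if n - q ≤ unlab n r v then 1 else 0)) * (ind (s v) (s u) * m₀ (n * u + v)) := by
    intro r hr
    have hr := (Finset.mem_range.1 hr).le
    rw [← sum_lab hr]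
    refine Finset.sum_le_sum fun i hi => ?_
    rw [← sum_lab hr fun v => ((if n - q ≤ unlab n r (lab n r i) then 1 else 0) +
      (if n - q ≤ unlab n r v then 1 else 0)) *
        (ind (s v) (s (lab n r i)) * m₀ (n * lab n r i + v))]
    refine Finset.sum_le_sum fun j hj => ?_
    rw [unlab_lab hr (Finset.mem_range.1 hi), unlab_lab hr (Finset.mem_range.1 hj), adj]
    dsimp only
    generalize ind _ _ * m₀ _ = x
    split_ifs <;> omega
  refine (Finset.sum_le_sum h3).trans (le_of_eq ?_)
  rw [Finset.sum_comm, backSum, Finset.mul_sum]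
  refine Finset.sum_congr rfl fun u hu => ?_
  rw [Finset.sum_comm, Finset.mul_sum]
  refine Finset.sum_congr rfl fun v hv => ?_
  rw [← Finset.sum_mul, Finset.sum_add_distrib, sum_rotations hq (Finset.mem_range.1 hu),
    sum_rotations hq (Finset.mem_range.1 hv)]
  ring

theorem sum_adj_eq (hr : r ≤ n) (m₀ s : ℕ → ℕ) : ∑ i ∈ Finset.range n, ∑ j ∈ Finset.range n,
    ind (s (lab n r j)) (s (lab n r i)) * adj n r m₀ i j = backSum n m₀ s := by
  rw [backSum, ← sum_lab hr fun u => ∑ v ∈ Finset.range n, ind (s v) (s u) * m₀ (n * u + v)]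
  exact Finset.sum_congr rfl fun i _ =>
    sum_lab hr fun v => ind (s v) (s (lab n r i)) * m₀ (n * lab n r i + v)

/-- Every backward arc between `Z` and its complement is counted once on the left, and it is
incident to the window because `Z` lies there. -/
theorem sum_backDeg_le {q Z : ℕ} {a : ℕ → ℕ → ℕ} {π : ℕ → ℕ}
    (hZ : ∀ i < n, bit n Z i = 1 → n - q ≤ i) :
    ∑ x ∈ Finset.range n, bit n Z x * backDeg n a Z π x ≤ backTop n q a π := by
  have e : ∑ x ∈ Finset.range n, bit n Z x * backDeg n a Z π x =
      ∑ i ∈ Finset.range n, ∑ j ∈ Finset.range n, (bit n Z i * (1 - bit n Z j) +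
        bit n Z j * (1 - bit n Z i)) * (ind (π j) (π i) * a i j) := by
    simp only [backDeg, mul_add, add_mul, Finset.mul_sum, Finset.sum_add_distrib]
    congr 1
    · simp only [mul_assoc]
    · rw [Finset.sum_comm]
      simp only [mul_assoc]
  rw [e]
  refine Finset.sum_le_sum fun i hi => Finset.sum_le_sum fun j hj => ?_
  have h1 := hZ i (Finset.mem_range.1 hi)
  have h2 := hZ j (Finset.mem_range.1 hj)
  rcases Nat.le_one_iff_eq_zero_or_eq_one.1 (bit_le_one n Z i) with h3 | h3 <;>
    rcases Nat.le_one_iff_eq_zero_or_eq_one.1 (bit_le_one n Z j) with h4 | h4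
  · simp [h3, h4]
  · simp [h3, h4, h2 h4]
  · simp [h3, h4, h1 h3]
  · simp [h3, h4]

/-- For every ordering there is a candidate that is almost as good. -/
theorem exists_candidate (hn : 0 < n) (hm : ∀ a, m₀ a ≤ 1) {s : ℕ → ℕ} (hs : ∀ v < n, s v < n)
    (hinj : ∀ u < n, ∀ v < n, s u = s v → u = v) (k : ℕ) : ∃ r < n, ∃ mode < 2, ∃ T t,
      Candidate n k r mode m₀ t ∧ t < (T + 1) * (2 * n + 2) ^ n ∧
      T ≤ 11 * backSum n m₀ s ∧ k * T ≤ (k + 20) * backSum n m₀ s := by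
  set q := n / k with hq
  have hqn : q ≤ n := Nat.div_le_self _ _
  obtain ⟨r, hr, hβ⟩ := exists_rotation hn hqn m₀ s
  obtain ⟨A₀, hA₀, -, harcs, hset, -⟩ := search_spec (n := n) hm k r
  rw [← hq] at hA₀ harcs hset
  set a := adj n r m₀ with ha
  set π := fun i => s (lab n r i) with hπ
  set β := backTop n q a π with hβ'
  have hπn : ∀ i < n, π i < n := fun i _ => hs _ (lab_lt hn r i)
  have hπinj : ∀ i < n, ∀ j < n, π i = π j → i = j := fun i hi j hj h => by
    have := hinj _ (lab_lt hn r i) _ (lab_lt hn r j) h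
    rw [← unlab_lab hr.le hi, this, unlab_lab hr.le hj]
  have ha1 : ∀ i j, a i j ≤ 1 := fun i j => hm _
  have hsum : ∑ i ∈ Finset.range n, ∑ j ∈ Finset.range n, ind (π j) (π i) * a i j =
      backSum n m₀ s := sum_adj_eq hr.le m₀ s
  have hkβ : k * β ≤ 2 * backSum n m₀ s := by
    have h1 : k * q ≤ n := Nat.mul_div_le n k
    refine Nat.le_of_mul_le_mul_left ?_ hn
    calc n * (k * β) = k * (n * β) := by ring
      _ ≤ k * (2 * q * backSum n m₀ s) := Nat.mul_le_mul_left _ hβ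
      _ = k * q * (2 * backSum n m₀ s) := by ring
      _ ≤ n * (2 * backSum n m₀ s) := Nat.mul_le_mul_right _ h1
  have hβle : β ≤ backSum n m₀ s := by
    rw [← hsum]
    refine Finset.sum_le_sum fun i _ => Finset.sum_le_sum fun j _ => ?_
    split_ifs
    · exact le_rfl
    · exact Nat.zero_le _
  -- The excess consists of up to `8 * β` arcs inside the sparse set and `2 * β` for the thresholds.
  -- It becomes `20 * backSum / k` by `hkβ`, while `hβle` gives the factor `11`.
  suffices H : ∃ mode < 2, ∃ T t, Candidate n k r mode m₀ t ∧ t < (T + 1) * (2 * n + 2) ^ n ∧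
      T ≤ backSum n m₀ s + 10 * β by
    obtain ⟨mode, hmode, T, t, hC, ht, hT⟩ := H
    refine ⟨r, hr, mode, hmode, T, t, hC, ht, by omega, ?_⟩
    have := Nat.mul_le_mul_left k hT
    rw [mul_add, mul_left_comm] at this
    rw [add_mul]
    omega
  have hfst : ∀ Z, ∑ i ∈ Finset.range n, ∑ j ∈ Finset.range n,
      (1 - bit n Z i) * (1 - bit n Z j) * (ind (π j) (π i) * a i j) ≤ backSum n m₀ s := fun Z => by
    rw [← hsum]
    exact Finset.sum_le_sum fun i _ => Finset.sum_le_sum fun j _ =>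
      (Nat.mul_le_mul_right _ (Nat.mul_le_mul (Nat.sub_le _ _) (Nat.sub_le _ _))).trans (by simp)
  have finish : ∀ mode < 2, (∀ U, (∀ i < n, bit n U i = 1 →
        bit n (zset n q r mode (withSearch n k m₀)) i = 0) →
      (∀ i < n, ∀ j < n, bit n U i = 1 → bit n (zset n q r mode (withSearch n k m₀)) j = 0 →
        π j < π i → bit n U j = 1) → Good n q r mode (withSearch n k m₀) U) →
      ∃ c t, Candidate n k r mode m₀ t ∧
        t < (c + (1 - mode) * sparseArcs n q r (withSearch n k m₀) + 1) * (2 * n + 2) ^ n ∧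
        c ≤ backSum n m₀ s + ∑ x ∈ Finset.range n,
          bit n (zset n q r mode (withSearch n k m₀)) x *
            (2 * backDeg n a (zset n q r mode (withSearch n k m₀)) π x) := by
    intro mode hmode hgood
    obtain ⟨U, c, κ, hP, hU, hc⟩ := exists_path hπinj hπn ha1 hgood
    have hUeq : U = pw n 1 n - 1 - zset n q r mode (withSearch n k m₀) := by
      refine eq_of_bit_eq hP.lt ?_ fun i hi => ?_
      · rw [pw_eq le_rfl]
        have := Nat.two_pow_pos n
        simp only [one_add_one_eq_two]
        omega
      · rw [bit_compl (zset_lt hm hmode) hi]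
        have := hU i hi
        have := bit_le_one n U i
        have := bit_le_one n (zset n q r mode (withSearch n k m₀)) i
        rw [← hq]
        omega
    have hk := hP.keyInv fun U hU i hi hz => hU.disjoint hmode hi hz
    rw [hUeq] at hP
    refine ⟨c, _, ⟨c, κ, hP, rfl⟩, ?_, hc.trans (Nat.add_le_add_right (hfst _) _)⟩
    rw [pw_eq le_rfl, add_mul _ 1, one_mul]
    exact Nat.add_lt_add_left (code_lt hr.le hk.le) _
  -- If the sparse set has few arcs, paying for all of them is affordable and thresholds are used;
  -- otherwise the restriction on crossing arcs excludes no initial segment of the given ordering.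
  rcases le_or_gt (arcs n a (up n q A₀)) (8 * β) with hcase | hcase
  · obtain ⟨c, t, hC, ht, hc⟩ := finish 0 (by omega) fun U hU _ => by
      rw [Good, defect, zero_mul, zero_add, Nat.sub_zero, one_mul]
      refine Finset.sum_eq_zero fun i hi => ?_
      have h1 := hU i (Finset.mem_range.1 hi)
      rw [zset, Nat.sub_zero, one_mul] at h1
      rcases Nat.le_one_iff_eq_zero_or_eq_one.1 (bit_le_one n U i) with h2 | h2
      · rw [h2, mul_zero]
      · rw [h1 h2, zero_mul]
    refine ⟨0, by omega, _, t, hC, ht, ?_⟩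
    rw [zset, Nat.sub_zero, one_mul, hset] at hc
    rw [Nat.sub_zero, one_mul, harcs]
    have h1 : ∑ x ∈ Finset.range n, bit n (up n q A₀) x * backDeg n a (up n q A₀) π x ≤ β :=
      sum_backDeg_le fun i hi h => by
        rw [bit_up hi] at h
        split_ifs at h with h'
        omega
    have h2 : ∑ x ∈ Finset.range n, bit n (up n q A₀) x * (2 * backDeg n a (up n q A₀) π x) =
        2 * ∑ x ∈ Finset.range n, bit n (up n q A₀) x * backDeg n a (up n q A₀) π x := by
      rw [Finset.mul_sum]
      exact Finset.sum_congr rfl fun x _ => by ring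
    omega
  · obtain ⟨c, t, hC, ht, hc⟩ := finish 1 (by omega) fun U _ hU => by
      rw [Good, defect, Nat.sub_self, zero_mul, add_zero, one_mul, harcs, adj_withSearch hn, ← ha]
      -- An arc of the window entering an initial segment of `π` is backward, so it is among the
      -- arcs counted by `β`.
      suffices cross n q a U ≤ β by omega
      refine Finset.sum_le_sum fun i hi => Finset.sum_le_sum fun j hj => ?_
      have hi := Finset.mem_range.1 hi
      have hj := Finset.mem_range.1 hj
      rcases Nat.le_one_iff_eq_zero_or_eq_one.1 (bit_le_one n U i) with h3 | h3
      swap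
      · simp [h3]
      rcases Nat.le_one_iff_eq_zero_or_eq_one.1 (bit_le_one n U j) with h4 | h4
      · simp [h4]
      have h5 : π j < π i := by
        by_contra h5
        rcases Nat.lt_or_ge (π i) (π j) with h6 | h6
        · have := hU j hj i hi h4 (by simp [zset, bit_zero_left]) h6
          omega
        · have := hπinj i hi j hj (by omega)
          subst this
          omega
      unfold ind
      split_ifs with h6 h7 <;> first | omega | simp [h3, h4]
    refine ⟨1, by omega, _, t, hC, ht, ?_⟩
    simp only [zset, Nat.sub_self, zero_mul, bit_zero_left, Finset.sum_const_zero] at hc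
    omega

end

/-! ### The algorithm on the adjacency matrix of a digraph -/

section

variable {n : ℕ} {G : Digraph (Fin n)}

theorem adjMemory_le_one (G : Digraph (Fin n)) (a : ℕ) : adjMemory G a ≤ 1 := by
  unfold adjMemory
  split_ifs <;> omega

theorem adjMemory_eq_zero (G : Digraph (Fin n)) {a : ℕ} (ha : n * n ≤ a) : adjMemory G a = 0 := by
  refine if_neg ?_
  rintro ⟨u, v, rfl, -⟩
  have := Nat.mul_le_mul_left n (show (u : ℕ) + 1 ≤ n from u.2)
  have := v.2
  rw [mul_add] at *
  omega

open Classical in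
theorem adjMemory_apply (G : Digraph (Fin n)) (u v : Fin n) :
    adjMemory G (n * u + v) = if G.Adj u v then 1 else 0 := by
  refine if_congr ⟨?_, fun h => ⟨u, v, rfl, h⟩⟩ rfl rfl
  rintro ⟨u', v', h, h'⟩
  have hn : 0 < n := u.pos
  have hu : u = u' := by
    have := congrArg (· / n) h
    simpa [Nat.mul_add_div hn, Nat.div_eq_of_lt, Fin.ext_iff] using this
  subst hu
  have hv : v = v' := Fin.ext (by omega)
  rwa [hv]

theorem adjMemory_diag (hG : ∀ v, ¬ G.Adj v v) : ∀ u < n, adjMemory G (n * u + u) = 0 :=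
  fun u hu => (adjMemory_apply G ⟨u, hu⟩ ⟨u, hu⟩).trans (if_neg (hG _))

theorem numBackwardArcs_eq (hG : ∀ v, ¬ G.Adj v v) (σ : Fin n ≃ Fin n) {s : ℕ → ℕ}
    (hs : ∀ v : Fin n, s v = σ v) : numBackwardArcs G σ = backSum n (adjMemory G) s := by
  classical
  rw [numBackwardArcs, Set.ncard_eq_toFinset_card', Set.toFinset_ofPred, Finset.card_filter,
    Fintype.sum_prod_type, backSum, ← Fin.sum_univ_eq_sum_range]
  refine Finset.sum_congr rfl fun u _ => ?_
  rw [← Fin.sum_univ_eq_sum_range fun v => ind (s v) (s u) * adjMemory G (n * u + v)]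
  refine Finset.sum_congr rfl fun v _ => ?_
  dsimp only
  rw [adjMemory_apply, hs, hs, ind]
  by_cases h : G.Adj u v
  · have h1 : σ u ≠ σ v := fun h' => by
      rw [σ.injective h'] at h
      exact hG _ h
    have h2 : (σ v : ℕ) < σ u ↔ ¬ σ u < σ v := by
      rw [not_lt, Fin.lt_def.symm.trans (lt_iff_le_and_ne)]
      exact and_iff_left h1.symm
    simp only [h, h2, true_and, if_true, mul_one]
  · simp [h]

theorem backSum_le {m : ℕ → ℕ} (hm : ∀ a, m a ≤ 1) (s : ℕ → ℕ) : backSum n m s ≤ n * n := by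
  refine (Finset.sum_le_sum fun u _ => Finset.sum_le_sum fun v _ =>
    Nat.mul_le_mul (ind_le_one _ _) (hm _)).trans ?_
  simp

/-- The ordering found is almost as good as any other. -/
theorem MainInv.backSum_rank_le (hn : 0 < n) {k : ℕ} {m₀ m : ℕ → ℕ} (hm : ∀ a, m₀ a ≤ 1)
    (hdiag : ∀ u < n, m₀ (n * u + u) = 0) (h : MainInv n k m₀ (2 * n) m) {s : ℕ → ℕ}
    (hs : ∀ v < n, s v < n) (hinj : ∀ u < n, ∀ v < n, s u = s v → u = v) :
    k * backSum n m₀ (rank n (key n m)) ≤ (k + 20) * backSum n m₀ s := by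
  obtain ⟨r, hr, mode, hmode, T, t, hC, ht, hT, hkT⟩ := exists_candidate hn hm hs hinj k
  -- The good candidate has weight below `cap n`, so the best value is positive and does come from a
  -- candidate.
  have hcap : (T + 1) * (2 * n + 2) ^ n ≤ cap n := by
    have := backSum_le (n := n) hm s
    rw [cap, mul_comm]
    exact Nat.mul_le_mul_left _ (by nlinarith)
  have hbest := h.best.1 t ⟨r, mode, hmode, by omega, hC⟩
  rcases h.best.2 with h0 | ⟨t', ⟨r', mode', hmode', hr', hC'⟩, ht'⟩
  · omega
  · have h1 := hC'.backSum_le (by omega) hm hdiag hmode' (by omega) ht'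
    -- The weight found is at most `t`; dividing by the range of the sort keys leaves a cost of at
    -- most `T`.
    have h2 : t' / (2 * n + 2) ^ n < T + 1 :=
      Nat.div_lt_of_lt_mul (by rw [mul_comm]; omega)
    exact (Nat.mul_le_mul_left k (by omega)).trans hkT

end

/-- A bound on the cost of the algorithm, up to polynomial factors. -/
def timeBound (k n : ℕ) : ℕ :=
  2 + n * (11 + 6 * 2 ^ (n / k) +
    2 * (6 ^ (n / k / 4) * 2 ^ (n / k) / 7 ^ (n / k / 4) * (2 + 2 * 2 ^ (n - n / k))))

theorem exists_ordering {n : ℕ} (k : ℕ) {G : Digraph (Fin n)} (hG : ∀ v, ¬ G.Adj v v) :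
    ∃ π : Fin n ≃ Fin n, (∀ v : Fin n, (mainC k n (adjMemory G)).1 v = π v) ∧
      (∀ σ, k * numBackwardArcs G π ≤ (k + 20) * numBackwardArcs G σ) ∧
      (mainC k n (adjMemory G)).2 ≤ timeBound k n := by
  rcases n.eq_zero_or_pos with rfl | hn
  · refine ⟨Equiv.refl _, fun v => v.elim0, fun σ => ?_, Nat.le_add_right 2 _⟩
    rw [numBackwardArcs_eq hG _ (s := fun _ => 0) fun v => v.elim0]
    simp [backSum]
  have hm := adjMemory_le_one G
  have hdiag := adjMemory_diag hG
  obtain ⟨m, h1, h2, h3⟩ := mainC_spec (k := k) hn (fun a => adjMemory_eq_zero G)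
    (6 ^ (n / k / 4) * 2 ^ (n / k) / 7 ^ (n / k / 4)) fun r _ mode hmode =>
      (Nat.le_div_iff_mul_le (by positivity)).2 (numGood_le hn hm hdiag k r hmode)
  let f : Fin n → Fin n := fun v => ⟨rank n (key n m) v, rank_lt v.2⟩
  have hf : Function.Injective f := fun u v h =>
    Fin.ext (rank_inj u.2 v.2 (Fin.ext_iff.1 h))
  refine ⟨Equiv.ofBijective f (Finite.injective_iff_bijective.1 hf), fun v => h2 v v.2,
    fun σ => ?_, h3⟩
  let s : ℕ → ℕ := fun v => if h : v < n then σ ⟨v, h⟩ else 0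
  have hs : ∀ v (h : v < n), s v = σ ⟨v, h⟩ := fun v h => dif_pos h
  rw [numBackwardArcs_eq hG σ (s := s) fun v => hs v v.2,
    numBackwardArcs_eq hG _ (s := rank n (key n m)) fun v => rfl]
  refine h1.backSum_rank_le hn hm hdiag (fun v hv => ?_) fun u hu v hv h => ?_
  · rw [hs v hv]
    exact (σ _).2
  · rw [hs u hu, hs v hv] at h
    exact Fin.ext_iff.1 (σ.injective (Fin.ext h))

/-! ### The running time -/

theorem timeBound_le {k : ℕ} (hk : 2 ≤ k) (n : ℕ) :
    (timeBound k n : ℝ) ≤ 27 * (n + 2) * (2 ^ n * (6 / 7) ^ (n / k / 4)) := by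
  rw [timeBound]
  set q := n / k with hq
  set s := q / 4 with hs
  have h2q : q * 2 ≤ n := (Nat.mul_le_mul_left q hk).trans (Nat.div_mul_le_self n k)
  set x : ℝ := (6 / 7) ^ s with hx
  have hx0 : 0 < x := by positivity
  have hx1 : x ≤ 1 := pow_le_one₀ (by norm_num) (by norm_num)
  have hD : ((6 ^ s * 2 ^ q / 7 ^ s : ℕ) : ℝ) ≤ 2 ^ q * x := by
    refine Nat.cast_div_le.trans (le_of_eq ?_)
    rw [hx, div_pow]
    push_cast
    ring
  have hq1 : (1 : ℝ) ≤ 2 ^ q := one_le_pow₀ (by norm_num)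
  have hqn : (2 : ℝ) ^ q ≤ 2 ^ n := pow_le_pow_right₀ (by norm_num) (by omega)
  -- The search over the window is cheap: `2 * (6 / 7) ≥ 1`, and `q + s ≤ n` because `k ≥ 2`.
  have hqE : (2 : ℝ) ^ q ≤ 2 ^ n * x := by
    have h1 : (1 : ℝ) ≤ 2 ^ s * x := by
      rw [hx, ← mul_pow]
      exact one_le_pow₀ (by norm_num)
    calc (2 : ℝ) ^ q ≤ 2 ^ q * (2 ^ s * x) := le_mul_of_one_le_right (by positivity) h1
      _ = 2 ^ (q + s) * x := by rw [pow_add, mul_assoc]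
      _ ≤ _ := mul_le_mul_of_nonneg_right
        (pow_le_pow_right₀ (by norm_num) (by omega)) hx0.le
  have hsplit : (2 : ℝ) ^ q * 2 ^ (n - q) = 2 ^ n := by
    rw [← pow_add, Nat.add_sub_cancel' (by omega)]
  set E : ℝ := 2 ^ n * x with hE
  have hDE : ((6 ^ s * 2 ^ q / 7 ^ s : ℕ) : ℝ) * (2 + 2 * 2 ^ (n - q)) ≤ 4 * E := by
    calc _ ≤ 2 ^ q * x * (2 + 2 * 2 ^ (n - q)) :=
          mul_le_mul_of_nonneg_right hD (by positivity)
      _ = 2 * (2 ^ q * x) + 2 * (2 ^ q * 2 ^ (n - q) * x) := by ring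
      _ ≤ 2 * E + 2 * E := by
        rw [hsplit]
        exact add_le_add_left (mul_le_mul_of_nonneg_left
          (mul_le_mul_of_nonneg_right hqn hx0.le) (by norm_num)) _
      _ = _ := by ring
  have hn : (0 : ℝ) ≤ n := Nat.cast_nonneg n
  have hin : (11 + 6 * 2 ^ q + 2 * (((6 ^ s * 2 ^ q / 7 ^ s : ℕ) : ℝ) * (2 + 2 * 2 ^ (n - q))) : ℝ) ≤
      25 * E := by linarith
  have := mul_le_mul_of_nonneg_left hin hn
  push_cast at this ⊢
  nlinarith

/-- Bernoulli's inequality gives `(1 - 1 / (28 * k)) ^ (4 * k) ≥ 1 - 1 / 7`, and `4 * k * (n / k / 4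
+ 1)` is at least `n` despite the two roundings. -/
theorem six_sevenths_pow_le {k : ℕ} (hk : 0 < k) (n : ℕ) :
    (6 / 7 : ℝ) ^ (n / k / 4 + 1) ≤ (1 - 1 / (28 * k)) ^ n := by
  have hk' : (1 : ℝ) ≤ k := by exact_mod_cast hk
  have h1 : (1 : ℝ) / (28 * k) ≤ 1 := (div_le_one (by positivity)).2 (by linarith)
  have h2 : (6 / 7 : ℝ) ≤ (1 - 1 / (28 * k)) ^ (4 * k) := by
    have := one_add_mul_le_pow (a := -(1 / (28 * k : ℝ))) (by linarith) (4 * k)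
    rw [← sub_eq_add_neg] at this
    refine le_trans (le_of_eq ?_) this
    push_cast
    field_simp
    norm_num
  have h3 : n ≤ 4 * k * (n / k / 4 + 1) := by
    have h4 : n < k * (n / k + 1) := Nat.lt_mul_div_succ n hk
    have h5 : k * (n / k + 1) ≤ k * (4 * (n / k / 4 + 1)) := Nat.mul_le_mul_left _ (by omega)
    rw [mul_comm 4 k, mul_assoc]
    omega
  calc (6 / 7 : ℝ) ^ (n / k / 4 + 1) ≤ ((1 - 1 / (28 * k)) ^ (4 * k)) ^ (n / k / 4 + 1) :=
        pow_le_pow_left₀ (by norm_num) h2 _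
    _ = (1 - 1 / (28 * k)) ^ (4 * k * (n / k / 4 + 1)) := (pow_mul _ _ _).symm
    _ ≤ _ := pow_le_pow_of_le_one (by linarith)
      (by have : (0 : ℝ) ≤ 1 / (28 * k) := by positivity
          linarith) h3

theorem isBigO_timeBound {k : ℕ} (hk : 2 ≤ k) {b : ℕ → ℕ} (hb : PolyBdd b) :
    (fun n => ((b n * timeBound k n : ℕ) : ℝ)) =O[atTop] fun n => (2 - 1 / (28 * k) : ℝ) ^ n := by
  obtain ⟨c, hc⟩ := hb
  have hk' : (2 : ℝ) ≤ k := by exact_mod_cast hk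
  set δ : ℝ := 1 / (28 * k) with hδ
  have hδ0 : 0 < δ := by positivity
  have hδ1 : δ ≤ 1 := (div_le_one (by positivity)).2 (by linarith)
  -- The base `2 * (1 - δ) = 2 - 2 * δ` is strictly below `2 - δ`, and this gap absorbs every
  -- polynomial factor.
  have hlo : (fun n : ℕ => (n : ℝ) ^ (c + 1) * (2 * (1 - δ)) ^ n) =O[atTop]
      fun n : ℕ => (2 - δ) ^ n := by
    refine (isLittleO_pow_const_mul_const_pow_const_pow_of_norm_lt (c + 1) ?_).isBigO
    rw [Real.norm_of_nonneg (by linarith)]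
    linarith
  refine IsBigO.trans (IsBigO.of_bound (3 ^ (c + 1) * 27 * (7 / 6)) ?_) hlo
  filter_upwards [eventually_ge_atTop 1] with n hn
  have hn' : (1 : ℝ) ≤ n := by exact_mod_cast hn
  have h1 : (b n : ℝ) ≤ (3 * n) ^ c := by
    have : (b n : ℝ) ≤ (n + 2) ^ c := by exact_mod_cast hc n
    exact this.trans (pow_le_pow_left₀ (by positivity) (by linarith) c)
  have h2 := six_sevenths_pow_le (k := k) (by omega) n
  rw [pow_succ, ← hδ] at h2
  have h3 : (timeBound k n : ℝ) ≤ 27 * (3 * n) * (2 ^ n * (7 / 6 * (1 - δ) ^ n)) := by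
    refine (timeBound_le hk n).trans ?_
    gcongr <;> linarith
  rw [Real.norm_of_nonneg (by positivity), Real.norm_of_nonneg
    (mul_nonneg (by positivity) (pow_nonneg (by linarith) n)), Nat.cast_mul]
  refine (mul_le_mul h1 h3 (by positivity) (by positivity)).trans (le_of_eq ?_)
  rw [mul_pow 2, mul_pow, pow_succ, pow_succ]
  ring

end RAM

/-! ### Conclusion: the choice of constants -/

theorem mainTheorem1 (ε : ℝ) (hε : 0 < ε) :
    ∃ δ : ℝ, 0 < δ ∧ δ < 1 ∧
      ∃ (P : RAM.Program) (T : ℕ → ℕ),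
        (fun n : ℕ => (T n : ℝ)) =O[atTop] (fun n : ℕ => (2 - δ) ^ n) ∧
        RAM.ApproximatesFAS P (1 + ε) T := by
  obtain ⟨k₀, hk₀⟩ := exists_nat_ge (20 / ε)
  -- The approximation factor is `1 + 20 / k`, and `k ≥ 2` is needed for the time bound.
  obtain ⟨k, hk, hkε⟩ : ∃ k : ℕ, 2 ≤ k ∧ 20 ≤ k * ε := by
    refine ⟨k₀ + 2, by omega, ?_⟩
    rw [div_le_iff₀ hε] at hk₀
    push_cast
    nlinarith
  have hk' : (2 : ℝ) ≤ k := by exact_mod_cast hk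
  obtain ⟨P, b, hb, hP⟩ := RAM.CompC.exists_program (RAM.compC_mainC k)
  refine ⟨1 / (28 * k), by positivity, ?_, P, fun n => b n * RAM.timeBound k n,
    RAM.isBigO_timeBound hk hb, fun n G hG => ?_⟩
  · rw [div_lt_one (by positivity)]
    linarith
  obtain ⟨π, hπ, hπσ, htime⟩ := RAM.exists_ordering k hG
  obtain ⟨t, d, hhalt, ht, hd⟩ := hP n (fun r => if r = 0 then n else 0) (RAM.adjMemory G) (if_pos rfl)
    fun a => RAM.le_cap ((RAM.adjMemory_le_one G a).trans (by omega))
  refine ⟨t, d, π, hhalt, ht.trans (Nat.mul_le_mul_left _ htime), fun v => hd ▸ hπ v, fun σ => ?_⟩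
  have h : (k : ℝ) * numBackwardArcs G π ≤ (k + 20) * numBackwardArcs G σ := by
    exact_mod_cast hπσ σ
  have h0 : (0 : ℝ) ≤ numBackwardArcs G σ := Nat.cast_nonneg _
  refine le_of_mul_le_mul_left (h.trans ?_) (show (0 : ℝ) < k by linarith)
  nlinarith
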